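/- **Theorem (Factorisation theorem).** Let $\kappa$ be an arbitrary field and let $C$ be a reduced scheme of finite type over $\kappa$ all of whose irreducible components have dimension $1$. Let $\nu\colon \widetilde{C}\to C$ be the normalisation of $C$, i.e. the normalisation of $C$ in the disjoint union of the spectra of the function fields of its irreducible components. A scheme $S$ is called *seminormal* if for every affine open $U\subseteq S$ and all $x,y\in\Gamma(U,\mathcal{O}_U)$ with $x^3=y^2$ there is a unique $a\in\Gamma(U,\mathcal{O}_U)$ with $x=a^2$ and $y=a^3$. The *seminormalisation* $\varsigma\colon C^{\mathrm{sn}}\to C$ is the initial object among the universal homeomorphisms $S'\to C$ which induce isomorphisms on all residue fields; i.e. $\varsigma$ is itself such a morphism, and for each such $S'\to C$ there is a unique $C$-morphism $C^{\mathrm{sn}}\to S'$. A commutative square of schemes is *co-Cartesian* if it is a push-out square in the category of schemes. The seminormalisation $\varsigma\colon C^{\mathrm{sn}}\to C$ exists, there is a unique morphism $\widetilde{\varsigma}\colon\widetilde{C}\to C^{\mathrm{sn}}$ with $\nu=\varsigma\circ\widetilde{\varsigma}$, and the following assertions hold. (i) If $C$ is not seminormal, then $\varsigma$ can be written as a composition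 $$C^{\mathrm{sn}}=C_1\overset{\varsigma_1}{\to}\cdots\overset{\varsigma_{n-1}}{\to}C_n=C$$ for some $n\geq 2$ such that, for each $i=1,\dots,n-1$, there are a closed point $x_{i+1}\in C_{i+1}$ with residue field $\kappa(x_{i+1})$ and a closed immersion $\operatorname{Spec}\kappa(x_{i+1})[\epsilon]/\langle\epsilon^2\rangle\to C_i$ such that the diagram $$\begin{array}{ccc} C_i & \overset{\varsigma_i}{\longrightarrow} & C_{i+1}\\ \uparrow & & \uparrow\\ \operatorname{Spec}\kappa(x_{i+1})[\epsilon]/\langle\epsilon^2\rangle & \longrightarrow & \operatorname{Spec}\kappa(x_{i+1})\end{array}$$ is co-Cartesian, where the lower and the right-hand arrows are the canonical ones. (ii) The set of points of $C^{\mathrm{sn}}$ whose local ring is not regular is closed; let $C^{\mathrm{sn},\mathrm{sing}}\subseteq C^{\mathrm{sn}}$ denote this set endowed with its reduced subscheme structure. Then the diagram $$\begin{array}{ccc} \widetilde{C} & \overset{\widetilde{\varsigma}}{\longrightarrow} & C^{\mathrm{sn}}\\ \uparrow & & \uparrow\\ \widetilde{C}\times_{C^{\mathrm{sn}}}C^{\mathrm{sn},\mathrm{sing}}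 & \longrightarrow & C^{\mathrm{sn},\mathrm{sing}}\end{array}$$ is co-Cartesian. Moreover, all scheme-theoretic fibres of $\widetilde{\varsigma}\colon\widetilde{C}\to C^{\mathrm{sn}}$ are reduced. -/

import Mathlib

open CategoryTheory CategoryTheory.Limits AlgebraicGeometry

universe u

noncomputable section

namespace FactorisationTheorem

/-- A scheme is purely one-dimensional if all its irreducible components have dimension one. -/
def IsPurelyOneDimensional (X : Scheme.{u}) : Prop :=
  ∀ Z ∈ irreducibleComponents X, topologicalKrullDim Z = 1

/-- A scheme `X` is seminormal if, for each affine open `U` and all sections `x`, `y` over `U` with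
`x ^ 3 = y ^ 2`, there is a unique section `a` over `U` with `x = a ^ 2` and `y = a ^ 3`. -/
def IsSeminormal (X : Scheme.{u}) : Prop :=
  ∀ U : X.Opens, IsAffineOpen U → ∀ x y : Γ(X, U), x ^ 3 = y ^ 2 →
    ∃! a : Γ(X, U), x = a ^ 2 ∧ y = a ^ 3

/-- A universal homeomorphism: every base change is a homeomorphism of the underlying spaces. -/
def IsUniversalHomeomorphism {X Y : Scheme.{u}} (f : X ⟶ Y) : Prop :=
  (topologically @IsHomeomorph).universally f

/-- A universal homeomorphism which induces isomorphisms on all residue fields. -/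
structure IsResidualUniversalHomeomorphism {X Y : Scheme.{u}} (f : X ⟶ Y) : Prop where
  isUniversalHomeomorphism : IsUniversalHomeomorphism f
  isIso_residueFieldMap : ∀ x : X, IsIso (f.residueFieldMap x)

/-- `f : X ⟶ S` is a seminormalisation of `S`: it is initial among the universal homeomorphisms
to `S` which induce isomorphisms on all residue fields. -/
structure IsSeminormalisation {X S : Scheme.{u}} (f : X ⟶ S) : Prop where
  isResidualUniversalHomeomorphism : IsResidualUniversalHomeomorphism f
  existsUnique_lift : ∀ (S' : Scheme.{u}) (g : S' ⟶ S), IsResidualUniversalHomeomorphism g →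
    ∃! h : X ⟶ S', h ≫ g = f

/-- The disjoint union of the spectra of the residue fields at the generic points of the
irreducible components of `S`. For a reduced scheme these residue fields are the function fields
of the irreducible components. -/
def genericScheme (S : Scheme.{u}) : Scheme.{u} :=
  ∐ fun x : genericPoints S => Spec (S.residueField x.1)

/-- The canonical morphism from the disjoint union of the spectra of the function fields. -/
def genericSchemeMap (S : Scheme.{u}) : genericScheme S ⟶ S :=
  Sigma.desc fun x : genericPoints S => S.fromSpecResidueField x.1

instance finite_genericPoints (S : Scheme.{u}) [IsNoetherian S] : Finite (genericPoints S) :=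
  (genericPoints.finite TopologicalSpace.NoetherianSpace.finite_irreducibleComponents).to_subtype

instance isAffine_genericScheme (S : Scheme.{u}) [IsNoetherian S] : IsAffine (genericScheme S) := by
  unfold genericScheme
  infer_instance

instance quasiCompact_genericSchemeMap (S : Scheme.{u}) [IsNoetherian S] :
    QuasiCompact (genericSchemeMap S) := by
  infer_instance

instance quasiSeparated_genericSchemeMap (S : Scheme.{u}) [IsNoetherian S] :
    QuasiSeparated (genericSchemeMap S) := by
  infer_instance

/-- The normalisation of a reduced Noetherian scheme `S`: the relative normalisation of `S` in the
disjoint union of the spectra of the function fields of its irreducible components. -/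
def normalisation (S : Scheme.{u}) [IsNoetherian S] : Scheme.{u} :=
  (genericSchemeMap S).normalization

/-- The normalisation morphism. -/
def normalisationMap (S : Scheme.{u}) [IsNoetherian S] : normalisation S ⟶ S :=
  (genericSchemeMap S).fromNormalization

theorem isNoetherian_of_finiteType {κ : Type u} [Field κ] {C : Scheme.{u}}
    (f : C ⟶ Spec (CommRingCat.of κ)) [LocallyOfFiniteType f] [QuasiCompact f] :
    IsNoetherian C := by
  have := LocallyOfFiniteType.isLocallyNoetherian f
  have : CompactSpace C := (quasiCompact_iff_compactSpace f).1 inferInstance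
  exact {}

/-- The set of points of `X` whose local ring is not regular. -/
def nonRegularLocus (X : Scheme.{u}) : Set X :=
  {x | ¬ IsRegularLocalRing (X.presheaf.stalk x)}

/-- `f : X ⟶ Y` is the push-out, in the category of schemes, along the canonical morphism
`Spec κ(y)[ε]/⟨ε²⟩ ⟶ Spec κ(y)` via a closed immersion `Spec κ(y)[ε]/⟨ε²⟩ ⟶ X`,
for some closed point `y` of `Y`. -/
def IsDualNumberPushout {X Y : Scheme.{u}} (f : X ⟶ Y) : Prop :=
  ∃ y : Y, IsClosed ({y} : Set Y) ∧
    ∃ i : Spec (CommRingCat.of (DualNumber (Y.residueField y))) ⟶ X, IsClosedImmersion i ∧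
      IsPushout i
        (Spec.map (CommRingCat.ofHom
          (algebraMap (Y.residueField y) (DualNumber (Y.residueField y)))))
        f (Y.fromSpecResidueField y)

/-- `f` is a composition of finitely many (at least one) morphisms, each of which is a push-out as
in `IsDualNumberPushout`. -/
inductive IsDualNumberPushoutChain : ∀ {X Y : Scheme.{u}}, (X ⟶ Y) → Prop
  | single {X Y : Scheme.{u}} (f : X ⟶ Y) (hf : IsDualNumberPushout f) :
      IsDualNumberPushoutChain f
  | cons {X Y Z : Scheme.{u}} (f : X ⟶ Y) (g : Y ⟶ Z) (hf : IsDualNumberPushout f)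
      (hg : IsDualNumberPushoutChain g) : IsDualNumberPushoutChain (f ≫ g)

/-- The closed subset `Z` of `X`, endowed with its reduced subscheme structure. -/
def reducedSubscheme (X : Scheme.{u}) (Z : TopologicalSpace.Closeds X) : Scheme.{u} :=
  (Scheme.IdealSheafData.vanishingIdeal Z).subscheme

/-- The closed immersion of a closed subset with its reduced subscheme structure. -/
def reducedSubschemeMap (X : Scheme.{u}) (Z : TopologicalSpace.Closeds X) :
    reducedSubscheme X Z ⟶ X :=
  (Scheme.IdealSheafData.vanishingIdeal Z).subschemeι

end FactorisationTheorem

end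

open FactorisationTheorem

/-! The seminormalisation is built from the normalisation `N` of `C`. Over an affine open of `C` its
sections are the sections of `N` whose values along each fibre are one and the same element of the
residue field of `C` (`gluedSections`). On a reduced scheme a section is determined by its values,
and the values of sections are the only data that a universal homeomorphism with trivial residue
extensions leaves unchanged. If `T` is such a universal homeomorphism over `C`, then `N` maps to
`T`, because the generic points lift and `T` is integral over `C`. Sections of `T` become glued
sections on `N`, and this gives the map from the scheme of glued sections to `T`
(`IsGluedFactorization.exists_lift`).

Everything else rests on finiteness of the normalisation over an arbitrary field. It is proved by
Noether normalisation, after adjoining `p ^ n`-th roots to make the function field extension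
separable. Finiteness gives a conductor element `f` that lies only in maximal ideals. Hence
normalisation modulo base has finite length locally, and a point is regular exactly when some
conductor element does not vanish there (`HasConductor`).

For (i), let `π : X ⟶ C` be a finite universal homeomorphism of reduced schemes with trivial residue
extensions. If `π` is unramified, its diagonal is a surjective open immersion, so `π` is a finite
monomorphism and therefore an isomorphism. Otherwise some nonzero derivation into a residue field
yields a tangent vector, that is, a closed `Spec κ[ε]` in `X` contracted by `π`. Pinching it gives a
scheme strictly between `X` and `C`. Repeating this stops by finite length
(`isDualNumberPushoutChain_of_not_isIso`). When the seminormalisation is an isomorphism, `C` is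
seminormal: the root `y / x` of `x ^ 3 = y ^ 2` is integral and its values lie in the residue fields
of `C`, so it is glued.

For (ii), the map from `N` is bijective with trivial residue extensions over regular points. A
section of `N` that agrees over the singular locus with a section of that locus therefore differs
from a section of the seminormalisation by a glued section. This is the push-out property on
sections (`isPushout_of_sections`). Fibres are reduced because a section vanishing at one point of a
fibre becomes glued after multiplication by sections that are units there and vanish at the other
relevant points. It then comes from a section below that vanishes at the base point, so it dies in
the fibre. -/

/-! ### Finiteness of the integral closure of a finitely generated domain over a field. -/

/-- Some power of an algebraic element by the exponential characteristic is separable. -/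
theorem exists_isSeparable_pow_expChar {F E : Type*} [Field F] [Field E] [Algebra F E]
    (p : ℕ) [hp : ExpChar F p] {t : E} (ht : IsIntegral F t) :
    ∃ n : ℕ, IsSeparable F (t ^ p ^ n) := by
  obtain ⟨g, hg, n, hgn⟩ := (minpoly.irreducible ht).hasSeparableContraction p
  refine ⟨n, ?_⟩
  have h0 : Polynomial.aeval (t ^ p ^ n) g = 0 := by
    rw [← Polynomial.expand_aeval, hgn, minpoly.aeval]
  exact hg.of_dvd (minpoly.dvd F _ h0)

theorem exists_uniform_isSeparable_pow_expChar {F E : Type*} [Field F] [Field E] [Algebra F E]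
    (p : ℕ) [hp : ExpChar F p] (T : Finset E) (hT : ∀ t ∈ T, IsIntegral F t) :
    ∃ n : ℕ, ∀ t ∈ T, IsSeparable F (t ^ p ^ n) := by
  classical
  induction T using Finset.induction_on with
  | empty => exact ⟨0, by simp⟩
  | insert a s _ ih =>
    obtain ⟨n, hn⟩ := ih fun t ht ↦ hT t (Finset.mem_insert_of_mem ht)
    obtain ⟨m, hm⟩ := exists_isSeparable_pow_expChar p (hT a (Finset.mem_insert_self _ _))
    refine ⟨n + m, fun t ht ↦ ?_⟩
    rw [← mem_separableClosure_iff] at hm ⊢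
    rcases Finset.mem_insert.1 ht with rfl | ht
    · rw [add_comm, pow_add, pow_mul]
      exact pow_mem hm _
    · have := hn t ht
      rw [← mem_separableClosure_iff] at this
      rw [pow_add, pow_mul]
      exact pow_mem this _

/-- An element of a finitely generated function field has its image under a field endomorphism
defined by finitely many scalars. -/
theorem exists_finset_mem_adjoin_image {κ Ω ι : Type*} [Field κ] [Field Ω] [Algebra κ Ω]
    (x : ι → Ω) (φ : Ω →+* Ω) {z : Ω} (hz : z ∈ IntermediateField.adjoin κ (Set.range x)) :
    ∃ S : Finset κ, φ z ∈ IntermediateField.adjoin κ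
      ((fun c ↦ φ (algebraMap κ Ω c)) '' (S : Set κ) ∪ Set.range fun i ↦ φ (x i)) := by
  classical
  have mono {S S' : Finset κ} (h : S ⊆ S') : IntermediateField.adjoin κ
      ((fun c ↦ φ (algebraMap κ Ω c)) '' (S : Set κ) ∪ Set.range fun i ↦ φ (x i)) ≤
      IntermediateField.adjoin κ
      ((fun c ↦ φ (algebraMap κ Ω c)) '' (S' : Set κ) ∪ Set.range fun i ↦ φ (x i)) :=
    IntermediateField.adjoin.mono _ _ _
      (Set.union_subset_union_left _ (Set.image_mono (by exact_mod_cast h)))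
  induction hz using IntermediateField.adjoin_induction with
  | mem y hy =>
    obtain ⟨i, rfl⟩ := hy
    exact ⟨∅, IntermediateField.subset_adjoin _ _ (Or.inr ⟨i, rfl⟩)⟩
  | algebraMap c =>
    exact ⟨{c}, IntermediateField.subset_adjoin _ _ (Or.inl ⟨c, by simp, rfl⟩)⟩
  | add a b _ _ ha hb =>
    obtain ⟨S, hS⟩ := ha
    obtain ⟨S', hS'⟩ := hb
    refine ⟨S ∪ S', ?_⟩
    rw [map_add]
    exact add_mem (mono Finset.subset_union_left hS) (mono Finset.subset_union_right hS')
  | mul a b _ _ ha hb =>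
    obtain ⟨S, hS⟩ := ha
    obtain ⟨S', hS'⟩ := hb
    refine ⟨S ∪ S', ?_⟩
    rw [map_mul]
    exact mul_mem (mono Finset.subset_union_left hS) (mono Finset.subset_union_right hS')
  | inv a _ ha =>
    obtain ⟨S, hS⟩ := ha
    refine ⟨S, ?_⟩
    rw [map_inv₀]
    exact inv_mem hS

/-- A finite set of elements is separable over a field generated by roots of finitely many scalars
and of the variables. -/
theorem exists_finset_isSeparable_adjoin {κ Ω ι : Type*} [Field κ] [Field Ω] [Algebra κ Ω]
    [IsAlgClosed Ω] (p : ℕ) [ExpChar Ω p] (x : ι → Ω) (T : Finset Ω)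
    (hT : ∀ t ∈ T, IsIntegral (IntermediateField.adjoin κ (Set.range x)) t) :
    ∃ (n : ℕ) (S : Finset κ), ∀ t ∈ T, IsSeparable (IntermediateField.adjoin κ
      ((fun c ↦ (iterateFrobeniusEquiv Ω p n).symm (algebraMap κ Ω c)) '' (S : Set κ) ∪
        Set.range fun i ↦ (iterateFrobeniusEquiv Ω p n).symm (x i))) t := by
  classical
  have : ExpChar (IntermediateField.adjoin κ (Set.range x)) p :=
    (algebraMap (IntermediateField.adjoin κ (Set.range x)) Ω).expChar
      (algebraMap (IntermediateField.adjoin κ (Set.range x)) Ω).injective p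
  obtain ⟨n, hn⟩ := exists_uniform_isSeparable_pow_expChar p T hT
  refine ⟨n, ?_⟩
  set φ : Ω →+* Ω := (iterateFrobeniusEquiv Ω p n).symm.toRingHom with hφ
  have h1 : ∀ z ∈ IntermediateField.adjoin κ (Set.range x), ∃ S : Finset κ,
      φ z ∈ IntermediateField.adjoin κ
      ((fun c ↦ φ (algebraMap κ Ω c)) '' (S : Set κ) ∪ Set.range fun i ↦ φ (x i)) :=
    fun z hz ↦ exists_finset_mem_adjoin_image x φ hz
  choose! S hS using h1
  refine ⟨T.biUnion fun t ↦ ((minpoly (IntermediateField.adjoin κ (Set.range x))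
    (t ^ p ^ n)).coeffs).biUnion fun c ↦ S c, fun t ht ↦ ?_⟩
  set g := minpoly (IntermediateField.adjoin κ (Set.range x)) (t ^ p ^ n) with hg
  set S' := T.biUnion fun t ↦ ((minpoly (IntermediateField.adjoin κ (Set.range x))
    (t ^ p ^ n)).coeffs).biUnion fun c ↦ S c with hS'
  set F' := IntermediateField.adjoin κ
      ((fun c ↦ φ (algebraMap κ Ω c)) '' (S' : Set κ) ∪ Set.range fun i ↦ φ (x i)) with hF'
  change IsSeparable F' t
  -- Taking `p ^ n`-th roots of the coefficients of the separable polynomial of `t ^ p ^ n` gives a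
  -- separable polynomial that vanishes at `t` itself. Only finitely many coefficients occur, so
  -- finitely many roots of scalars suffice.
  set h : Polynomial Ω := g.map (φ.comp (algebraMap _ Ω)) with hh
  have hlift : h ∈ Polynomial.lifts (algebraMap F' Ω) := by
    rw [Polynomial.lifts_iff_coeff_lifts]
    intro k
    by_cases hk : g.coeff k = 0
    · exact ⟨0, by simp [hh, hk]⟩
    · have hmem : φ (algebraMap _ Ω (g.coeff k)) ∈ F' := by
        refine IntermediateField.adjoin.mono κ _ _ ?_ (hS _ (g.coeff k).2)
        refine Set.union_subset_union_left _ (Set.image_mono ?_)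
        intro c hc
        simp only [hS', Finset.coe_biUnion, Set.mem_iUnion]
        exact ⟨t, ht, _, Polynomial.coeff_mem_coeffs hk, hc⟩
      exact ⟨⟨_, hmem⟩, by simp [hh]⟩
  obtain ⟨h', hh'⟩ := Polynomial.mem_lifts _ |>.1 hlift
  have hsep : h'.Separable := by
    rw [← Polynomial.separable_map (algebraMap F' Ω), hh', hh, Polynomial.separable_map]
    exact hn t ht
  refine hsep.of_dvd (minpoly.dvd F' _ ?_)
  have ht' : φ (t ^ p ^ n) = t := by
    rw [← iterateFrobeniusEquiv_def Ω p n]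
    exact (iterateFrobeniusEquiv Ω p n).symm_apply_apply t
  rw [Polynomial.aeval_def, ← Polynomial.eval_map, hh', hh, Polynomial.eval_map]
  conv_lhs => rw [← ht']
  rw [← Polynomial.hom_eval₂, ← Polynomial.aeval_def, hg, minpoly.aeval, map_zero]

/-- Roots of algebraically independent elements are algebraically independent. -/
theorem algebraicIndependent_iterateFrobeniusEquiv_symm {κ Ω ι : Type*} [Field κ] [Field Ω]
    [Algebra κ Ω] [IsAlgClosed Ω] (p : ℕ) [ExpChar Ω p] (n : ℕ) {x : ι → Ω}
    (hx : AlgebraicIndependent κ x) :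
    AlgebraicIndependent κ fun i ↦ (iterateFrobeniusEquiv Ω p n).symm (x i) := by
  have : ExpChar κ p := (algebraMap κ Ω).expChar (algebraMap κ Ω).injective p
  refine AlgebraicIndependent.of_ringHom_of_comp_eq (S := κ) (B := Ω) (iterateFrobenius κ p n)
    (iterateFrobeniusEquiv Ω p n) ?_ (iterateFrobenius κ p n).injective ?_
  · convert hx using 1
    ext i
    exact ((iterateFrobeniusEquiv Ω p n).apply_symm_apply (x i))
  · ext c
    simp [iterateFrobenius_def]

theorem isIntegrallyClosed_adjoin_of_algebraicIndependent {κ Ω ι : Type*} [Field κ] [Field Ω]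
    [Algebra κ Ω] {x : ι → Ω} (hx : AlgebraicIndependent κ x) :
    IsIntegrallyClosed (Algebra.adjoin κ (Set.range x)) := by
  let e := hx.aevalEquiv
  have : IsIntegrallyClosed (MvPolynomial ι κ) := inferInstance
  exact IsIntegrallyClosed.of_equiv e.toRingEquiv

theorem isNoetherianRing_adjoin_range {κ Ω ι : Type*} [Field κ] [Field Ω]
    [Algebra κ Ω] [Finite ι] (x : ι → Ω) :
    IsNoetherianRing (Algebra.adjoin κ (Set.range x)) :=
  have : Algebra.FiniteType κ (Algebra.adjoin κ (Set.range x)) :=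
    (Subalgebra.fg_iff_finiteType _).1 (Subalgebra.fg_def.2 ⟨_, Set.finite_range x, rfl⟩)
  Algebra.FiniteType.isNoetherianRing κ _

/-- The elements of a finite separable extension which are integral over an integrally closed
Noetherian domain are contained in a finitely generated module. -/
theorem exists_fg_of_isSeparable {P F Ω : Type*} [CommRing P] [IsDomain P] [Field F] [Field Ω]
    [IsIntegrallyClosed P] [IsNoetherianRing P] [Algebra P F] [IsFractionRing P F] [Algebra F Ω]
    [Algebra P Ω] [IsScalarTower P F Ω] (T : Finset Ω) (hsep : ∀ t ∈ T, IsSeparable F t) :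
    ∃ N : Submodule P Ω, N.FG ∧
      ∀ z ∈ IntermediateField.adjoin F (T : Set Ω), IsIntegral P z → z ∈ N := by
  set L := IntermediateField.adjoin F (T : Set Ω) with hL
  have : Algebra.IsSeparable F L :=
    (IntermediateField.isSeparable_adjoin_iff_isSeparable F Ω).2 hsep
  have : FiniteDimensional F L :=
    IntermediateField.finiteDimensional_adjoin fun t ht ↦ (hsep t ht).isIntegral
  have : IsScalarTower P L Ω := .of_algebraMap_eq fun z ↦ by
    rw [IsScalarTower.algebraMap_apply P F Ω, IsScalarTower.algebraMap_apply P F L,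
      ← IsScalarTower.algebraMap_apply F L Ω]
  have hC : Module.Finite P (integralClosure P L) := IsIntegralClosure.finite P F L _
  let ψ : integralClosure P L →ₗ[P] Ω :=
    ((IsScalarTower.toAlgHom P L Ω).comp (integralClosure P L).val).toLinearMap
  refine ⟨LinearMap.range ψ, Module.Finite.iff_fg.1 inferInstance, fun z hz hzi ↦ ?_⟩
  exact ⟨⟨⟨z, hz⟩, (isIntegral_algHom_iff (IsScalarTower.toAlgHom P L Ω)
        (algebraMap L Ω).injective).1 hzi⟩, rfl⟩

/-- An algebra generated over a finite field extension by roots of elements of the base ring is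
finite. -/
theorem finite_of_adjoin_eq_top_of_pow_mem {κ κ' P P' ι : Type*} [Field κ] [Field κ']
    [Algebra κ κ'] [FiniteDimensional κ κ'] [CommRing P] [CommRing P'] [Algebra κ P] [Algebra κ P']
    [Algebra κ' P'] [Algebra P P'] [IsScalarTower κ κ' P'] [IsScalarTower κ P P'] [Finite ι]
    {y : ι → P'} (hy : Algebra.adjoin κ' (Set.range y) = ⊤) {q : ℕ} (hq : 0 < q)
    (hyx : ∀ i, y i ^ q ∈ (algebraMap P P').range) : Module.Finite P P' := by
  have h1 : Algebra.FiniteType κ' P' := ⟨hy ▸ Subalgebra.fg_def.2 ⟨_, Set.finite_range y, rfl⟩⟩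
  have h2 : Algebra.FiniteType κ P' := .trans (S := κ') inferInstance h1
  have h3 : Algebra.FiniteType P P' := .of_restrictScalars_finiteType κ P P'
  have h4 : Algebra.IsIntegral P P' := by
    refine ⟨fun z ↦ ?_⟩
    have hz : z ∈ Algebra.adjoin κ' (Set.range y) := hy ▸ trivial
    induction hz using Algebra.adjoin_induction with
    | mem w hw =>
      obtain ⟨i, rfl⟩ := hw
      obtain ⟨c, hc⟩ := hyx i
      exact IsIntegral.of_pow hq (hc ▸ isIntegral_algebraMap)
    | algebraMap c =>
      have : IsIntegral κ c := Algebra.IsIntegral.isIntegral c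
      exact (this.map (IsScalarTower.toAlgHom κ κ' P')).tower_top
    | add a b _ _ ha hb => exact ha.add hb
    | mul a b _ _ ha hb => exact ha.mul hb
  exact Algebra.finite_iff_isIntegral_and_finiteType.2 ⟨h4, h3⟩

/-- The elements of a finite separable extension which are integral over a subring of an
integrally closed Noetherian domain are contained in a finitely generated module. -/
theorem exists_fg_of_isSeparable_of_le {κ Ω F ι : Type*} [Field κ] [Field Ω] [Algebra κ Ω]
    [Finite ι] {κ' : IntermediateField κ Ω} [FiniteDimensional κ κ'] {P : Subalgebra κ Ω}
    {P' : Subalgebra κ' Ω} (hPP' : ∀ z ∈ P, z ∈ P') {y : ι → P'}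
    (hy : Algebra.adjoin κ' (Set.range y) = ⊤) {q : ℕ} (hq : 0 < q)
    (hyx : ∀ i, (y i : Ω) ^ q ∈ P) [Field F] [Algebra P' F] [IsFractionRing P' F] [Algebra F Ω]
    [IsScalarTower P' F Ω] [IsIntegrallyClosed P'] [IsNoetherianRing P'] (T : Finset Ω)
    (hsep : ∀ t ∈ T, IsSeparable F t) :
    ∃ N : Submodule P Ω, N.FG ∧
      ∀ z ∈ IntermediateField.adjoin F (T : Set Ω), IsIntegral P z → z ∈ N := by
  let _ : Algebra P P' := RingHom.toAlgebra ((algebraMap P Ω).codRestrict P' fun z ↦ hPP' z z.2)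
  have : IsScalarTower P P' Ω := .of_algebraMap_eq' rfl
  have : IsScalarTower κ P P' := .of_algebraMap_eq' rfl
  have hfinite : Module.Finite P P' :=
    finite_of_adjoin_eq_top_of_pow_mem (κ := κ) (κ' := κ') hy hq
      fun i ↦ ⟨⟨_, hyx i⟩, Subtype.ext rfl⟩
  obtain ⟨N, hN, hN'⟩ := exists_fg_of_isSeparable (P := P') T hsep
  exact ⟨N.restrictScalars _, Submodule.FG.restrictScalars hN,
    fun z hz hzi ↦ hN' z hz (hzi.tower_top (A := P'))⟩

theorem isSeparable_of_intermediateField_le {κ Ω : Type*} [Field κ] [Field Ω] [Algebra κ Ω]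
    {κ' : IntermediateField κ Ω} {F : IntermediateField κ Ω} {F' : IntermediateField κ' Ω}
    (h : ∀ z ∈ F, z ∈ F') {t : Ω} (ht : IsSeparable F t) : IsSeparable F' t := by
  let _ : Algebra F F' := RingHom.toAlgebra ((algebraMap F Ω).codRestrict F' fun z ↦ h z z.2)
  have : IsScalarTower F F' Ω := .of_algebraMap_eq' rfl
  exact ht.tower_top F'

theorem adjoin_range_codRestrict_eq_top {κ Ω ι : Type*} [Field κ] [Field Ω] [Algebra κ Ω]
    (y : ι → Ω) : Algebra.adjoin κ (Set.range fun i ↦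
      (⟨y i, Algebra.subset_adjoin (Set.mem_range_self i)⟩ : Algebra.adjoin κ (Set.range y))) =
      ⊤ := by
  rw [← Algebra.adjoin_adjoin_coe_preimage (s := Set.range y)]
  congr 1
  ext z
  constructor
  · rintro ⟨i, rfl⟩
    exact ⟨i, rfl⟩
  · rintro ⟨i, hi⟩
    exact ⟨i, Subtype.ext hi⟩

theorem mem_adjoin_of_mem_adjoin_pow {κ Ω ι : Type*} [Field κ] [Field Ω] [Algebra κ Ω]
    {x y : ι → Ω} {q : ℕ} (hyx : ∀ i, y i ^ q = x i) (κ' : IntermediateField κ Ω) {z : Ω}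
    (hz : z ∈ Algebra.adjoin κ (Set.range x)) : z ∈ Algebra.adjoin κ' (Set.range y) := by
  induction hz using Algebra.adjoin_induction with
  | mem w hw =>
    obtain ⟨i, rfl⟩ := hw
    rw [← hyx i]
    exact pow_mem (Algebra.subset_adjoin (Set.mem_range_self i)) _
  | algebraMap c =>
    exact Subalgebra.algebraMap_mem _ (algebraMap κ κ' c)
  | add a b _ _ ha hb => exact add_mem ha hb
  | mul a b _ _ ha hb => exact mul_mem ha hb

open scoped IntermediateField.algebraAdjoinAdjoin in
/-- The elements of a finitely generated algebraic extension of a rational function field which are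
integral over the polynomial ring are contained in a finitely generated module. -/
theorem exists_fg_of_isIntegral_adjoin {κ Ω ι : Type*} [Field κ] [Field Ω] [Algebra κ Ω]
    [IsAlgClosed Ω] [Finite ι] {x : ι → Ω} (hx : AlgebraicIndependent κ x) (T : Finset Ω)
    (hT : ∀ t ∈ T, IsIntegral (IntermediateField.adjoin κ (Set.range x)) t) :
    ∃ N : Submodule (Algebra.adjoin κ (Set.range x)) Ω, N.FG ∧
      ∀ z ∈ IntermediateField.adjoin κ (Set.range x ∪ T),
        IsIntegral (Algebra.adjoin κ (Set.range x)) z → z ∈ N := by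
  obtain ⟨p, _⟩ := ExpChar.exists Ω
  obtain ⟨n, S, hS⟩ := exists_finset_isSeparable_adjoin p x T hT
  set φ := (iterateFrobeniusEquiv Ω p n).symm with hφ
  set y : ι → Ω := fun i ↦ φ (x i) with hy
  have hyx : ∀ i, y i ^ p ^ n = x i := fun i ↦ by
    rw [← iterateFrobeniusEquiv_def Ω p n]
    exact (iterateFrobeniusEquiv Ω p n).apply_symm_apply _
  have hφc : ∀ c : κ, IsIntegral κ (φ (algebraMap κ Ω c)) := fun c ↦ by
    refine IsIntegral.of_pow (n := p ^ n) (expChar_pow_pos Ω p n) ?_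
    rw [← iterateFrobeniusEquiv_def Ω p n]
    rw [(iterateFrobeniusEquiv Ω p n).apply_symm_apply]
    exact isIntegral_algebraMap
  -- Over this finite extension of scalars, the roots `y` of the variables again generate a
  -- polynomial ring. It is integrally closed and finite over the original one, and the elements of
  -- `T` are separable over its field of fractions.
  set κ' := IntermediateField.adjoin κ ((fun c ↦ φ (algebraMap κ Ω c)) '' (S : Set κ)) with hκ'
  have : FiniteDimensional κ κ' := IntermediateField.finiteDimensional_adjoin (by
    rintro _ ⟨c, _, rfl⟩
    exact hφc c)
  have hyκ : AlgebraicIndependent κ' y :=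
    (algebraicIndependent_iterateFrobeniusEquiv_symm p n hx).extendScalars κ'
  have : IsIntegrallyClosed (Algebra.adjoin κ' (Set.range y)) :=
    isIntegrallyClosed_adjoin_of_algebraicIndependent hyκ
  have : IsNoetherianRing (Algebra.adjoin κ' (Set.range y)) := isNoetherianRing_adjoin_range y
  have hmem : ∀ z ∈ IntermediateField.adjoin κ
      ((fun c ↦ φ (algebraMap κ Ω c)) '' (S : Set κ) ∪ Set.range y),
      z ∈ IntermediateField.adjoin κ' (Set.range y) := fun z hz ↦ by
    rw [← IntermediateField.adjoin_adjoin_left] at hz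
    exact hz
  obtain ⟨N, hN, hN'⟩ := exists_fg_of_isSeparable_of_le
    (fun z hz ↦ mem_adjoin_of_mem_adjoin_pow hyx κ' hz) (adjoin_range_codRestrict_eq_top y)
    (expChar_pow_pos Ω p n)
    (fun i ↦ by rw [hyx i]; exact Algebra.subset_adjoin (Set.mem_range_self i))
    (F := IntermediateField.adjoin κ' (Set.range y)) T
    fun t ht ↦ isSeparable_of_intermediateField_le hmem (hS t ht)
  refine ⟨N, hN, fun z hz hzi ↦ hN' z ?_ hzi⟩
  have hle : IntermediateField.adjoin κ (Set.range x ∪ T) ≤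
      IntermediateField.restrictScalars κ (IntermediateField.restrictScalars κ'
        (IntermediateField.adjoin (IntermediateField.adjoin κ' (Set.range y)) (T : Set Ω))) := by
    rw [IntermediateField.adjoin_le_iff]
    rintro w (⟨i, rfl⟩ | hw)
    · rw [← hyx i]
      exact pow_mem (IntermediateField.algebraMap_mem
        (IntermediateField.adjoin (IntermediateField.adjoin κ' (Set.range y)) (T : Set Ω))
        ⟨y i, IntermediateField.subset_adjoin _ _ ⟨i, rfl⟩⟩) _
    · exact IntermediateField.subset_adjoin (IntermediateField.adjoin κ' (Set.range y)) _ hw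
  exact hle hz

/-- The integral closure of a finitely generated domain over a field in its field of fractions is
finite. -/
theorem finite_integralClosure_of_finiteType (κ : Type*) {D K : Type*} [Field κ] [CommRing D]
    [IsDomain D] [Algebra κ D] [Algebra.FiniteType κ D] [Field K] [Algebra D K]
    [IsFractionRing D K] : Module.Finite D (integralClosure D K) := by
  classical
  let _ : Algebra κ K := ((algebraMap D K).comp (algebraMap κ D)).toAlgebra
  have : IsScalarTower κ D K := .of_algebraMap_eq' rfl
  -- Noether normalisation. The polynomial ring is moved into an algebraic closure of `K`, where the
  -- `p ^ n`-th roots of the variables are available.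
  obtain ⟨s, g, hg, hgfin⟩ := exists_finite_inj_algHom_of_fg κ D
  let Ω := AlgebraicClosure K
  have : IsScalarTower κ K Ω := inferInstance
  have : IsScalarTower D K Ω := inferInstance
  have : IsScalarTower κ D Ω := .of_algebraMap_eq fun c ↦ by
    rw [IsScalarTower.algebraMap_apply κ K Ω, IsScalarTower.algebraMap_apply κ D K,
      IsScalarTower.algebraMap_apply D K Ω]
  let ψ : D →ₐ[κ] Ω := IsScalarTower.toAlgHom κ D Ω
  have hψ : Function.Injective ψ := by
    change Function.Injective (algebraMap D Ω)
    rw [IsScalarTower.algebraMap_eq D K Ω]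
    exact (algebraMap K Ω).injective.comp (IsFractionRing.injective D K)
  let x : Fin s → Ω := fun i ↦ ψ (g (MvPolynomial.X i))
  have hxaeval : MvPolynomial.aeval x = ψ.comp g := by
    ext i
    simp [x]
  have hx : AlgebraicIndependent κ x := by
    rw [algebraicIndependent_iff_injective_aeval, hxaeval]
    exact hψ.comp hg
  let P := Algebra.adjoin κ (Set.range x)
  have : IsNoetherianRing P := isNoetherianRing_adjoin_range x
  let ρ : P →ₐ[κ] D := g.comp hx.aevalEquiv.symm.toAlgHom
  have hρ : ∀ z : P, ψ (ρ z) = z := fun z ↦ by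
    obtain ⟨w, rfl⟩ := hx.aevalEquiv.surjective z
    rw [show ((hx.aevalEquiv w : P) : Ω) = MvPolynomial.aeval x w from
      hx.algebraMap_aevalEquiv w, hxaeval]
    simp [ρ]
  let _ : Algebra P D := ρ.toAlgebra
  have : IsScalarTower κ P D := .of_algebraMap_eq' ρ.comp_algebraMap.symm
  have : IsScalarTower P D Ω := .of_algebraMap_eq fun z ↦ (hρ z).symm
  have hPD : Module.Finite P D := by
    have : ρ.toRingHom.Finite := hgfin.comp (RingHom.Finite.of_surjective _
      hx.aevalEquiv.symm.surjective)
    exact this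
  obtain ⟨T, hT⟩ := ‹Algebra.FiniteType κ D›.out
  have hDmem : ∀ d : D, ψ d ∈ IntermediateField.adjoin κ (Set.range x ∪ (T.image ψ : Finset Ω)) :=
      fun d ↦ by
    have hd : d ∈ Algebra.adjoin κ (T : Set D) := hT ▸ trivial
    induction hd using Algebra.adjoin_induction with
    | mem w hw =>
      exact IntermediateField.subset_adjoin _ _ (Or.inr (by simpa using ⟨w, hw, rfl⟩))
    | algebraMap c =>
      rw [ψ.commutes]
      exact IntermediateField.algebraMap_mem _ c
    | add a b _ _ ha hb =>
      rw [map_add]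
      exact add_mem ha hb
    | mul a b _ _ ha hb =>
      rw [map_mul]
      exact mul_mem ha hb
  obtain ⟨N, hN, hN'⟩ := exists_fg_of_isIntegral_adjoin hx (T.image ψ) (by
    intro t ht
    obtain ⟨d, _, rfl⟩ := Finset.mem_image.1 ht
    have : IsIntegral P d := Algebra.IsIntegral.isIntegral d
    have h2 : IsIntegral P (ψ d) := this.algebraMap (B := Ω)
    obtain ⟨f, hf, hf'⟩ := h2
    refine ⟨f.map (Subring.inclusion (S := P.toSubring)
      (T := (IntermediateField.adjoin κ (Set.range x)).toSubring)
      (IntermediateField.algebra_adjoin_le_adjoin κ _)), hf.map _, ?_⟩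
    rw [Polynomial.eval₂_map]
    exact hf')
  let _ : Module P (integralClosure D K) := Module.compHom _ (algebraMap P D)
  have : IsScalarTower P D (integralClosure D K) := ⟨fun a b c ↦ by
    rw [Algebra.smul_def a b]
    exact mul_smul (algebraMap P D a) b c⟩
  have hBN : Module.Finite P (integralClosure D K) := by
    let θ : integralClosure D K →ₗ[P] Ω :=
      { toFun b := algebraMap K Ω b
        map_add' a b := by simp
        map_smul' c b := by
          have h1 : algebraMap K Ω (algebraMap D K (algebraMap P D c)) = c := by
            rw [← IsScalarTower.algebraMap_apply D K Ω]
            exact hρ c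
          change algebraMap K Ω ((algebraMap P D c • b : integralClosure D K) : K) = _
          rw [Algebra.smul_def, Subalgebra.coe_mul, map_mul]
          change algebraMap K Ω (algebraMap D K (algebraMap P D c)) * _ = _
          rw [h1]
          rfl }
    have hθN : LinearMap.range θ ≤ N := by
      rintro _ ⟨b, rfl⟩
      refine hN' _ ?_ ?_
      · obtain ⟨a, t, _, ht⟩ := IsFractionRing.div_surjective (A := D) (b : K)
        change algebraMap K Ω b ∈ _
        rw [← ht, map_div₀]
        exact div_mem (hDmem a) (hDmem t)
      · have hb : IsIntegral D (b : K) := b.2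
        exact isIntegral_trans (R := P) (A := D) _ (hb.algebraMap (B := Ω))
    have : IsNoetherian P N := isNoetherian_of_fg_of_noetherian N hN
    have : IsNoetherian P (LinearMap.range θ) := isNoetherian_of_le hθN
    have hθ : Function.Injective θ := (algebraMap K Ω).injective.comp Subtype.val_injective
    exact Module.Finite.of_injective θ.rangeRestrict
      (fun a b h ↦ hθ (congrArg Subtype.val h))
  exact Module.Finite.of_restrictScalars_finite P D _

/-! ### Finite products of residue fields as rings of fractions. -/

/-- A reduced Artinian ring is von Neumann regular. -/
theorem exists_sq_mul_eq_of_isArtinianRing {Q : Type*} [CommRing Q] [_root_.IsReduced Q]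
    [IsArtinianRing Q] (z : Q) : ∃ w, z ^ 2 * w = z := by
  obtain ⟨n, w, hw⟩ := IsArtinian.exists_pow_succ_smul_dvd (M := Q) z (1 : Q)
  refine ⟨w, ?_⟩
  simp only [smul_eq_mul, mul_one, Nat.succ_eq_add_one] at hw
  have h : (z - z ^ 2 * w) ^ (n + 1) = 0 := by
    -- The descending chain condition gives `z ^ n = z ^ (n + 1) * w`, and this difference is split
    -- off as a factor of a power of `z - z ^ 2 * w`.
    have h1 : (z - z ^ 2 * w) ^ (n + 1) = (z ^ n - z ^ (n + 1) * w) * (z * (1 - z * w) ^ n) := by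
      rw [show z - z ^ 2 * w = z * (1 - z * w) by ring, mul_pow]
      ring
    rw [h1, hw, sub_self, zero_mul]
  exact (sub_eq_zero.1 (eq_zero_of_pow_eq_zero h)).symm

/-- The ring `Q` is a finite product of residue fields of `A` at pairwise incomparable primes. -/
structure IsGenericAlgebra (A Q : Type*) [CommRing A] [CommRing Q] [Algebra A Q] : Prop where
  isReduced : _root_.IsReduced Q
  isArtinianRing : IsArtinianRing Q
  exists_mul_sub_mem : ∀ (m : Ideal Q) [m.IsPrime] (z : Q),
    ∃ s a : A, algebraMap A Q s ∉ m ∧ algebraMap A Q s * z - algebraMap A Q a ∈ m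
  eq_of_comap_le : ∀ (m m' : Ideal Q) [m.IsPrime] [m'.IsPrime],
    m.comap (algebraMap A Q) ≤ m'.comap (algebraMap A Q) → m = m'

namespace IsGenericAlgebra

variable {A Q : Type*} [CommRing A] [CommRing Q] [Algebra A Q]

theorem eq_zero_of_forall_mem (h : IsGenericAlgebra A Q) {z : Q}
    (hz : ∀ m : MaximalSpectrum Q, z ∈ m.asIdeal) : z = 0 := by
  have := h.isReduced
  have := h.isArtinianRing
  have : z ∈ nilradical Q := by
    rw [nilradical_eq_sInf, Ideal.mem_sInf]
    intro p hp
    have : p.IsPrime := hp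
    exact hz ⟨p, IsArtinianRing.isMaximal_of_isPrime p⟩
  rw [nilradical_eq_zero] at this
  exact this

/-- The integral closure of an algebra of finite type over a field in the product of its residue
fields at incomparable primes is finite. -/
theorem finite_integralClosure (κ : Type*) [Field κ] [Algebra κ A] [Algebra.FiniteType κ A]
    (h : IsGenericAlgebra A Q) : Module.Finite A (integralClosure A Q) := by
  have := h.isArtinianRing
  have : IsNoetherianRing A := Algebra.FiniteType.isNoetherianRing κ A
  have key : ∀ m : MaximalSpectrum Q, ∃ N : Submodule A (Q ⧸ m.asIdeal), N.FG ∧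
      ∀ z : Q ⧸ m.asIdeal, IsIntegral A z → z ∈ N := by
    intro m
    have := m.isMaximal
    let p := m.asIdeal.comap (algebraMap A Q)
    let _ : Field (Q ⧸ m.asIdeal) := Ideal.Quotient.field _
    have hdiv : IsFractionRing (A ⧸ p) (Q ⧸ m.asIdeal) := by
      have hinj : Function.Injective (algebraMap (A ⧸ p) (Q ⧸ m.asIdeal)) :=
        Ideal.algebraMap_quotient_injective
      have : FaithfulSMul (A ⧸ p) (Q ⧸ m.asIdeal) :=
        (faithfulSMul_iff_algebraMap_injective _ _).2 hinj
      refine IsFractionRing.of_field _ _ fun z ↦ ?_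
      obtain ⟨z, rfl⟩ := Ideal.Quotient.mk_surjective z
      obtain ⟨s, a, hs, ha⟩ := h.exists_mul_sub_mem m.asIdeal z
      refine ⟨Ideal.Quotient.mk _ a, Ideal.Quotient.mk _ s, ?_⟩
      change Ideal.Quotient.mk _ z =
        Ideal.Quotient.mk _ (algebraMap A Q a) / Ideal.Quotient.mk _ (algebraMap A Q s)
      rw [eq_div_iff (by rwa [Ne, Ideal.Quotient.eq_zero_iff_mem]), ← map_mul, mul_comm]
      exact Ideal.Quotient.eq.2 ha
    have hfin := finite_integralClosure_of_finiteType κ (D := A ⧸ p) (K := Q ⧸ m.asIdeal)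
    have hfin' : Module.Finite A (integralClosure (A ⧸ p) (Q ⧸ m.asIdeal)) :=
      Module.Finite.trans (A ⧸ p) _
    let θ : integralClosure (A ⧸ p) (Q ⧸ m.asIdeal) →ₗ[A] Q ⧸ m.asIdeal :=
      (integralClosure (A ⧸ p) (Q ⧸ m.asIdeal)).val.toLinearMap.restrictScalars A
    exact ⟨LinearMap.range θ, Module.Finite.iff_fg.1 inferInstance,
      fun z hz ↦ ⟨⟨z, hz.tower_top⟩, rfl⟩⟩
  choose N hN hN' using key
  have (m : MaximalSpectrum Q) : Module.Finite A (N m) := Module.Finite.iff_fg.2 (hN m)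
  -- `Q` is reduced and Artinian, so it embeds in the finite product of its residue fields, and
  -- finiteness can be tested on each factor.
  let θ : integralClosure A Q →ₗ[A] ∀ m, N m :=
    LinearMap.pi fun m ↦ ((Ideal.Quotient.mkₐ A m.asIdeal).toLinearMap.comp
      (integralClosure A Q).val.toLinearMap).codRestrict (N m)
        fun z ↦ hN' m _ (z.2.map (Ideal.Quotient.mkₐ A m.asIdeal))
  have hθ : Function.Injective θ := by
    rw [← LinearMap.ker_eq_bot, LinearMap.ker_eq_bot']
    intro z hz
    refine Subtype.ext (h.eq_zero_of_forall_mem fun m ↦ ?_)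
    have := congrArg Subtype.val (congrFun hz m)
    exact Ideal.Quotient.eq_zero_iff_mem.1 this
  exact Module.Finite.of_injective θ hθ

/-- Every element of `Q` is a fraction whose denominator is a unit of `Q`. -/
theorem exists_isUnit_mul_mem_range (h : IsGenericAlgebra A Q) (z : Q) :
    ∃ f a : A, IsUnit (algebraMap A Q f) ∧ algebraMap A Q f * z = algebraMap A Q a := by
  classical
  have := h.isArtinianRing
  have : Fintype (MaximalSpectrum Q) := Fintype.ofFinite _
  have hmax (m : MaximalSpectrum Q) : m.asIdeal.IsPrime := m.isMaximal.isPrime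
  -- Incomparability of the contracted primes gives elements of `A` that are nonzero at exactly one
  -- point of `Q`. They act as approximate idempotents and combine the denominators found at each
  -- point.
  have hidem : ∀ m : MaximalSpectrum Q, ∃ e : A, algebraMap A Q e ∉ m.asIdeal ∧
      ∀ m' : MaximalSpectrum Q, m' ≠ m → algebraMap A Q e ∈ m'.asIdeal := by
    intro m
    have : ∀ m' : MaximalSpectrum Q, m' ≠ m → ∃ e : A, algebraMap A Q e ∈ m'.asIdeal ∧
        algebraMap A Q e ∉ m.asIdeal := by
      intro m' hm'
      by_contra! hcon
      exact hm' (MaximalSpectrum.ext (h.eq_of_comap_le m'.asIdeal m.asIdeal fun a ha ↦ hcon a ha))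
    choose! e he he' using this
    refine ⟨∏ m' ∈ Finset.univ.erase m, e m', ?_, fun m' hm' ↦ ?_⟩
    · rw [map_prod, (hmax m).prod_mem_iff]
      rintro ⟨m', hm', hmem⟩
      exact he' m' (Finset.ne_of_mem_erase hm') hmem
    · rw [map_prod, (hmax m').prod_mem_iff]
      exact ⟨m', Finset.mem_erase.2 ⟨hm', Finset.mem_univ _⟩, he m' hm'⟩
  choose e he he' using hidem
  choose s a hs ha using fun m : MaximalSpectrum Q ↦ h.exists_mul_sub_mem m.asIdeal z
  have hsum : ∀ (c : MaximalSpectrum Q → A) (m : MaximalSpectrum Q),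
      algebraMap A Q (∑ m', e m' * c m') - algebraMap A Q (e m * c m) ∈ m.asIdeal := by
    intro c m
    rw [← Finset.add_sum_erase _ _ (Finset.mem_univ m), map_add, add_sub_cancel_left, map_sum]
    refine Ideal.sum_mem _ fun m' hm' ↦ ?_
    rw [map_mul]
    exact Ideal.mul_mem_right _ _ (he' m' m (Finset.ne_of_mem_erase hm').symm)
  refine ⟨∑ m, e m * s m, ∑ m, e m * a m, ?_, ?_⟩
  · by_contra hu
    obtain ⟨m, hm, hmem⟩ := exists_max_ideal_of_mem_nonunits hu
    have h1 := hsum s ⟨m, hm⟩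
    have h2 := (Submodule.sub_mem_iff_right _ hmem).1 h1
    rw [map_mul] at h2
    rcases (hmax ⟨m, hm⟩).mem_or_mem h2 with h3 | h3
    · exact he _ h3
    · exact hs _ h3
  · rw [← sub_eq_zero]
    refine h.eq_zero_of_forall_mem fun m ↦ ?_
    have h1 := Ideal.mul_mem_right z _ (hsum s m)
    have h2 := hsum a m
    have h3 := Ideal.mul_mem_left _ (algebraMap A Q (e m)) (ha m)
    have := Ideal.add_mem _ (Ideal.sub_mem _ h1 h2) h3
    convert this using 1
    simp only [map_mul]
    ring

/-- A finite set of elements of `Q` has a common denominator which is a unit of `Q`. -/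
theorem exists_isUnit_smul_mem_range (h : IsGenericAlgebra A Q) (N : Submodule A Q) (hN : N.FG) :
    ∃ f : A, IsUnit (algebraMap A Q f) ∧
      ∀ z ∈ N, algebraMap A Q f * z ∈ (algebraMap A Q).range := by
  classical
  obtain ⟨S, rfl⟩ := hN
  choose f a hf ha using h.exists_isUnit_mul_mem_range
  refine ⟨∏ z ∈ S, f z, ?_, fun z hz ↦ ?_⟩
  · rw [map_prod]
    exact Finset.prod_induction _ _ (fun _ _ ↦ IsUnit.mul) isUnit_one fun z _ ↦ hf z
  · induction hz using Submodule.span_induction with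
    | mem z hz =>
      refine ⟨(∏ w ∈ S.erase z, f w) * a z, ?_⟩
      rw [← Finset.mul_prod_erase _ _ hz, map_mul, map_mul, ← ha z]
      ring
    | zero => simp
    | add z w _ _ hz hw =>
      rw [mul_add]
      exact add_mem hz hw
    | smul c z _ hz =>
      rw [Algebra.smul_def, mul_left_comm]
      exact mul_mem ⟨c, rfl⟩ hz

end IsGenericAlgebra

/-! ### Finite length from an element lying only in maximal ideals. -/

section FiniteLength

/-- A finite module killed by an element which lies only in maximal ideals has finite length. -/
theorem isArtinian_of_smul_eq_zero {A M : Type*} [CommRing A] [IsNoetherianRing A] [AddCommGroup M]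
    [Module A M] [Module.Finite A M] {f : A} (hf : ∀ p : Ideal A, p.IsPrime → f ∈ p → p.IsMaximal)
    (hM : ∀ x : M, f • x = 0) : IsArtinian A M := by
  let I := Ideal.span {f}
  have hdim : Ring.KrullDimLE 0 (A ⧸ I) := by
    refine Ring.KrullDimLE.mk₀ fun p hp ↦ ?_
    have h1 : (p.comap (Ideal.Quotient.mk I)).IsMaximal := by
      refine hf _ inferInstance ?_
      rw [Ideal.mem_comap, Ideal.Quotient.eq_zero_iff_mem.2 (Ideal.mem_span_singleton_self f)]
      exact p.zero_mem
    have h2 := Ideal.map_eq_top_or_isMaximal_of_surjective (Ideal.Quotient.mk I)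
      Ideal.Quotient.mk_surjective h1
    rw [Ideal.map_comap_of_surjective _ Ideal.Quotient.mk_surjective] at h2
    exact h2.resolve_left hp.ne_top
  have : IsArtinianRing (A ⧸ I) := isArtinianRing_iff_krullDimLE_zero.2 hdim
  have hM' : Module.IsTorsionBySet A M I := (Module.isTorsionBySet_span_singleton_iff f).2 hM
  let _ : Module (A ⧸ I) M := hM'.module
  have : IsScalarTower A (A ⧸ I) M := hM'.isScalarTower
  have : Module.Finite (A ⧸ I) M := Module.Finite.of_restrictScalars_finite A _ _
  have : IsArtinian (A ⧸ I) M := inferInstance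
  exact isArtinian_of_surjective_algebraMap (R := A ⧸ I) Ideal.Quotient.mk_surjective

/-- In a one-dimensional ring, primes containing a regular element are maximal. -/
theorem isMaximal_of_mem_of_isUnit_algebraMap {A Q : Type*} [CommRing A] [CommRing Q] [Algebra A Q]
    [Ring.KrullDimLE 1 A] (hinj : Function.Injective (algebraMap A Q)) {f : A}
    (hf : IsUnit (algebraMap A Q f)) (p : Ideal A) (hp : p.IsPrime) (hfp : f ∈ p) :
    p.IsMaximal := by
  refine (Ring.krullDimLE_one_iff.1 inferInstance p hp).resolve_left fun hmin ↦ ?_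
  refine Set.disjoint_left.1 (Ideal.disjoint_nonZeroDivisors_of_mem_minimalPrimes hmin) hfp ?_
  refine mem_nonZeroDivisors_iff_right.2 fun x hx ↦ hinj ?_
  rw [map_zero, ← hf.mul_left_eq_zero, ← map_mul, hx, map_zero]

/-- A closed set of maximal ideals of a Noetherian ring is finite. -/
theorem finite_setOf_mem_of_isMaximal {A : Type*} [CommRing A] [IsNoetherianRing A] {f : A}
    (hf : ∀ p : Ideal A, p.IsPrime → f ∈ p → p.IsMaximal) :
    {p : Ideal A | p.IsPrime ∧ f ∈ p}.Finite := by
  refine (Ideal.finite_minimalPrimes_of_isNoetherianRing A (Ideal.span {f})).subset ?_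
  rintro p ⟨hp, hfp⟩
  refine ⟨⟨hp, by simpa [Ideal.span_le] using hfp⟩, fun q hq hqp ↦ ?_⟩
  exact ((hf q hq.1 (hq.2 (Ideal.mem_span_singleton_self f))).eq_of_le hp.ne_top hqp).ge

end FiniteLength

/-! ### Regularity in dimension at most one, and local agreement with the integral closure. -/

section Regular

/-- A reduced Noetherian local ring with principal maximal ideal is a domain. -/
theorem isDomain_of_isPrincipal_maximalIdeal {L : Type*} [CommRing L] [IsLocalRing L]
    [IsNoetherianRing L] [_root_.IsReduced L] {t : L}
    (ht : IsLocalRing.maximalIdeal L = Ideal.span {t}) : IsDomain L := by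
  have key : ∀ x : L, x ≠ 0 → ∃ (n : ℕ) (v : L), IsUnit v ∧ x = v * t ^ n := by
    intro x hx
    by_contra! hcon
    have hmem : ∀ n : ℕ, ∃ v, x = v * t ^ n := by
      intro n
      induction n with
      | zero => exact ⟨x, by simp⟩
      | succ n ih =>
        obtain ⟨v, hv⟩ := ih
        have hv' : v ∈ IsLocalRing.maximalIdeal L := fun h ↦ hcon n v h hv
        rw [ht, Ideal.mem_span_singleton'] at hv'
        obtain ⟨w, rfl⟩ := hv'
        exact ⟨w, by rw [hv]; ring⟩
    -- By Krull's intersection theorem, no nonzero element is divisible by all powers of `t`.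
    have : x ∈ (⨅ i : ℕ, IsLocalRing.maximalIdeal L ^ i) := by
      rw [Ideal.mem_iInf]
      intro n
      obtain ⟨v, hv⟩ := hmem n
      rw [hv, ht, Ideal.span_singleton_pow]
      exact Ideal.mul_mem_left _ _ (Ideal.mem_span_singleton_self _)
    rw [Ideal.iInf_pow_eq_bot_of_isLocalRing _ (IsLocalRing.maximalIdeal.isMaximal L).ne_top] at this
    exact hx this
  have : NoZeroDivisors L := by
    refine ⟨fun {x y} hxy ↦ ?_⟩
    by_contra! hcon
    obtain ⟨n, v, hv, rfl⟩ := key x hcon.1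
    obtain ⟨k, w, hw, rfl⟩ := key y hcon.2
    have h1 : (v * w) * t ^ (n + k) = 0 := by rw [← hxy]; ring
    rw [(hv.mul hw).mul_right_eq_zero] at h1
    have h0 : t = 0 := eq_zero_of_pow_eq_zero h1
    rcases Nat.eq_zero_or_pos n with rfl | hn
    · rcases Nat.eq_zero_or_pos k with rfl | hk
      · simp at h1
      · exact hcon.2 (by rw [h0, zero_pow hk.ne', mul_zero])
    · exact hcon.1 (by rw [h0, zero_pow hn.ne', mul_zero])
  exact NoZeroDivisors.to_isDomain L

/-- A reduced regular local ring of dimension at most one is a domain and a principal ideal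
ring. -/
theorem isDomain_and_isPrincipalIdealRing_of_isRegularLocalRing {L : Type*} [CommRing L]
    [IsRegularLocalRing L] [_root_.IsReduced L] [Ring.KrullDimLE 1 L] :
    ∃ _ : IsDomain L, IsPrincipalIdealRing L := by
  have h1 : ((IsLocalRing.maximalIdeal L).spanFinrank : WithBot ℕ∞) ≤ 1 := by
    rw [IsRegularLocalRing.spanFinrank_maximalIdeal]
    exact Order.krullDimLE_iff _ _ |>.1 inferInstance
  have h2 : (IsLocalRing.maximalIdeal L).spanFinrank ≤ 1 := by exact_mod_cast h1
  have hfg : (IsLocalRing.maximalIdeal L).FG := IsNoetherian.noetherian _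
  have h3 : ∃ t, IsLocalRing.maximalIdeal L = Ideal.span {t} := by
    rw [← Submodule.FG.generators_ncard hfg] at h2
    have h4 := Submodule.span_generators (IsLocalRing.maximalIdeal L)
    rcases (Set.ncard_le_one_iff_eq (Submodule.FG.finite_generators hfg)).1 h2 with h5 | ⟨t, h5⟩
    · exact ⟨0, by rw [← h4, h5]; simp⟩
    · exact ⟨t, by rw [← h4, h5]⟩
  obtain ⟨t, ht⟩ := h3
  have hdom := isDomain_of_isPrincipal_maximalIdeal ht
  have hprin : (IsLocalRing.maximalIdeal L).IsPrincipal := ⟨⟨t, ht⟩⟩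
  exact ⟨hdom, ((tfae_of_isNoetherianRing_of_isLocalRing_of_isDomain L).out 0 4).2 hprin⟩

/-- If the local ring of `R` at a prime is regular of dimension at most one, then finite birational
extensions of `R` are trivial locally at that prime. -/
theorem exists_mul_mem_range_of_isRegularLocalRing {R L : Type u} {B : Type*} [CommRing R] [CommRing B]
    [CommRing L] [Algebra R B] [Algebra.IsIntegral R B] [_root_.IsReduced R]
    (hinj : Function.Injective (algebraMap R B)) (P : Ideal R) [P.IsPrime] [Algebra R L]
    [IsLocalization.AtPrime L P] [IsRegularLocalRing L] [Ring.KrullDimLE 1 L]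
    {f : R} (hf : ∀ b : B, algebraMap R B f * b = 0 → b = 0) {b : B}
    (hb : algebraMap R B f * b ∈ (algebraMap R B).range) :
    ∃ s ∉ P, algebraMap R B s * b ∈ (algebraMap R B).range := by
  have : _root_.IsReduced L := isReduced_localizationPreserves P.primeCompl L inferInstance
  obtain ⟨hdom, hpir⟩ := isDomain_and_isPrincipalIdealRing_of_isRegularLocalRing (L := L)
  have hic : IsIntegrallyClosed L := inferInstance
  obtain ⟨r, hr⟩ := hb
  obtain ⟨g, hg, hgb⟩ := Algebra.IsIntegral.isIntegral (R := R) b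
  let K := FractionRing L
  have hf0 : algebraMap R L f ≠ 0 := by
    intro h0
    obtain ⟨t, ht⟩ := (IsLocalization.map_eq_zero_iff P.primeCompl L f).1 h0
    have : (t : R) = 0 := by
      apply hinj
      rw [map_zero]
      refine hf _ ?_
      rw [← map_mul, mul_comm, ht, map_zero]
    exact t.2 (this ▸ P.zero_mem)
  -- Formally `b = r / f`. Multiplying the roots of the integral equation of `b` by `f` gives an
  -- equation for `r` over `R` alone, which can be carried to the fraction field of `L`, where `B`
  -- does not map.
  have hscale : (g.scaleRoots f).eval r = 0 := by
    apply hinj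
    have h1 := Polynomial.scaleRoots_eval₂_mul (p := g) (algebraMap R B) b f
    rwa [hgb, mul_zero, ← hr, Polynomial.eval₂_at_apply, ← map_zero (algebraMap R B)] at h1
  let φ : R →+* K := (algebraMap L K).comp (algebraMap R L)
  have hφf : φ f ≠ 0 := by
    simpa [φ] using hf0
  have hint : IsIntegral L (φ r / φ f) := by
    refine ⟨g.map (algebraMap R L), hg.map _, ?_⟩
    rw [Polynomial.eval₂_map]
    have h1 := Polynomial.scaleRoots_eval₂_mul (p := g) φ (φ r / φ f) f
    rw [mul_div_cancel₀ _ hφf] at h1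
    have h2 : Polynomial.eval₂ φ (φ r) (g.scaleRoots f) = 0 := by
      rw [Polynomial.eval₂_at_apply, hscale, map_zero]
    rw [h2] at h1
    exact (mul_eq_zero.1 h1.symm).resolve_left (pow_ne_zero _ hφf)
  obtain ⟨c, hc⟩ := IsIntegrallyClosed.isIntegral_iff.1 hint
  have hc' : algebraMap R L r = algebraMap R L f * c := by
    apply IsFractionRing.injective L K
    rw [map_mul, hc]
    change φ r = φ f * _
    rw [mul_div_cancel₀ _ hφf]
  obtain ⟨⟨c₀, t⟩, hct⟩ := IsLocalization.surj P.primeCompl c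
  have h3 : algebraMap R L (r * t) = algebraMap R L (f * c₀) := by
    rw [map_mul, map_mul, hc', mul_assoc, hct]
  obtain ⟨v, hv⟩ := (IsLocalization.eq_iff_exists P.primeCompl L).1 h3
  refine ⟨v * t, (v * t).2, v * c₀, ?_⟩
  rw [← sub_eq_zero]
  refine hf _ ?_
  have h4 := congrArg (algebraMap R B) hv
  simp only [map_mul, hr] at h4 ⊢
  linear_combination -h4

/-- A local ring which is integrally closed in a von Neumann regular ring is an integrally closed
domain. -/
theorem isIntegrallyClosed_of_vonNeumannRegular {L Q : Type*} [CommRing L] [CommRing Q]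
    [IsLocalRing L] [Algebra L Q] (hinj : Function.Injective (algebraMap L Q))
    (hQ : ∀ z : Q, ∃ w, z ^ 2 * w = z)
    (hLQ : ∀ z : Q, IsIntegral L z → z ∈ (algebraMap L Q).range) :
    ∃ _ : IsDomain L, IsIntegrallyClosed L := by
  have : Nontrivial Q := hinj.nontrivial
  have hfield : IsField Q := by
    refine ⟨exists_pair_ne Q, mul_comm, fun {z} hz ↦ ?_⟩
    obtain ⟨w, hw⟩ := hQ z
    -- The idempotent `z * w` is integral, hence lies in the local ring `L`, where only `0` and `1`
    -- are idempotent. So every nonzero `z` is invertible.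
    have he : (z * w) * (z * w) = z * w := by linear_combination w * hw
    have hei : IsIntegral L (z * w) := by
      refine IsIntegral.of_aeval_monic (p := Polynomial.X ^ 2 - Polynomial.X)
        (by monicity!) ?_ ?_
      · have : (Polynomial.X ^ 2 - Polynomial.X : Polynomial L).natDegree = 2 := by compute_degree!
        rw [this]
        exact two_ne_zero
      · simp only [map_sub, map_pow, Polynomial.aeval_X]
        rw [pow_two, he, sub_self]
        exact isIntegral_zero
    obtain ⟨l, hl⟩ := hLQ _ hei
    have hll : l * (1 - l) = 0 := by
      apply hinj
      rw [map_mul, map_sub, map_one, hl, map_zero]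
      linear_combination -he
    rcases IsLocalRing.isUnit_or_isUnit_one_sub_self l with h | h
    · refine ⟨w, ?_⟩
      rw [← hl, ← sub_eq_zero.1 (h.mul_right_eq_zero.1 hll), map_one]
    · rw [h.mul_left_eq_zero.1 hll, map_zero] at hl
      refine absurd ?_ hz
      rw [← hw, pow_two, mul_assoc, ← hl, mul_zero]
  let _ : Field Q := hfield.toField
  have hdom : IsDomain L := hinj.isDomain (algebraMap L Q)
  refine ⟨hdom, (isIntegrallyClosed_iff (FractionRing L)).2 fun {x} hx ↦ ?_⟩
  let φ : FractionRing L →ₐ[L] Q := IsFractionRing.liftAlgHom (g := Algebra.ofId L Q) hinj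
  obtain ⟨y, hy⟩ := hLQ _ (hx.map φ)
  refine ⟨y, φ.toRingHom.injective ?_⟩
  change φ _ = φ _
  rw [φ.commutes, hy]

/-- If a ring `R` agrees locally at a prime with its integral closure in a von Neumann regular ring,
then the local ring at that prime is an integrally closed domain. -/
theorem isIntegrallyClosed_of_isLocalization_of_mul_mem {R Q L : Type*} [CommRing R]
    [CommRing Q] [CommRing L] [Algebra R Q] (hinj : Function.Injective (algebraMap R Q))
    (hQ : ∀ z : Q, ∃ w, z ^ 2 * w = z) (P : Ideal R) [P.IsPrime] [Algebra R L]
    [IsLocalization.AtPrime L P] {s : R} (hs : s ∉ P)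
    (hsB : ∀ b : Q, IsIntegral R b → algebraMap R Q s * b ∈ (algebraMap R Q).range) :
    ∃ _ : IsDomain L, IsIntegrallyClosed L := by
  have : IsLocalRing L := IsLocalization.AtPrime.isLocalRing L P
  let M := Algebra.algebraMapSubmonoid Q P.primeCompl
  have hM : ∀ m ∈ P.primeCompl, algebraMap R Q m ∈ M := fun m hm ↦ ⟨m, hm, rfl⟩
  let Q' := Localization (Algebra.algebraMapSubmonoid Q P.primeCompl)
  let _ : Algebra L Q' := localizationAlgebra P.primeCompl Q
  have : IsScalarTower R L Q' := isScalarTower_localizationAlgebra P.primeCompl Q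
  have hloc : IsLocalization M Q' := Localization.isLocalization
  have : IsLocalization (P.primeCompl.map (algebraMap R Q)) Q' := hloc
  have hinj' : Function.Injective (algebraMap L Q') :=
    IsLocalization.map_injective_of_injective P.primeCompl L Q' hinj
  refine isIntegrallyClosed_of_vonNeumannRegular hinj' (fun z ↦ ?_) fun z hz ↦ ?_
  · obtain ⟨q, m, rfl⟩ := IsLocalization.exists_mk'_eq (S := Q') M z
    obtain ⟨w, hw⟩ := hQ q
    refine ⟨IsLocalization.mk' Q' (w * m) (1 : M), ?_⟩
    rw [← IsLocalization.mk'_pow, ← IsLocalization.mk'_mul, IsLocalization.mk'_eq_iff_eq]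
    congr 1
    simp only [mul_one, SubmonoidClass.coe_pow]
    linear_combination (m : Q) ^ 2 * hw
  · obtain ⟨q, ⟨_, m, hm, rfl⟩, rfl⟩ := IsLocalization.exists_mk'_eq M z
    obtain ⟨m₂, hm₂⟩ := IsIntegral.exists_multiple_integral_of_isLocalization P.primeCompl _ hz
    rw [Submonoid.smul_def, Algebra.smul_def] at hm₂
    set z := IsLocalization.mk' Q' q (⟨algebraMap R Q m, hM m hm⟩ : M)
    have hzq : z * algebraMap R Q' m = algebraMap Q Q' q := by
      rw [IsScalarTower.algebraMap_apply R Q Q']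
      exact IsLocalization.mk'_spec Q' q (⟨algebraMap R Q m, hM m hm⟩ : M)
    have : IsLocalization (Algebra.algebraMapSubmonoid Q P.primeCompl) Q' :=
      Localization.isLocalization
    obtain ⟨m₃, hm₃, hm₃'⟩ := IsLocalization.exists_isIntegral_smul_of_isIntegral_map (Sₘ := Q')
      P.primeCompl (x := (m₂ : R) • q) <| by
        rw [Algebra.smul_def, map_mul, ← hzq, ← IsScalarTower.algebraMap_apply]
        have := hm₂.mul (isIntegral_algebraMap (R := R) (A := Q') (x := m))
        rwa [mul_assoc] at this
    obtain ⟨r, hr⟩ := hsB _ hm₃'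
    -- The factors `m`, `m₂`, `m₃` clear denominators until the element is integral over `R`, and
    -- `s` then brings it into `R`. All four lie outside `P`, so they are invertible in `L`.
    have hu : s * m₃ * m₂ * m ∈ P.primeCompl :=
      mul_mem (mul_mem (mul_mem hs hm₃) m₂.2) hm
    refine ⟨IsLocalization.mk' L r ⟨_, hu⟩, ?_⟩
    have hunit : IsUnit (algebraMap R Q' (s * m₃ * m₂ * m)) := by
      rw [IsScalarTower.algebraMap_apply R L Q']
      exact (IsLocalization.map_units L (⟨_, hu⟩ : P.primeCompl)).map _
    rw [← hunit.mul_left_inj]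
    rw [IsScalarTower.algebraMap_apply R L Q', ← map_mul, IsLocalization.mk'_spec,
      ← IsScalarTower.algebraMap_apply, ← IsScalarTower.algebraMap_apply,
      IsScalarTower.algebraMap_apply R Q Q', hr, Algebra.smul_def, Algebra.smul_def]
    simp only [map_mul, ← IsScalarTower.algebraMap_apply, ← hzq]
    ring

/-- A Noetherian local ring of dimension at most one which is an integrally closed domain is
regular. -/
theorem isRegularLocalRing_of_isIntegrallyClosed {L : Type*} [CommRing L] [IsDomain L]
    [IsLocalRing L] [IsNoetherianRing L] [Ring.KrullDimLE 1 L] [IsIntegrallyClosed L] :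
    IsRegularLocalRing L := by
  have h : IsIntegrallyClosed L ∧ ∀ P : Ideal L, P ≠ ⊥ → P.IsPrime →
      P = IsLocalRing.maximalIdeal L := ⟨inferInstance,
      fun P hP hP' ↦ IsLocalRing.eq_maximalIdeal
        (Ring.krullDimLE_one_iff_of_isPrime_bot.1 inferInstance P hP hP')⟩
  have : IsPrincipalIdealRing L :=
    ((tfae_of_isNoetherianRing_of_isLocalRing_of_isDomain L).out 0 3).2 h
  infer_instance

/-- The criterion for the local ring at a prime of a one-dimensional ring to be regular: it agrees
locally with the integral closure. -/
theorem isRegularLocalRing_iff_exists_mul_mem_range {R L : Type u} {Q : Type*} [CommRing R]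
    [IsNoetherianRing R] [Ring.KrullDimLE 1 R] [CommRing Q] [CommRing L] [Algebra R Q]
    (hinj : Function.Injective (algebraMap R Q)) (hQ : ∀ z : Q, ∃ w, z ^ 2 * w = z)
    (hfin : Module.Finite R (integralClosure R Q)) {f : R} (hf : IsUnit (algebraMap R Q f))
    (hfB : ∀ b : Q, IsIntegral R b → algebraMap R Q f * b ∈ (algebraMap R Q).range)
    (P : Ideal R) [P.IsPrime] [Algebra R L] [IsLocalization.AtPrime L P] :
    IsRegularLocalRing L ↔
      ∃ s ∉ P, ∀ b : Q, IsIntegral R b → algebraMap R Q s * b ∈ (algebraMap R Q).range := by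
  have hlocal : IsLocalRing L := IsLocalization.AtPrime.isLocalRing L P
  have hnoeth : IsNoetherianRing L := IsLocalization.isNoetherianRing P.primeCompl L inferInstance
  have hdim : Ring.KrullDimLE 1 L := by
    rw [Ring.krullDimLE_iff, IsLocalization.AtPrime.ringKrullDim_eq_height P L]
    exact (Ideal.height_le_ringKrullDim_of_ne_top ‹P.IsPrime›.ne_top).trans
      (Ring.krullDimLE_iff.1 inferInstance)
  refine ⟨fun hL ↦ ?_, fun ⟨s, hs, hsB⟩ ↦ ?_⟩
  · have : _root_.IsReduced Q := ⟨fun x hx ↦ by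
      obtain ⟨w, hw⟩ := hQ x
      have key : ∀ n, x = x ^ (n + 1) * w ^ n := by
        intro n
        induction n with
        | zero => simp
        | succ n ih =>
          nth_rewrite 1 [ih]
          linear_combination -(x ^ n * w ^ n) * hw
      obtain ⟨n, hn⟩ := hx
      rw [key n, pow_succ, hn, zero_mul, zero_mul]⟩
    have : _root_.IsReduced R := isReduced_of_injective _ hinj
    let B := integralClosure R Q
    have key : ∀ b : B, ∃ s ∉ P, algebraMap R B s * b ∈ (algebraMap R B).range := by
      intro b
      refine exists_mul_mem_range_of_isRegularLocalRing (L := L) (f := f) ?_ P ?_ ?_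
      · exact Function.Injective.of_comp (f := algebraMap B Q) (by
          rwa [← RingHom.coe_comp, ← IsScalarTower.algebraMap_eq])
      · intro b hb
        ext
        have : algebraMap R Q f * b = 0 := congrArg (algebraMap B Q) hb
        exact hf.mul_right_eq_zero.1 this
      · obtain ⟨r, hr⟩ := hfB b b.2
        exact ⟨r, Subtype.ext hr⟩
    obtain ⟨S, hS⟩ := hfin.fg_top
    classical
    choose s hs hsr using key
    refine ⟨∏ b ∈ S, s b, fun h ↦ ?_, fun b hb ↦ ?_⟩
    · obtain ⟨b, -, hb⟩ := (Ideal.IsPrime.prod_mem_iff).1 h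
      exact hs b hb
    · have : (⟨b, hb⟩ : B) ∈ Submodule.span R (S : Set B) := hS ▸ Submodule.mem_top
      suffices h : ∀ b ∈ Submodule.span R (S : Set B),
          algebraMap R B (∏ b ∈ S, s b) * b ∈ (algebraMap R B).range by
        obtain ⟨r, hr⟩ := h _ this
        exact ⟨r, congrArg (algebraMap B Q) hr⟩
      intro b hb
      induction hb using Submodule.span_induction with
      | mem b hb =>
        rw [← Finset.prod_erase_mul _ _ hb, map_mul, mul_assoc]
        exact mul_mem ⟨_, rfl⟩ (hsr b)
      | zero => simp
      | add x y _ _ hx hy => rw [mul_add]; exact add_mem hx hy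
      | smul r x _ hx =>
        rw [Algebra.smul_def, mul_left_comm]
        exact mul_mem ⟨r, rfl⟩ hx
  · obtain ⟨hdom, hic⟩ := isIntegrallyClosed_of_isLocalization_of_mul_mem hinj hQ P (L := L) hs hsB
    exact isRegularLocalRing_of_isIntegrallyClosed

end Regular

/-! ### Gluing morphisms, and descent along surjections to reduced schemes. -/

/-- Morphisms on an open cover which agree locally on the overlaps glue. -/
theorem exists_glue_of_locally {X T : Scheme.{u}} {I : Type u} (W : I → X.Opens)
    (hW : ∀ x, ∃ i, x ∈ W i) (g : ∀ i, (W i).toScheme ⟶ T)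
    (H : ∀ i j x, x ∈ W i → x ∈ W j → ∃ (V : X.Opens) (hi : V ≤ W i) (hj : V ≤ W j), x ∈ V ∧
      X.homOfLE hi ≫ g i = X.homOfLE hj ≫ g j) :
    ∃ G : X ⟶ T, ∀ i, (W i).ι ≫ G = g i := by
  let 𝒰 : X.OpenCover := X.openCoverOfIsOpenCover W
    (TopologicalSpace.IsOpenCover.mk (eq_top_iff.2 fun x _ ↦
      TopologicalSpace.Opens.mem_iSup.2 (hW x)))
  refine ⟨𝒰.glueMorphisms g fun i j ↦ ?_, fun i ↦ 𝒰.ι_glueMorphisms g _ i⟩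
  refine Scheme.hom_ext_of_forall _ _ fun p ↦ ?_
  change ∃ V : (pullback (W i).ι (W j).ι).Opens, p ∈ V ∧ V.ι ≫ pullback.fst (W i).ι (W j).ι ≫ g i =
    V.ι ≫ pullback.snd (W i).ι (W j).ι ≫ g j
  obtain ⟨V, hi, hj, hx, hV⟩ := H i j ((pullback.fst (W i).ι (W j).ι ≫ (W i).ι) p)
    (pullback.fst (W i).ι (W j).ι p).2
    (by rw [pullback.condition]; exact (pullback.snd (W i).ι (W j).ι p).2)
  refine ⟨(pullback.fst (W i).ι (W j).ι ≫ (W i).ι) ⁻¹ᵁ V, hx, ?_⟩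
  have h1 : ((pullback.fst (W i).ι (W j).ι ≫ (W i).ι) ⁻¹ᵁ V).ι ≫ pullback.fst (W i).ι (W j).ι =
      ((pullback.fst (W i).ι (W j).ι ≫ (W i).ι) ∣_ V) ≫ X.homOfLE hi := by
    rw [← cancel_mono (W i).ι, Category.assoc, Category.assoc, Scheme.homOfLE_ι, morphismRestrict_ι]
  have h2 : ((pullback.fst (W i).ι (W j).ι ≫ (W i).ι) ⁻¹ᵁ V).ι ≫ pullback.snd (W i).ι (W j).ι =
      ((pullback.fst (W i).ι (W j).ι ≫ (W i).ι) ∣_ V) ≫ X.homOfLE hj := by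
    rw [← cancel_mono (W j).ι, Category.assoc, Category.assoc, Scheme.homOfLE_ι, morphismRestrict_ι,
      pullback.condition]
  rw [reassoc_of% h1, reassoc_of% h2, hV]

/-- A surjective morphism to a reduced scheme is an epimorphism. -/
theorem epi_of_surjective {X Y : Scheme.{u}} (f : X ⟶ Y) [Surjective f]
    [AlgebraicGeometry.IsReduced Y] : Epi f := by
  refine ⟨fun {T} g h hgh ↦ ?_⟩
  -- The equalizer is immersed in `Y` and contains the image of `f`. It is therefore a surjective
  -- closed immersion into a reduced scheme.
  have hsurj : Surjective (equalizer.ι g h) := by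
    have : Surjective (equalizer.lift f hgh ≫ equalizer.ι g h) := by
      rwa [equalizer.lift_ι]
    exact Surjective.of_comp (equalizer.lift f hgh) (equalizer.ι g h)
  have : IsClosedImmersion (equalizer.ι g h) := by
    refine IsClosedImmersion.of_isPreimmersion _ ?_
    rw [(equalizer.ι g h).surjective.range_eq]
    exact isClosed_univ
  have := isIso_of_isClosedImmersion_of_surjective (equalizer.ι g h)
  rw [← cancel_epi (equalizer.ι g h), equalizer.condition]

/-- A morphism descends along a surjective morphism to a reduced scheme if it does so locally. -/
theorem exists_lift_of_locally {X Y T : Scheme.{u}} (f : X ⟶ Y) [Surjective f]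
    [AlgebraicGeometry.IsReduced Y] (τ : X ⟶ T)
    (H : ∀ y, ∃ (V : Y.Opens) (l : V.toScheme ⟶ T), y ∈ V ∧ (f ∣_ V) ≫ l = (f ⁻¹ᵁ V).ι ≫ τ) :
    ∃ l : Y ⟶ T, f ≫ l = τ := by
  choose V l hV hl using H
  obtain ⟨G, hG⟩ := exists_glue_of_locally V (fun y ↦ ⟨y, hV y⟩) l fun i j y hi hj ↦ by
    refine ⟨V i ⊓ V j, inf_le_left, inf_le_right, ⟨hi, hj⟩, ?_⟩
    have : Surjective (f ∣_ (V i ⊓ V j)) :=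
      IsZariskiLocalAtTarget.restrict (P := @Surjective) ‹_› _
    have := epi_of_surjective (f ∣_ (V i ⊓ V j))
    rw [← cancel_epi (f ∣_ (V i ⊓ V j))]
    have key : ∀ (k) (hk : V i ⊓ V j ≤ V k), (f ∣_ (V i ⊓ V j)) ≫ Y.homOfLE hk ≫ l k =
        (f ⁻¹ᵁ (V i ⊓ V j)).ι ≫ τ := by
      intro k hk
      have : (f ∣_ (V i ⊓ V j)) ≫ Y.homOfLE hk = X.homOfLE (f.preimage_mono hk) ≫ (f ∣_ V k) := by
        rw [← cancel_mono (V k).ι]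
        simp
      rw [reassoc_of% this, hl, Scheme.homOfLE_ι_assoc]
    rw [key, key]
  refine ⟨G, Scheme.hom_ext_of_forall _ _ fun x ↦ ⟨f ⁻¹ᵁ V (f x), hV (f x), ?_⟩⟩
  rw [← morphismRestrict_ι_assoc, hG, hl]

/-! ### Relative spectra of families of subrings. -/

/-- A family of subrings of the sections of `X` over the preimages of the opens of `Y`, which is
compatible with restriction and localization. -/
structure SectionSubrings {X Y : Scheme.{u}} (f : X ⟶ Y) where
  /-- The subring over an open. -/
  ring : ∀ U : Y.Opens, Subring Γ(X, f ⁻¹ᵁ U)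
  app_mem : ∀ (U : Y.Opens) (a : Γ(Y, U)), f.app U a ∈ ring U
  map_mem : ∀ {U V : Y.Opens} (h : V ≤ U) (b : Γ(X, f ⁻¹ᵁ U)), b ∈ ring U →
    X.presheaf.map (homOfLE (f.preimage_mono h)).op b ∈ ring V
  exists_map_eq : ∀ {U : Y.Opens} (_ : IsAffineOpen U) (r : Γ(Y, U))
    (b : Γ(X, f ⁻¹ᵁ Y.basicOpen r)), b ∈ ring (Y.basicOpen r) →
    ∃ (n : ℕ), ∃ c ∈ ring U, X.presheaf.map (homOfLE (f.preimage_mono (Y.basicOpen_le r))).op c =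
      f.app _ (Y.presheaf.map (homOfLE (Y.basicOpen_le r)).op r) ^ n * b

namespace SectionSubrings

variable {X Y : Scheme.{u}} {f : X ⟶ Y} (S : SectionSubrings f)

/-- The presheaf of rings given by a family of subrings. -/
noncomputable def presheaf : Y.Opensᵒᵖ ⥤ CommRingCat where
  obj U := .of (S.ring U.unop)
  map {V U} i :=
    CommRingCat.ofHom ((X.presheaf.map (homOfLE (f.preimage_mono i.unop.le)).op).hom.restrict
      _ _ fun x hx ↦ S.map_mem i.unop.le x hx)
  map_id U := by
    ext x
    exact congr($(X.presheaf.map_id _) x.1)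
  map_comp i j := by
    ext x
    change X.presheaf.map _ x.1 = X.presheaf.map _ (X.presheaf.map _ x.1)
    rw [← CommRingCat.comp_apply, ← X.presheaf.map_comp]
    rfl

/-- The structure map of the presheaf of rings given by a family of subrings. -/
noncomputable def presheafMap : Y.presheaf ⟶ S.presheaf where
  app U := CommRingCat.ofHom ((f.app U.unop).hom.codRestrict _ (S.app_mem U.unop))
  naturality {U V} i := by ext x; exact Subtype.ext congr($(f.naturality i) x)

open Scheme.AffineZariskiSite


/-- The inclusion of a subring. -/
noncomputable def incl (U : Y.Opens) : S.presheaf.obj (.op U) ⟶ Γ(X, f ⁻¹ᵁ U) :=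
  CommRingCat.ofHom (S.ring U).subtype

theorem incl_map {U V : Y.Opens} (i : U ≤ V) :
    S.incl V ≫ X.presheaf.map (homOfLE (f.preimage_mono i)).op =
      S.presheaf.map (homOfLE i).op ≫ S.incl U := rfl

/-- The inclusion of a subring, as a morphism of schemes on the preimage of an open. -/
noncomputable def preimageToChart (U : Y.Opens) :
    (f ⁻¹ᵁ U).toScheme ⟶ Spec (S.presheaf.obj (.op U)) :=
  (f ⁻¹ᵁ U).toSpecΓ ≫ Spec.map (S.incl U)

theorem homOfLE_preimageToChart {U V : Y.Opens} (i : U ≤ V) :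
    X.homOfLE (f.preimage_mono i) ≫ S.preimageToChart V =
      S.preimageToChart U ≫ Spec.map (S.presheaf.map (homOfLE i).op) := by
  unfold preimageToChart
  rw [← Scheme.Opens.toSpecΓ_SpecMap_presheaf_map_assoc, Category.assoc, ← Spec.map_comp,
    ← Spec.map_comp, incl_map]

variable [QuasiCompact f]

/-- This is the localisation property that lets the spectra of the subrings glue. Surjectivity up to
denominators is `exists_map_eq`. Sections that agree on a basic open agree after multiplication by a
power of `r`, since the preimage of an affine open is quasi-compact. -/
theorem coequifibered_presheafMap :
    Functor.whiskerLeft (toOpensFunctor Y).op S.presheafMap |>.Coequifibered := by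
  refine coequifibered_iff_forall_isLocalizationAway.mpr fun U r ↦ ?_
  let _ : Algebra (S.ring U.toOpens) (S.ring (Y.basicOpen r)) :=
    (S.presheaf.map (homOfLE (Y.basicOpen_le r)).op).hom.toAlgebra
  change IsLocalization.Away ((f.app U.toOpens).hom.codRestrict _ (S.app_mem U.toOpens) r)
    (S.ring (Y.basicOpen r))
  have hmap (c : S.ring U.toOpens) : ((algebraMap (S.ring U.toOpens) (S.ring (Y.basicOpen r)) c : _) :
      Γ(X, f ⁻¹ᵁ Y.basicOpen r)) =
      X.presheaf.map (homOfLE (f.preimage_mono (Y.basicOpen_le r))).op c.1 := rfl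
  have hr : X.presheaf.map (homOfLE (f.preimage_mono (Y.basicOpen_le r))).op (f.app U.toOpens r) =
      f.app _ (Y.presheaf.map (homOfLE (Y.basicOpen_le r)).op r) :=
    congr($(f.naturality (homOfLE (Y.basicOpen_le r)).op) r).symm
  have hunit : IsUnit (Y.presheaf.map (homOfLE (Y.basicOpen_le r)).op r) :=
    RingedSpace.isUnit_res_basicOpen _ r
  refine IsLocalization.Away.mk _ ?_ ?_ ?_
  · have h1 := hunit.map ((f.app (Y.basicOpen r)).hom.codRestrict _ (S.app_mem (Y.basicOpen r)))
    convert h1 using 1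
    exact Subtype.ext hr
  · intro b
    obtain ⟨n, c, hc, hcb⟩ := S.exists_map_eq U.2 r b.1 b.2
    refine ⟨n, ⟨c, hc⟩, Subtype.ext ?_⟩
    rw [hmap, hcb, mul_comm, ← hr]
    rfl
  · intro c d hcd
    have hc' : X.presheaf.map (homOfLE (f.preimage_mono (Y.basicOpen_le r))).op (c.1 - d.1) = 0 := by
      rw [map_sub, sub_eq_zero]
      exact congrArg Subtype.val hcd
    have h2 : X.presheaf.map (homOfLE (X.basicOpen_le (f.app U.toOpens r))).op (c.1 - d.1) = 0 := by
      have h3 := congrArg (X.presheaf.map (eqToHom (f.preimage_basicOpen r).symm).op) hc'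
      rw [map_zero, ← CommRingCat.comp_apply, ← X.presheaf.map_comp] at h3
      exact h3
    obtain ⟨n, hn⟩ := exists_pow_mul_eq_zero_of_res_basicOpen_eq_zero_of_isCompact X
      (f.isCompact_preimage U.2.isCompact) (c.1 - d.1) (f.app U.toOpens r) h2
    rw [mul_sub, sub_eq_zero] at hn
    exact ⟨n, Subtype.ext hn⟩

/-- The scheme obtained by gluing the spectra of the subrings. -/
noncomputable def glueData : (directedCover Y).RelativeGluingData :=
  relativeGluingData S.coequifibered_presheafMap

instance : (S.glueData.functor ⋙ Scheme.forget).IsLocallyDirected :=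
  Scheme.Cover.RelativeGluingData.instIsLocallyDirectedI₀CompFunctorForgetOfIsThin ..

/-- The scheme obtained by gluing the spectra of the subrings. -/
noncomputable def relSpec : Scheme.{u} := S.glueData.glued

/-- The structure morphism. -/
noncomputable def relSpecMap : S.relSpec ⟶ Y := S.glueData.toBase

/-- The affine charts. -/
noncomputable def chart (U : Y.AffineZariskiSite) : Spec (S.presheaf.obj (.op U.toOpens)) ⟶ S.relSpec :=
  S.glueData.cover.f U

instance (U : Y.AffineZariskiSite) : IsOpenImmersion (S.chart U) :=
  S.glueData.cover.map_prop U

theorem chart_relSpecMap (U : Y.AffineZariskiSite) :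
    S.chart U ≫ S.relSpecMap = Spec.map (S.presheafMap.app (.op U.toOpens)) ≫ U.2.fromSpec :=
  colimit.ι_desc _ _

theorem relSpecMap_preimage (U : Y.AffineZariskiSite) :
    S.relSpecMap ⁻¹ᵁ U.toOpens = (S.chart U).opensRange := by
  have := S.glueData.toBase_preimage_eq_opensRange_ι U
  rwa [show ((directedCover Y).f U).opensRange = U.toOpens from Scheme.Opens.opensRange_ι _] at this

theorem map_chart {U V : Y.AffineZariskiSite} (h : U.toOpens ≤ V.toOpens) (i : U ≤ V) :
    Spec.map (S.presheaf.map (homOfLE h).op) ≫ S.chart V = S.chart U :=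
  colimit.w S.glueData.functor (homOfLE i)

/-- The morphism to the glued scheme. -/
theorem exists_toRelSpec : ∃ g : X ⟶ S.relSpec, ∀ U : Y.AffineZariskiSite,
    (f ⁻¹ᵁ U.toOpens).ι ≫ g = S.preimageToChart U.toOpens ≫ S.chart U := by
  refine exists_glue_of_locally (I := Y.AffineZariskiSite) (fun U ↦ f ⁻¹ᵁ U.toOpens) (fun x ↦ ?_)
    (fun U ↦ S.preimageToChart U.toOpens ≫ S.chart U) fun U V x hU hV ↦ ?_
  · obtain ⟨U, hxU⟩ := TopologicalSpace.Opens.mem_iSup.mp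
      ((iSup_affineOpens_eq_top Y).ge (Set.mem_univ (f x)))
    exact ⟨U, hxU⟩
  · obtain ⟨r, s, e, hxr⟩ := exists_basicOpen_le_affine_inter U.2 V.2 _ ⟨hU, hV⟩
    let W : Y.AffineZariskiSite := U.basicOpen r
    have hWU : W ≤ U := U.basicOpen_le r
    have hWV : W ≤ V := ⟨s, e.symm⟩
    refine ⟨f ⁻¹ᵁ W.toOpens, f.preimage_mono (toOpens_mono hWU),
      f.preimage_mono (toOpens_mono hWV), hxr, ?_⟩
    have key {U' : Y.AffineZariskiSite} (h : W ≤ U') :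
        X.homOfLE (f.preimage_mono (toOpens_mono h)) ≫ S.preimageToChart U'.toOpens ≫ S.chart U' =
          S.preimageToChart W.toOpens ≫ S.chart W := by
      have h1 := S.homOfLE_preimageToChart (toOpens_mono h)
      have h2 := S.map_chart (toOpens_mono h) h
      calc _ = (X.homOfLE (f.preimage_mono (toOpens_mono h)) ≫ S.preimageToChart U'.toOpens) ≫
            S.chart U' := rfl
        _ = (S.preimageToChart W.toOpens ≫ _) ≫ S.chart U' := congr($h1 ≫ S.chart U')
        _ = S.preimageToChart W.toOpens ≫ _ ≫ S.chart U' := Category.assoc _ _ _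
        _ = _ := congr(S.preimageToChart W.toOpens ≫ $h2)
    exact (key hWU).trans (key hWV).symm

/-- The morphism to the glued scheme. -/
noncomputable def toRelSpec : X ⟶ S.relSpec := S.exists_toRelSpec.choose

theorem ι_toRelSpec (U : Y.AffineZariskiSite) :
    (f ⁻¹ᵁ U.toOpens).ι ≫ S.toRelSpec = S.preimageToChart U.toOpens ≫ S.chart U :=
  S.exists_toRelSpec.choose_spec U

theorem exists_affine_mem (y : Y) : ∃ U : Y.AffineZariskiSite, y ∈ U.toOpens := by
  obtain ⟨U, hU⟩ := TopologicalSpace.Opens.mem_iSup.mp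
    ((iSup_affineOpens_eq_top Y).ge (Set.mem_univ y))
  exact ⟨U, hU⟩

theorem toRelSpec_relSpecMap : S.toRelSpec ≫ S.relSpecMap = f := by
  refine Scheme.hom_ext_of_forall _ _ fun x ↦ ?_
  obtain ⟨U, hU⟩ := exists_affine_mem (f x)
  refine ⟨f ⁻¹ᵁ U.toOpens, hU, ?_⟩
  rw [reassoc_of% S.ι_toRelSpec U, chart_relSpecMap, preimageToChart, Category.assoc, ← Spec.map_comp_assoc]
  have : S.presheafMap.app (.op U.toOpens) ≫ S.incl U.toOpens = f.app U.toOpens := rfl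
  rw [this]
  simp

theorem preimage_le_preimage_relSpecMap (U : Y.Opens) :
    f ⁻¹ᵁ U ≤ S.toRelSpec ⁻¹ᵁ S.relSpecMap ⁻¹ᵁ U := by
  rw [← Scheme.Hom.comp_preimage, toRelSpec_relSpecMap]

/-- The preimage of `U` in the glued scheme is exactly the chart at `U`. Sections can therefore be
compared through the chart, where the map from `X` is defined by the inclusion of the subring. -/
theorem exists_iso_appLE_toRelSpec (U : Y.AffineZariskiSite) :
    ∃ e : Γ(S.relSpec, S.relSpecMap ⁻¹ᵁ U.toOpens) ≅ S.presheaf.obj (.op U.toOpens),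
      S.toRelSpec.appLE (S.relSpecMap ⁻¹ᵁ U.toOpens) (f ⁻¹ᵁ U.toOpens)
        (S.preimage_le_preimage_relSpecMap _) = e.hom ≫ S.incl U.toOpens := by
  have hle : ⊤ ≤ S.chart U ⁻¹ᵁ S.relSpecMap ⁻¹ᵁ U.toOpens := by
    rw [relSpecMap_preimage]
    simp
  have hiso : IsIso ((S.chart U).appLE (S.relSpecMap ⁻¹ᵁ U.toOpens) ⊤ hle) := by
    have h1 : IsIso ((S.chart U).app (S.relSpecMap ⁻¹ᵁ U.toOpens)) :=
      Scheme.Hom.isIso_app _ _ (by rw [relSpecMap_preimage])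
    have h2 : S.chart U ⁻¹ᵁ S.relSpecMap ⁻¹ᵁ U.toOpens = ⊤ := top_le_iff.1 hle
    have h3 : IsIso ((Spec (S.presheaf.obj (.op U.toOpens))).presheaf.map (homOfLE hle).op) := by
      have : homOfLE hle = eqToHom h2.symm := rfl
      rw [this]
      infer_instance
    rw [Scheme.Hom.appLE]
    infer_instance
  refine ⟨asIso ((S.chart U).appLE (S.relSpecMap ⁻¹ᵁ U.toOpens) ⊤ hle) ≪≫ Scheme.ΓSpecIso _, ?_⟩
  have h4 : (f ⁻¹ᵁ U.toOpens).ι.appLE (f ⁻¹ᵁ U.toOpens) ⊤ (by simp) =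
      (f ⁻¹ᵁ U.toOpens).topIso.inv := by
    rw [Scheme.Opens.ι_appLE]
    rfl
  have h5 : ∀ (g : (f ⁻¹ᵁ U.toOpens).toScheme ⟶ S.relSpec) (h : g = (f ⁻¹ᵁ U.toOpens).ι ≫ S.toRelSpec)
      (hg), ((f ⁻¹ᵁ U.toOpens).ι ≫ S.toRelSpec).appLE (S.relSpecMap ⁻¹ᵁ U.toOpens) ⊤ hg =
      g.appLE (S.relSpecMap ⁻¹ᵁ U.toOpens) ⊤ (h ▸ hg) := by
    rintro _ rfl _
    rfl
  have h6 : ∀ hg, (S.preimageToChart U.toOpens ≫ S.chart U).appLE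
      (S.relSpecMap ⁻¹ᵁ U.toOpens) ⊤ hg = (S.chart U).appLE (S.relSpecMap ⁻¹ᵁ U.toOpens) ⊤ hle ≫
        (S.preimageToChart U.toOpens).appTop := by
    intro hg
    rw [Scheme.Hom.appTop, Scheme.Hom.app_eq_appLE]
    exact (Scheme.Hom.appLE_comp_appLE _ _ _ ⊤ ⊤ hle le_rfl).symm
  rw [← cancel_mono (f ⁻¹ᵁ U.toOpens).topIso.inv, ← h4, Scheme.Hom.appLE_comp_appLE,
    h5 _ (S.ι_toRelSpec U).symm, h6, h4, Iso.trans_hom, asIso_hom, Category.assoc, Category.assoc]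
  congr 1
  rw [preimageToChart, Scheme.Hom.comp_appTop, Scheme.Opens.toSpecΓ_appTop,
    Scheme.ΓSpecIso_naturality_assoc]

theorem isAffineOpen_preimage_relSpecMap (U : Y.AffineZariskiSite) :
    IsAffineOpen (S.relSpecMap ⁻¹ᵁ U.toOpens) := by
  rw [S.relSpecMap_preimage U]
  exact isAffineOpen_opensRange (S.chart U)

instance : IsAffineHom S.relSpecMap where
  isAffine_preimage U hU := S.isAffineOpen_preimage_relSpecMap ⟨U, hU⟩

theorem exists_equiv_appLE_toRelSpec {U : Y.Opens} (hU : IsAffineOpen U) :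
    ∃ e : Γ(S.relSpec, S.relSpecMap ⁻¹ᵁ U) ≃ S.ring U, ∀ b,
      S.toRelSpec.appLE (S.relSpecMap ⁻¹ᵁ U) (f ⁻¹ᵁ U) (S.preimage_le_preimage_relSpecMap _) b =
        (e b).1 := by
  obtain ⟨e, he⟩ := S.exists_iso_appLE_toRelSpec ⟨U, hU⟩
  exact ⟨e.commRingCatIsoToRingEquiv.toEquiv, fun b ↦ congr($he b)⟩

/-- The glued scheme exists: `f` factors through an affine morphism to `Y` whose sections are the
given subrings. -/
theorem exists_factorization : ∃ (X' : Scheme.{u}) (g : X ⟶ X') (h : X' ⟶ Y) (hgh : g ≫ h = f),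
    IsAffineHom h ∧ ∀ {U : Y.Opens} (_ : IsAffineOpen U),
      Function.Injective (g.appLE (h ⁻¹ᵁ U) (f ⁻¹ᵁ U) (by rw [← hgh]; rfl)) ∧
      ∀ b, b ∈ S.ring U ↔ ∃ r, g.appLE (h ⁻¹ᵁ U) (f ⁻¹ᵁ U) (by rw [← hgh]; rfl) r = b := by
  refine ⟨S.relSpec, S.toRelSpec, S.relSpecMap, S.toRelSpec_relSpecMap, inferInstance,
    fun {U} hU ↦ ?_⟩
  obtain ⟨e, he⟩ := S.exists_equiv_appLE_toRelSpec hU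
  refine ⟨fun a b hab ↦ e.injective (Subtype.ext ?_), fun b ↦ ⟨fun hb ↦ ?_, ?_⟩⟩
  · rw [← he, ← he, hab]
  · obtain ⟨r, hr⟩ := e.surjective ⟨b, hb⟩
    exact ⟨r, by rw [he, hr]⟩
  · rintro ⟨r, rfl⟩
    rw [he]
    exact (e r).2

end SectionSubrings

/-! ### Universal homeomorphisms and residue fields. -/

section UniversalHomeomorphism

variable {X Y : Scheme.{u}} {g : X ⟶ Y}

theorem FactorisationTheorem.IsUniversalHomeomorphism.isHomeomorph
    (hg : IsUniversalHomeomorphism g) : IsHomeomorph g :=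
  MorphismProperty.universally_le _ _ hg

theorem FactorisationTheorem.IsUniversalHomeomorphism.universallyInjective
    (hg : IsUniversalHomeomorphism g) : UniversallyInjective g := by
  rw [universallyInjective_iff]
  exact MorphismProperty.universally_mono (fun _ _ _ h ↦ h.injective) _ hg

theorem FactorisationTheorem.IsUniversalHomeomorphism.universallyClosed
    (hg : IsUniversalHomeomorphism g) : UniversallyClosed g := by
  rw [universallyClosed_iff]
  exact MorphismProperty.universally_mono (fun _ _ _ h ↦ h.isClosedMap) _ hg

/-- A topological embedding with closed image is affine, and an affine universally closed morphism
is integral. -/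
theorem FactorisationTheorem.IsUniversalHomeomorphism.isIntegralHom
    (hg : IsUniversalHomeomorphism g) : IsIntegralHom g := by
  rw [IsIntegralHom.iff_universallyClosed_and_isAffineHom]
  exact ⟨hg.universallyClosed, isAffineHom_of_isInducing _ hg.isHomeomorph.isInducing
    hg.isHomeomorph.isClosedEmbedding.isClosed_range⟩

theorem isUniversalHomeomorphism_of_isIntegralHom [IsIntegralHom g] [UniversallyInjective g]
    [Surjective g] : IsUniversalHomeomorphism g := by
  intro X' Y' i₁ i₂ f' h
  have h1 : IsIntegralHom f' := MorphismProperty.of_isPullback h.flip ‹_›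
  have h2 : UniversallyInjective f' := MorphismProperty.of_isPullback h.flip ‹_›
  have h3 : Surjective f' := MorphismProperty.of_isPullback h.flip ‹_›
  exact isHomeomorph_iff_continuous_isClosedMap_bijective.2
    ⟨f'.continuous, f'.isClosedMap, f'.injective, f'.surjective⟩

theorem universallyInjective_of_isIso_residueFieldMap (hinj : Function.Injective g)
    (hres : ∀ x : X, IsIso (g.residueFieldMap x)) : UniversallyInjective g := by
  have key : Function.Injective g ∧ ∀ x, (g.residueFieldMap x).hom.IsPurelyInseparable := ?_
  · exact ((tfae_universallyInjective g).out 2 0).1 key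
  refine ⟨hinj, fun x ↦ ?_⟩
  have h := hres x
  have hb : Function.Bijective (g.residueFieldMap x).hom :=
    ConcreteCategory.bijective_of_isIso (g.residueFieldMap x)
  let _ := (g.residueFieldMap x).hom.toAlgebra
  have hs : Function.Surjective
    (algebraMap (Y.residueField (g x)) (X.residueField x)) := hb.surjective
  have : Algebra.IsIntegral (Y.residueField (g x)) (X.residueField x) :=
    ⟨fun z ↦ by obtain ⟨w, rfl⟩ := hs z; exact isIntegral_algebraMap⟩
  exact ⟨this, fun z _ ↦ hs z⟩

theorem isResidualUniversalHomeomorphism_of_isIntegralHom [IsIntegralHom g] [Surjective g]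
    (hinj : Function.Injective g) (hres : ∀ x : X, IsIso (g.residueFieldMap x)) :
    IsResidualUniversalHomeomorphism g :=
  have := universallyInjective_of_isIso_residueFieldMap hinj hres
  ⟨isUniversalHomeomorphism_of_isIntegralHom, hres⟩

/-- Two morphisms from a reduced scheme to a universally injective scheme over a base agree. -/
theorem eq_of_comp_eq_of_universallyInjective {T : Scheme.{u}} [AlgebraicGeometry.IsReduced T]
    [UniversallyInjective g] [IsSeparated g] {a b : T ⟶ X} (h : a ≫ g = b ≫ g) : a = b := by
  refine ext_of_fromSpecResidueField_eq a b g Set.univ dense_univ (fun x _ ↦ ?_) h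
  have key : UniversallyInjective g ↔ ∀ (K : Type u) [Field K], Function.Injective
      (fun t : Spec (CommRingCat.of K) ⟶ X ↦ t ≫ g) := (tfae_universallyInjective g).out 0 1
  refine key.1 inferInstance (T.residueField x) ?_
  change (T.fromSpecResidueField x ≫ a) ≫ g = (T.fromSpecResidueField x ≫ b) ≫ g
  rw [Category.assoc, Category.assoc, h]

end UniversalHomeomorphism

/-! ### Sections that are constant along the fibres. -/

section GluedSections

variable {X Y : Scheme.{u}}

/-- Sections over the preimage of a basic open extend, up to a power of the defining section. -/
theorem exists_map_eq_app_pow_mul (f : X ⟶ Y) [QuasiCompact f] [QuasiSeparated f] {U : Y.Opens}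
    (hU : IsAffineOpen U) (r : Γ(Y, U)) (b : Γ(X, f ⁻¹ᵁ Y.basicOpen r)) :
    ∃ (n : ℕ) (c : Γ(X, f ⁻¹ᵁ U)),
      X.presheaf.map (homOfLE (f.preimage_mono (Y.basicOpen_le r))).op c =
      f.app _ (Y.presheaf.map (homOfLE (Y.basicOpen_le r)).op r) ^ n * b := by
  have hr : X.presheaf.map (homOfLE (f.preimage_mono (Y.basicOpen_le r))).op (f.app U r) =
      f.app _ (Y.presheaf.map (homOfLE (Y.basicOpen_le r)).op r) :=
    congr($(f.naturality (homOfLE (Y.basicOpen_le r)).op) r).symm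
  obtain ⟨n, c, hc⟩ := exists_eq_pow_mul_of_isCompact_of_isQuasiSeparated X (f ⁻¹ᵁ U)
    (f.isCompact_preimage hU.isCompact) (f.isQuasiSeparated_preimage hU.isQuasiSeparated)
    (f.app U r) (X.presheaf.map (eqToHom (f.preimage_basicOpen r).symm).op b)
  refine ⟨n, c, ?_⟩
  rw [← hr]
  have h := congrArg (X.presheaf.map (eqToHom (f.preimage_basicOpen r)).op) hc
  have e1 : ∀ z, X.presheaf.map (eqToHom (f.preimage_basicOpen r)).op
      (X.presheaf.map (homOfLE (X.basicOpen_le (f.app U r))).op z) =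
      X.presheaf.map (homOfLE (f.preimage_mono (Y.basicOpen_le r))).op z := fun z ↦ by
    rw [← CommRingCat.comp_apply, ← X.presheaf.map_comp]
    rfl
  have e2 : X.presheaf.map (eqToHom (f.preimage_basicOpen r)).op
      (X.presheaf.map (eqToHom (f.preimage_basicOpen r).symm).op b) = b := by
    rw [← CommRingCat.comp_apply, ← X.presheaf.map_comp, ← op_comp, eqToHom_trans, eqToHom_refl,
      op_id, X.presheaf.map_id, CommRingCat.id_apply]
  rw [map_mul, map_pow, e2] at h
  rw [← e1, ← e1]
  exact h

theorem evaluation_app (f : X ⟶ Y) {U : Y.Opens} (x : X) (hx : x ∈ f ⁻¹ᵁ U) (a : Γ(Y, U)) :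
    X.evaluation (f ⁻¹ᵁ U) x hx (f.app U a) = f.residueFieldMap x (Y.evaluation U (f x) hx a) :=
  (Scheme.evaluation_naturality_apply f x hx a).symm

theorem evaluation_map (X : Scheme.{u}) {U V : X.Opens} (h : V ≤ U) (b : Γ(X, U)) (x : X) (hx : x ∈ V) :
    X.evaluation V x hx (X.presheaf.map (homOfLE h).op b) = X.evaluation U x (h hx) b := by
  simp only [Scheme.evaluation, CommRingCat.comp_apply]
  rw [TopCat.Presheaf.germ_res_apply]

/-- The sections over the preimage of an open which are constant, with value in the residue field
of the base, along the fibres. -/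
def gluedSections (f : X ⟶ Y) (U : Y.Opens) : Subring Γ(X, f ⁻¹ᵁ U) where
  carrier := {b | ∃ c : ∀ y, Y.residueField y, ∀ x (hx : x ∈ f ⁻¹ᵁ U),
    X.evaluation (f ⁻¹ᵁ U) x hx b = f.residueFieldMap x (c (f x))}
  mul_mem' := by
    rintro a b ⟨c, hc⟩ ⟨d, hd⟩
    exact ⟨fun y ↦ c y * d y, fun x hx ↦ by rw [map_mul, map_mul, hc, hd]⟩
  add_mem' := by
    rintro a b ⟨c, hc⟩ ⟨d, hd⟩
    exact ⟨fun y ↦ c y + d y, fun x hx ↦ by rw [map_add, map_add, hc, hd]⟩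
  neg_mem' := by
    rintro a ⟨c, hc⟩
    exact ⟨fun y ↦ - c y, fun x hx ↦ by rw [map_neg, map_neg, hc]⟩
  one_mem' := ⟨fun y ↦ 1, fun x hx ↦ by rw [map_one, map_one]⟩
  zero_mem' := ⟨fun y ↦ 0, fun x hx ↦ by rw [map_zero, map_zero]⟩

theorem app_mem_gluedSections (f : X ⟶ Y) (U : Y.Opens) (a : Γ(Y, U)) :
    f.app U a ∈ gluedSections f U := by
  classical
  refine ⟨fun y ↦ if hy : y ∈ U then Y.evaluation U y hy a else 0, fun x hx ↦ ?_⟩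
  refine (evaluation_app f x hx a).trans (Eq.trans ?_ (congrArg (f.residueFieldMap x)
    (dif_pos (show f x ∈ U from hx)).symm))
  rfl

theorem map_mem_gluedSections (f : X ⟶ Y) {U V : Y.Opens} (h : V ≤ U) (b : Γ(X, f ⁻¹ᵁ U))
    (hb : b ∈ gluedSections f U) :
    X.presheaf.map (homOfLE (f.preimage_mono h)).op b ∈ gluedSections f V := by
  obtain ⟨c, hc⟩ := hb
  exact ⟨c, fun x hx ↦ (evaluation_map X (f.preimage_mono h) b x hx).trans (hc x _)⟩

/-- The family of subrings of glued sections. -/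
def gluedSectionSubrings (f : X ⟶ Y) [QuasiCompact f] [QuasiSeparated f] :
    SectionSubrings f where
  ring := gluedSections f
  app_mem := app_mem_gluedSections f
  map_mem := map_mem_gluedSections f
  exists_map_eq {U} hU r b := by
    classical
    rintro ⟨c, hc⟩
    obtain ⟨n, b', hb'⟩ := exists_map_eq_app_pow_mul f hU r b
    -- The extra factor `r` makes the extended section vanish wherever `r` vanishes, so it is glued
    -- there with value `0`. The power `n` alone would give no control over `b'` at those points.
    refine ⟨n + 1, f.app U r * b', ⟨fun y ↦ if hy : y ∈ U then
      Y.evaluation U y hy r ^ (n + 1) * c y else 0, fun x hx ↦ ?_⟩, ?_⟩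
    · refine Eq.trans ?_ (congrArg (f.residueFieldMap x) (dif_pos (show f x ∈ U from hx)).symm)
      rw [map_mul, map_mul, map_pow, evaluation_app]
      by_cases hxr : x ∈ f ⁻¹ᵁ Y.basicOpen r
      · have h1 := evaluation_map X (f.preimage_mono (Y.basicOpen_le r)) b' x hxr
        have h2 := evaluation_map Y (Y.basicOpen_le r) r (f x) hxr
        rw [← h1, hb', map_mul, map_pow, hc x hxr, evaluation_app, h2]
        ring
      · have h0 : Y.evaluation U (f x) hx r = 0 :=
          (Y.evaluation_eq_zero_iff_notMem_basicOpen (f x) hx r).2 hxr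
        rw [h0, map_zero]
        ring
    · have hr : X.presheaf.map (homOfLE (f.preimage_mono (Y.basicOpen_le r))).op (f.app U r) =
          f.app _ (Y.presheaf.map (homOfLE (Y.basicOpen_le r)).op r) :=
        congr($(f.naturality (homOfLE (Y.basicOpen_le r)).op) r).symm
      rw [map_mul, hb', hr]
      ring

/-- No compatibility is required between the values at different points of `Y`, so they may be
chosen one fibre at a time. -/
theorem mem_gluedSections_of_forall {f : X ⟶ Y} {U : Y.Opens} {b : Γ(X, f ⁻¹ᵁ U)}
    (H : ∀ y ∈ U, ∃ c : ∀ y, Y.residueField y, ∀ x (hx : x ∈ f ⁻¹ᵁ U), f x = y →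
      X.evaluation (f ⁻¹ᵁ U) x hx b = f.residueFieldMap x (c (f x))) :
    b ∈ gluedSections f U := by
  classical
  choose c hc using H
  refine ⟨fun y ↦ if hy : y ∈ U then c y hy y else 0, fun x hx ↦ ?_⟩
  exact (hc (f x) hx x hx rfl).trans
    (congrArg (f.residueFieldMap x) (dif_pos hx :
      (if hy : f x ∈ U then c (f x) hy (f x) else 0) = c (f x) hx (f x)).symm)

/-- Over a point with a single preimage and trivial residue extension, being glued is no condition.
-/
theorem exists_evaluation_eq_of_isIso {f : X ⟶ Y} (x : X) [IsIso (f.residueFieldMap x)]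
    (hinj : ∀ x', f x' = f x → x' = x) {U : Y.Opens} (b : Γ(X, f ⁻¹ᵁ U)) :
    ∃ c : ∀ y, Y.residueField y, ∀ x' (hx' : x' ∈ f ⁻¹ᵁ U), f x' = f x →
      X.evaluation (f ⁻¹ᵁ U) x' hx' b = f.residueFieldMap x' (c (f x')) := by
  classical
  by_cases hx : x ∈ f ⁻¹ᵁ U
  · obtain ⟨c, hc⟩ := (ConcreteCategory.bijective_of_isIso (f.residueFieldMap x)).surjective
      (X.evaluation (f ⁻¹ᵁ U) x hx b)
    refine ⟨Function.update (fun _ ↦ 0) (f x) c, fun x' hx' h ↦ ?_⟩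
    obtain rfl := hinj x' h
    rw [Function.update_self, hc]
  · refine ⟨fun _ ↦ 0, fun x' hx' h ↦ absurd ?_ hx⟩
    obtain rfl := hinj x' h
    exact hx'

/-- If `f` is injective and induces isomorphisms on residue fields, all sections are glued. -/
theorem mem_gluedSections_of_injective {f : X ⟶ Y} (hf : Function.Injective f)
    (hres : ∀ x : X, IsIso (f.residueFieldMap x)) {U : Y.Opens} (b : Γ(X, f ⁻¹ᵁ U)) :
    b ∈ gluedSections f U := by
  refine mem_gluedSections_of_forall fun y _ ↦ ?_
  by_cases hy : ∃ x, f x = y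
  · obtain ⟨x, rfl⟩ := hy
    have := hres x
    exact exists_evaluation_eq_of_isIso x (fun x' h ↦ hf h) b
  · exact ⟨fun _ ↦ 0, fun x _ hxy ↦ absurd ⟨x, hxy⟩ hy⟩

end GluedSections

/-! ### Descent of morphisms from descent of sections. -/

section Descent

variable {X X' Y T : Scheme.{u}}

/-- Pulling back sections along a surjection to a reduced scheme is injective. -/
theorem injective_app_of_surjective (g : X ⟶ X') [Surjective g] [AlgebraicGeometry.IsReduced X']
    (V : X'.Opens) : Function.Injective (g.app V) := by
  refine (injective_iff_map_eq_zero _).2 fun s hs ↦ eq_zero_of_basicOpen_eq_bot s ?_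
  rw [Scheme.basicOpen_eq_bot_iff_forall_evaluation_eq_zero]
  rintro ⟨y, hy⟩
  obtain ⟨x, rfl⟩ := g.surjective y
  have h1 := evaluation_app g x hy s
  rw [hs, map_zero] at h1
  exact (map_eq_zero _).1 h1.symm

theorem toSpecΓ_SpecMap_appLE_fromSpec (g : X ⟶ T) {A : T.Opens} (hA : IsAffineOpen A)
    (W : X.Opens) (e : W ≤ g ⁻¹ᵁ A) :
    W.toSpecΓ ≫ Spec.map (g.appLE A W e) ≫ hA.fromSpec = W.ι ≫ g := by
  rw [← Category.assoc, Scheme.Opens.toSpecΓ_SpecMap_appLE, Category.assoc,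
    IsAffineOpen.toSpecΓ_fromSpec, Scheme.Hom.resLE_comp_ι]

/-- A morphism `g'` descends along `g` if its sections do. -/
theorem exists_lift_of_sections (g : X ⟶ X') [Surjective g] [AlgebraicGeometry.IsReduced X']
    (g' : X ⟶ T)
    (H : ∀ x' : X', ∃ (V : X'.Opens) (A : T.Opens) (_ : IsAffineOpen A)
      (e : g ⁻¹ᵁ V ≤ g' ⁻¹ᵁ A), x' ∈ V ∧
        ∀ t : Γ(T, A), ∃ r : Γ(X', V), g.app V r = g'.appLE A _ e t) :
    ∃ l : X' ⟶ T, g ≫ l = g' := by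
  refine exists_lift_of_locally g g' fun x' ↦ ?_
  obtain ⟨V, A, hA, e, hxV, hV⟩ := H x'
  have hinj := injective_app_of_surjective g V
  -- Pullback to `X` is injective, so the chosen preimages are unique and form a ring homomorphism.
  choose ψ hψ using hV
  let φ : Γ(T, A) ⟶ Γ(X', V) := CommRingCat.ofHom
    { toFun := ψ
      map_one' := hinj (by rw [hψ, map_one, map_one])
      map_mul' := fun a b ↦ hinj (by rw [map_mul, hψ, hψ, hψ, map_mul])
      map_zero' := hinj (by rw [hψ, map_zero, map_zero])
      map_add' := fun a b ↦ hinj (by rw [map_add, hψ, hψ, hψ, map_add]) }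
  have hφ : φ ≫ g.app V = g'.appLE A _ e := by
    ext t
    exact hψ t
  refine ⟨V, V.toSpecΓ ≫ Spec.map φ ≫ hA.fromSpec, hxV, ?_⟩
  rw [← toSpecΓ_SpecMap_appLE_fromSpec g' hA _ e, ← hφ, Spec.map_comp, Category.assoc,
    Scheme.Opens.toSpecΓ_naturality_assoc]

end Descent

/-! ### What injectivity and gluedness of sections say about a factorisation. -/

section Factorization

variable {X X' Y : Scheme.{u}}

/-- A basic open that misses the image is defined by a section which pulls back to one with empty
basic open. That pullback is zero because `X` is reduced, so by injectivity the section is zero and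
the basic open is empty. -/
theorem isDominant_of_injective_app (g : X ⟶ X') (h : X' ⟶ Y) [IsAffineHom h]
    [AlgebraicGeometry.IsReduced X]
    (H : ∀ {U : Y.Opens}, IsAffineOpen U → Function.Injective (g.app (h ⁻¹ᵁ U))) :
    IsDominant g := by
  refine ⟨fun x' ↦ mem_closure_iff.2 fun W hW hxW ↦ ?_⟩
  obtain ⟨U, hU⟩ := SectionSubrings.exists_affine_mem (h x')
  have hV : IsAffineOpen (h ⁻¹ᵁ U.toOpens) := U.2.preimage h
  obtain ⟨s, hsW, hxs⟩ := hV.exists_basicOpen_le (V := ⟨W, hW⟩) ⟨x', hxW⟩ hU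
  by_contra hempty
  have h1 : g.app _ s = 0 := by
    refine eq_zero_of_basicOpen_eq_bot _ (eq_bot_iff.2 fun x hx ↦ hempty ?_)
    rw [← Scheme.Hom.preimage_basicOpen] at hx
    exact ⟨g x, hsW hx, x, rfl⟩
  rw [H U.2 (h1.trans (map_zero _).symm), Scheme.basicOpen_zero] at hxs
  exact hxs

theorem isReduced_of_isReduced_app (h : X' ⟶ Y) [IsAffineHom h]
    (H : ∀ {U : Y.Opens}, IsAffineOpen U → _root_.IsReduced Γ(X', h ⁻¹ᵁ U)) :
    AlgebraicGeometry.IsReduced X' := by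
  have (x' : X') : _root_.IsReduced (X'.presheaf.stalk x') := by
    obtain ⟨U, hU⟩ := SectionSubrings.exists_affine_mem (h x')
    have hV : IsAffineOpen (h ⁻¹ᵁ U.toOpens) := U.2.preimage h
    have : _root_.IsReduced Γ(X', h ⁻¹ᵁ U.toOpens) := H U.2
    let _ : Algebra Γ(X', h ⁻¹ᵁ U.toOpens) (X'.presheaf.stalk x') :=
      TopCat.Presheaf.algebra_section_stalk X'.presheaf (⟨x', hU⟩ : (h ⁻¹ᵁ U.toOpens : X'.Opens))
    have := hV.isLocalization_stalk ⟨x', hU⟩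
    exact isReduced_localizationPreserves (hV.primeIdealOf ⟨x', hU⟩).asIdeal.primeCompl _ ‹_›
  exact isReduced_of_isReduced_stalk X'

theorem isReduced_of_injective_app (g : X ⟶ X') (h : X' ⟶ Y) [IsAffineHom h]
    [AlgebraicGeometry.IsReduced X]
    (H : ∀ {U : Y.Opens}, IsAffineOpen U → Function.Injective (g.app (h ⁻¹ᵁ U))) :
    AlgebraicGeometry.IsReduced X' :=
  isReduced_of_isReduced_app h fun hU ↦ isReduced_of_injective (g.app _).hom (H hU)

/-- An integral equation for the pullback of a section to `X` already holds on `X'`, by injectivity.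
-/
theorem isIntegralHom_of_injective_app (g : X ⟶ X') (h : X' ⟶ Y) [IsAffineHom h]
    [IsIntegralHom (g ≫ h)]
    (H : ∀ {U : Y.Opens}, IsAffineOpen U → Function.Injective (g.app (h ⁻¹ᵁ U))) :
    IsIntegralHom h where
  isIntegral_app U hU b := by
    obtain ⟨p, hp, hp0⟩ := (g ≫ h).isIntegral_app U hU (g.app _ b)
    have h1 : g.app (h ⁻¹ᵁ U) (Polynomial.eval₂ (h.app U).hom b p) = 0 :=
      (Polynomial.hom_eval₂ _ _ _ _).trans hp0
    exact ⟨p, hp, H hU (h1.trans (map_zero _).symm)⟩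

theorem app_mem_gluedSections_comp (g : X ⟶ X') (h : X' ⟶ Y) {U : Y.Opens} {r : Γ(X', h ⁻¹ᵁ U)}
    (hr : r ∈ gluedSections h U) : g.app (h ⁻¹ᵁ U) r ∈ gluedSections (g ≫ h) U := by
  obtain ⟨c, hc⟩ := hr
  refine ⟨c, fun x hx ↦ ?_⟩
  have h1 := evaluation_app g (U := h ⁻¹ᵁ U) x hx r
  rw [hc (g x) hx] at h1
  rw [Scheme.residueFieldMap_comp]
  exact h1

theorem mem_gluedSections_of_app_mem (g : X ⟶ X') (h : X' ⟶ Y) [Surjective g] {U : Y.Opens}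
    {r : Γ(X', h ⁻¹ᵁ U)} (hr : g.app (h ⁻¹ᵁ U) r ∈ gluedSections (g ≫ h) U) :
    r ∈ gluedSections h U := by
  obtain ⟨c, hc⟩ := hr
  refine ⟨c, fun x' hx' ↦ ?_⟩
  obtain ⟨x, rfl⟩ := g.surjective x'
  have h1 := evaluation_app g (U := h ⁻¹ᵁ U) x hx' r
  have h2 := hc x hx'
  rw [Scheme.residueFieldMap_comp] at h2
  exact (g.residueFieldMap x).hom.injective (h1.symm.trans h2)

theorem map_mem_gluedSections_of_eq {f₁ f₂ : X ⟶ Y} (e : f₁ = f₂) {U : Y.Opens}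
    {b : Γ(X, f₁ ⁻¹ᵁ U)} (hb : b ∈ gluedSections f₁ U) :
    X.presheaf.map (homOfLE (e ▸ le_rfl : f₂ ⁻¹ᵁ U ≤ f₁ ⁻¹ᵁ U)).op b ∈ gluedSections f₂ U := by
  subst e
  exact map_mem_gluedSections f₁ le_rfl b hb

/-- The fibre over `y` has at most one point if all sections are constant on it. -/
theorem eq_of_forall_evaluation_eq (h : X ⟶ Y) [IsAffineHom h] {U : Y.Opens} (hU : IsAffineOpen U)
    {y : Y} (hy : y ∈ U) (H : ∀ r : Γ(X, h ⁻¹ᵁ U), ∃ c : ∀ y, Y.residueField y,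
      ∀ x (hx : x ∈ h ⁻¹ᵁ U), h x = y → X.evaluation _ x hx r = h.residueFieldMap x (c (h x)))
    {x₁ x₂ : X} (h₁ : h x₁ = y) (h₂ : h x₂ = y) : x₁ = x₂ := by
  have hV : IsAffineOpen (h ⁻¹ᵁ U) := hU.preimage h
  -- Whether a section vanishes at a point of the fibre depends only on its common value over `y`.
  -- Basic opens, and hence all opens, cannot separate two points of the fibre.
  have key : ∀ (x x' : X) (W : X.Opens), x ∈ W → h x = y → h x' = y → x' ∈ W := by
    rintro x x' W hxW rfl hxx'
    have hx : x ∈ h ⁻¹ᵁ U := hy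
    have hx' : x' ∈ h ⁻¹ᵁ U := (hxx' ▸ hy : h x' ∈ U)
    obtain ⟨s, hsW, hxs⟩ := hV.exists_basicOpen_le ⟨x, hxW⟩ hy
    obtain ⟨c, hc⟩ := H s
    refine hsW ((X.evaluation_ne_zero_iff_mem_basicOpen x' hx' s).1 ?_)
    have h1 := (X.evaluation_ne_zero_iff_mem_basicOpen x hx s).2 hxs
    rw [hc x hx rfl, Ne, map_eq_zero] at h1
    rw [hc x' hx' hxx', Ne, map_eq_zero, hxx']
    exact h1
  by_contra hne
  obtain ⟨W, hW, hx⟩ := exists_isOpen_xor_mem hne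
  rcases hx with ⟨h3, h4⟩ | ⟨h3, h4⟩
  · exact h4 (key _ _ ⟨W, hW⟩ h3 h₁ h₂)
  · exact h4 (key _ _ ⟨W, hW⟩ h3 h₂ h₁)

theorem exists_evaluation_mul_eq {V : X.Opens} (hV : IsAffineOpen V) (x : X) (hx : x ∈ V)
    (z : X.residueField x) : ∃ s a : Γ(X, V), X.evaluation V x hx s ≠ 0 ∧
      z * X.evaluation V x hx s = X.evaluation V x hx a := by
  obtain ⟨w, rfl⟩ := X.residue_surjective x z
  let _ : Algebra Γ(X, V) (X.presheaf.stalk x) :=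
    TopCat.Presheaf.algebra_section_stalk X.presheaf (⟨x, hx⟩ : V)
  have := hV.isLocalization_stalk ⟨x, hx⟩
  obtain ⟨⟨a, s⟩, has⟩ := IsLocalization.surj (hV.primeIdealOf ⟨x, hx⟩).asIdeal.primeCompl w
  have hs : IsUnit (X.presheaf.germ V x hx s) := IsLocalization.map_units _ s
  refine ⟨s, a, (hs.map (X.residue x).hom).ne_zero, ?_⟩
  have h1 := congrArg (X.residue x) has
  rw [map_mul] at h1
  exact h1

/-- Elements of the residue field at `x` are quotients of values of sections, and all these values
come from the base. -/
theorem isIso_residueFieldMap_of_forall_evaluation_eq (h : X ⟶ Y) [IsAffineHom h] {U : Y.Opens}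
    (hU : IsAffineOpen U) (x : X) (hx : x ∈ h ⁻¹ᵁ U)
    (H : ∀ r : Γ(X, h ⁻¹ᵁ U), ∃ c, X.evaluation _ x hx r = h.residueFieldMap x c) :
    IsIso (h.residueFieldMap x) := by
  have : Function.Bijective (h.residueFieldMap x) := by
    refine ⟨(h.residueFieldMap x).hom.injective, fun z ↦ ?_⟩
    obtain ⟨s, a, hs, hz⟩ := exists_evaluation_mul_eq (hU.preimage h) x hx z
    obtain ⟨c, hc⟩ := H s
    obtain ⟨d, hd⟩ := H a
    refine ⟨d / c, ?_⟩
    rw [map_div₀, ← hc, ← hd, ← hz]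
    exact mul_div_cancel_right₀ _ hs
  exact (ConcreteCategory.isIso_iff_bijective _).2 this

/-- If all sections of `X` are glued, then `X ⟶ Y` is injective. -/
theorem injective_of_mem_gluedSections (h : X ⟶ Y) [IsAffineHom h]
    (H : ∀ {U : Y.Opens}, IsAffineOpen U → ∀ r, r ∈ gluedSections h U) :
    Function.Injective h := by
  intro x₁ x₂ h12
  obtain ⟨U, hU⟩ := SectionSubrings.exists_affine_mem (h x₁)
  refine eq_of_forall_evaluation_eq h U.2 hU (fun r ↦ ?_) rfl h12.symm
  obtain ⟨c, hc⟩ := H U.2 r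
  exact ⟨c, fun x hx _ ↦ hc x hx⟩

theorem isIso_residueFieldMap_of_mem_gluedSections (h : X ⟶ Y) [IsAffineHom h]
    (H : ∀ {U : Y.Opens}, IsAffineOpen U → ∀ r, r ∈ gluedSections h U)
    (x : X) : IsIso (h.residueFieldMap x) := by
  obtain ⟨U, hU⟩ := SectionSubrings.exists_affine_mem (h x)
  refine isIso_residueFieldMap_of_forall_evaluation_eq h U.2 x hU fun r ↦ ?_
  obtain ⟨c, hc⟩ := H U.2 r
  exact ⟨_, hc x hU⟩

end Factorization

/-! ### The scheme of glued sections and its universal property. -/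

section Seminormalisation

variable {X Y : Scheme.{u}}

/-- `g : X ⟶ X'` and `h : X' ⟶ Y` factor an integral surjective morphism in such a way that `X'` is
the scheme of glued sections. -/
structure IsGluedFactorization {X X' Y : Scheme.{u}} (g : X ⟶ X') (h : X' ⟶ Y) : Prop where
  isResidualUniversalHomeomorphism : IsResidualUniversalHomeomorphism h
  surjective : Surjective g
  isReduced : AlgebraicGeometry.IsReduced X'
  exists_app_eq : ∀ {U : Y.Opens}, IsAffineOpen U → ∀ b ∈ gluedSections (g ≫ h) U,
    ∃ r, g.app (h ⁻¹ᵁ U) r = b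

theorem exists_isGluedFactorization (f : X ⟶ Y) [IsIntegralHom f] [Surjective f]
    [AlgebraicGeometry.IsReduced X] :
    ∃ (X' : Scheme.{u}) (g : X ⟶ X') (h : X' ⟶ Y), g ≫ h = f ∧ IsGluedFactorization g h := by
  obtain ⟨X', g, h, rfl, haff, H⟩ := (gluedSectionSubrings f).exists_factorization
  have hinj : ∀ {U : Y.Opens}, IsAffineOpen U → Function.Injective (g.app (h ⁻¹ᵁ U)) := by
    intro U hU
    have := (H hU).1
    rwa [Scheme.Hom.app_eq_appLE]
  have hmem : ∀ {U : Y.Opens}, IsAffineOpen U → ∀ b, b ∈ gluedSections (g ≫ h) U ↔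
      ∃ r, g.app (h ⁻¹ᵁ U) r = b := by
    intro U hU
    have := (H hU).2
    rwa [Scheme.Hom.app_eq_appLE]
  have hred := isReduced_of_injective_app g h hinj
  have hdom := isDominant_of_injective_app g h hinj
  have hint := isIntegralHom_of_injective_app g h hinj
  have hint' : IsIntegralHom g := IsIntegralHom.of_comp g h
  have hsurj : Surjective g :=
    surjective_of_isDominant_of_isClosed_range _ g.isClosedMap.isClosed_range
  have hsurj' : Surjective h := Surjective.of_comp g h
  have hglued : ∀ {U : Y.Opens}, IsAffineOpen U → ∀ r, r ∈ gluedSections h U := fun hU r ↦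
    mem_gluedSections_of_app_mem g h ((hmem hU _).2 ⟨r, rfl⟩)
  exact ⟨X', g, h, rfl, isResidualUniversalHomeomorphism_of_isIntegralHom
    (injective_of_mem_gluedSections h hglued)
    (isIso_residueFieldMap_of_mem_gluedSections h hglued), hsurj, hred,
    fun hU b ↦ (hmem hU b).1⟩

/-- The scheme of glued sections maps to all universal homeomorphisms with trivial residue field
extensions through which `X` factors. -/
theorem IsGluedFactorization.exists_lift {X' T : Scheme.{u}} {g : X ⟶ X'} {h : X' ⟶ Y}
    (hgh : IsGluedFactorization g h) (g' : X ⟶ T) (k : T ⟶ Y)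
    (hk : IsResidualUniversalHomeomorphism k) (hgk : g' ≫ k = g ≫ h) :
    ∃ l : X' ⟶ T, g ≫ l = g' ∧ l ≫ k = h := by
  have := hgh.surjective
  have := hgh.isReduced
  have := hk.isUniversalHomeomorphism.isIntegralHom
  have := epi_of_surjective g
  suffices h : ∃ l, g ≫ l = g' by
    obtain ⟨l, hl⟩ := h
    exact ⟨l, hl, by rw [← cancel_epi g, reassoc_of% hl, hgk]⟩
  refine exists_lift_of_sections g g' fun x' ↦ ?_
  obtain ⟨U, hU⟩ := SectionSubrings.exists_affine_mem (h x')
  refine ⟨h ⁻¹ᵁ U.toOpens, k ⁻¹ᵁ U.toOpens, U.2.preimage k, ?_, hU, fun t ↦ ?_⟩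
  · rw [← Scheme.Hom.comp_preimage, ← Scheme.Hom.comp_preimage, hgk]
  -- Every section of `T` is glued over `Y` because `k` is injective with trivial residue
  -- extensions. Its pullback to `X` stays glued, so it comes from `X'`.
  · have h1 := app_mem_gluedSections_comp g' k (mem_gluedSections_of_injective
      hk.isUniversalHomeomorphism.isHomeomorph.injective hk.isIso_residueFieldMap t)
    obtain ⟨r, hr⟩ := hgh.exists_app_eq U.2 _ (map_mem_gluedSections_of_eq hgk h1)
    exact ⟨r, hr⟩

end Seminormalisation

/-! ### Dimension, and the points of affine opens. -/

section Dimension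

open TopologicalSpace

/-- The dimension of a space is bounded by those of its irreducible components. -/
theorem topologicalKrullDim_le_of_irreducibleComponents {X : Type*} [TopologicalSpace X]
    {n : WithBot ℕ∞} (h : ∀ Z ∈ irreducibleComponents X, topologicalKrullDim Z ≤ n) :
    topologicalKrullDim X ≤ n := by
  refine iSup_le fun p ↦ ?_
  obtain ⟨W, hW, hpW⟩ :=
    exists_mem_irreducibleComponents_subset_of_isIrreducible _ p.last.isIrreducible
  have hle : ∀ i, (p i : Set X) ⊆ W := fun i ↦
    Set.Subset.trans (SetLike.coe_subset_coe.2 (LTSeries.monotone p (Fin.le_last i))) hpW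
  let r (i : Fin (p.length + 1)) : IrreducibleCloseds W :=
    { carrier := Subtype.val ⁻¹' (p i : Set X)
      isIrreducible' := by
        obtain ⟨⟨x, hx⟩, hirr⟩ := (p i).isIrreducible
        refine ⟨⟨⟨x, hle i hx⟩, hx⟩, ?_⟩
        rintro _ _ ⟨u, hu, rfl⟩ ⟨v, hv, rfl⟩ ⟨a, ha, hau⟩ ⟨b, hb, hbv⟩
        obtain ⟨c, hc, hcu, hcv⟩ := hirr u v hu hv ⟨a, ha, hau⟩ ⟨b, hb, hbv⟩
        exact ⟨⟨c, hle i hc⟩, hc, hcu, hcv⟩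
      isClosed' := (p i).isClosed.preimage continuous_subtype_val }
  have hr (i : Fin p.length) : r i.castSucc < r i.succ := by
    obtain ⟨h2, x, hx, hx'⟩ := SetLike.lt_iff_le_and_exists.1
      (show p i.castSucc < p i.succ from p.step i)
    exact lt_iff_le_not_ge.2 ⟨fun y hy ↦ h2 hy,
      fun h ↦ hx' (h (show (⟨x, hle _ hx⟩ : W) ∈ r i.succ from hx))⟩
  let q : LTSeries (IrreducibleCloseds W) := ⟨p.length, r, hr⟩
  exact (Order.LTSeries.length_le_krullDim q).trans (h W hW)

end Dimension

section AffineOpen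

variable {X : Scheme.{u}} {U : X.Opens}

/-- The prime ideals of the sections over an affine open are given by its points. -/
theorem exists_evaluation_eq_zero_iff_mem (hU : IsAffineOpen U) (m : Ideal Γ(X, U))
    [hm : m.IsPrime] : ∃ x, ∃ hx : x ∈ U, ∀ b, b ∈ m ↔ X.evaluation U x hx b = 0 := by
  let p : Spec Γ(X, U) := ⟨m, hm⟩
  have hp : hU.fromSpec p ∈ U := by
    rw [← SetLike.mem_coe, ← hU.range_fromSpec]
    exact ⟨p, rfl⟩
  refine ⟨hU.fromSpec p, hp, fun b ↦ ?_⟩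
  rw [← not_iff_not, ← Ne, X.evaluation_ne_zero_iff_mem_basicOpen _ hp b]
  have h1 : p ∈ hU.fromSpec ⁻¹ᵁ X.basicOpen b ↔ b ∉ m := by
    rw [hU.fromSpec_preimage_basicOpen]
    rfl
  exact h1.symm

/-- Sections over affine opens detect specialisations. -/
theorem specializes_of_evaluation_eq_zero (hU : IsAffineOpen U) {x y : X} (hx : x ∈ U)
    (hy : y ∈ U) (h : ∀ b : Γ(X, U), X.evaluation U x hx b = 0 → X.evaluation U y hy b = 0) :
    x ⤳ y := by
  refine specializes_iff_forall_open.2 fun W hW hyW ↦ ?_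
  obtain ⟨s, hsW, hys⟩ := hU.exists_basicOpen_le (V := ⟨W, hW⟩) ⟨y, hyW⟩ hy
  refine hsW ((X.evaluation_ne_zero_iff_mem_basicOpen x hx s).1 fun h0 ↦ ?_)
  exact (X.evaluation_ne_zero_iff_mem_basicOpen y hy s).2 hys (h s h0)

theorem krullDimLE_of_topologicalKrullDim_le {n : ℕ} (h : topologicalKrullDim X ≤ n)
    (hU : IsAffineOpen U) : Ring.KrullDimLE n Γ(X, U) := by
  rw [Ring.krullDimLE_iff, ← PrimeSpectrum.topologicalKrullDim_eq_ringKrullDim]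
  exact (hU.fromSpec.isOpenEmbedding.isInducing.topologicalKrullDim_le).trans h

end AffineOpen

/-! ### The scheme of generic points. -/

section Generic

variable (S : Scheme.{u})

/-- The inclusions of the generic points. -/
noncomputable def genericSchemeι (i : genericPoints S) : Spec (S.residueField i.1) ⟶ genericScheme S :=
  Sigma.ι (fun x : genericPoints S ↦ Spec (S.residueField x.1)) i

theorem genericSchemeι_genericSchemeMap (i : genericPoints S) :
    genericSchemeι S i ≫ genericSchemeMap S = S.fromSpecResidueField i.1 := Sigma.ι_desc _ _

theorem exists_genericSchemeι_eq (x : genericScheme S) : ∃ i z, genericSchemeι S i z = x := by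
  obtain ⟨⟨i, z⟩, hz⟩ := (sigmaMk (fun x : genericPoints S ↦ Spec (S.residueField x.1))).surjective x
  exact ⟨i, z, (sigmaMk_mk (fun x : genericPoints S ↦ Spec (S.residueField x.1)) i z).symm.trans hz⟩

theorem genericSchemeMap_genericSchemeι (i : genericPoints S) (z : Spec (S.residueField i.1)) :
    genericSchemeMap S (genericSchemeι S i z) = i.1 := by
  rw [← Scheme.Hom.comp_apply, genericSchemeι_genericSchemeMap]
  exact S.fromSpecResidueField_apply i.1 z

theorem genericSchemeMap_mem (x : genericScheme S) : genericSchemeMap S x ∈ genericPoints S := by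
  obtain ⟨i, z, rfl⟩ := exists_genericSchemeι_eq S x
  rw [genericSchemeMap_genericSchemeι]
  exact i.2

theorem genericSchemeMap_injective : Function.Injective (genericSchemeMap S) := by
  intro x x' h
  obtain ⟨i, z, rfl⟩ := exists_genericSchemeι_eq S x
  obtain ⟨i', z', rfl⟩ := exists_genericSchemeι_eq S x'
  rw [genericSchemeMap_genericSchemeι, genericSchemeMap_genericSchemeι] at h
  obtain rfl := Subtype.ext h
  rw [Subsingleton.elim z z']

theorem exists_genericSchemeMap_eq {x : S} (hx : x ∈ genericPoints S) :
    ∃ z, genericSchemeMap S z = x :=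
  ⟨_, genericSchemeMap_genericSchemeι S ⟨x, hx⟩ (IsLocalRing.closedPoint _)⟩

theorem surjective_residueFieldMap_genericSchemeMap (x : genericScheme S) :
    Function.Surjective ((genericSchemeMap S).residueFieldMap x) := by
  obtain ⟨i, z, rfl⟩ := exists_genericSchemeι_eq S x
  have h2 : Function.Surjective ((genericSchemeι S i ≫ genericSchemeMap S).residueFieldMap z) := by
    have : IsPreimmersion (genericSchemeι S i ≫ genericSchemeMap S) := by
      rw [genericSchemeι_genericSchemeMap]
      infer_instance
    intro w
    obtain ⟨v, rfl⟩ := Scheme.residue_surjective _ _ w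
    obtain ⟨v', rfl⟩ := (genericSchemeι S i ≫ genericSchemeMap S).stalkMap_surjective z v
    exact ⟨Scheme.residue _ _ v', 
      congr($(Scheme.residue_residueFieldMap (genericSchemeι S i ≫ genericSchemeMap S) z) v')⟩
  rw [Scheme.residueFieldMap_comp] at h2
  intro w
  obtain ⟨v, hv⟩ := h2 ((genericSchemeι S i).residueFieldMap z w)
  exact ⟨v, ((genericSchemeι S i).residueFieldMap z).hom.injective hv⟩

instance isReduced_genericScheme : AlgebraicGeometry.IsReduced (genericScheme S) := by
  have (i : _) : AlgebraicGeometry.IsReduced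
    ((sigmaOpenCover fun x : genericPoints S ↦ Spec (S.residueField x.1)).X i) :=
    inferInstanceAs (AlgebraicGeometry.IsReduced (Spec _))
  exact IsReduced.of_openCover _ (sigmaOpenCover fun x : genericPoints S ↦ Spec (S.residueField x.1))

instance discreteTopology_genericScheme : DiscreteTopology (genericScheme S) :=
  (sigmaMk fun x : genericPoints S ↦ Spec (S.residueField x.1)).symm.isEmbedding.discreteTopology

theorem isAffineOpen_genericScheme [IsNoetherian S] (U : (genericScheme S).Opens) :
    IsAffineOpen U := by
  have : IsClosedImmersion U.ι := IsClosedImmersion.of_isPreimmersion _ (isClosed_discrete _)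
  have : IsAffine (U : Scheme) := isAffine_of_isAffineHom U.ι
  exact this

/-- The generic scheme is finite, discrete and reduced, so its rings of sections are reduced
Artinian. Its residue fields are generated by those of `S`, and distinct generic points of
components do not specialise to each other. -/
theorem isGenericAlgebra_genericSchemeMap [IsNoetherian S] {U : S.Opens} (hU : IsAffineOpen U) :
    letI := ((genericSchemeMap S).app U).hom.toAlgebra
    IsGenericAlgebra Γ(S, U) Γ(genericScheme S, genericSchemeMap S ⁻¹ᵁ U) := by
  let q := genericSchemeMap S
  let _ := (q.app U).hom.toAlgebra
  have hV : IsAffineOpen (q ⁻¹ᵁ U) := isAffineOpen_genericScheme S _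
  refine ⟨inferInstance, IsLocallyArtinian.isArtinianRing_presheaf_obj (U := ⟨_, hV⟩), ?_, ?_⟩
  · intro m _ z
    obtain ⟨x, hx, hm⟩ := exists_evaluation_eq_zero_iff_mem hV m
    obtain ⟨w, hw⟩ := surjective_residueFieldMap_genericSchemeMap S x
      ((genericScheme S).evaluation _ x hx z)
    obtain ⟨s, a, hs, hsa⟩ := exists_evaluation_mul_eq hU (q x) hx w
    refine ⟨s, a, fun h ↦ ?_, ?_⟩
    · have h1 := (hm _).1 h
      have h2 := (evaluation_app q x hx s).symm.trans h1
      exact hs ((map_eq_zero _).1 h2)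
    · rw [hm]
      have h1 := evaluation_app q x hx s
      have h2 := evaluation_app q x hx a
      refine (map_sub _ _ _).trans (sub_eq_zero.2 ((map_mul _ _ _).trans ?_))
      refine Eq.trans ?_ h2.symm
      rw [← hsa, map_mul, mul_comm]
      exact congr_arg₂ _ hw.symm h1
  · intro m m' _ _ hle
    obtain ⟨x, hx, hm⟩ := exists_evaluation_eq_zero_iff_mem hV m
    obtain ⟨x', hx', hm'⟩ := exists_evaluation_eq_zero_iff_mem hV m'
    have hsp : q x ⤳ q x' := by
      refine specializes_of_evaluation_eq_zero hU hx hx' fun b hb ↦ ?_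
      have h1 : algebraMap Γ(S, U) Γ(genericScheme S, q ⁻¹ᵁ U) b ∈ m := by
        rw [hm]
        exact (evaluation_app q x hx b).trans (by rw [hb, map_zero])
      have h2 := (hm' _).1 (hle h1)
      exact (map_eq_zero _).1 ((evaluation_app q x' hx' b).symm.trans h2)
    have h1 : closure {q x'} ∈ irreducibleComponents S := genericSchemeMap_mem S x'
    have h2 : closure {q x} ≤ closure {q x'} :=
      h1.2 isIrreducible_singleton.closure (specializes_iff_closure_subset.1 hsp)
    have hxx' : x = x' := genericSchemeMap_injective S
      (hsp.antisymm (specializes_iff_closure_subset.2 h2)).eq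
    subst hxx'
    ext b
    rw [hm, hm']

end Generic

/-! ### Conductors of rings between a ring and its integral closure. -/

section Conductor

/-- An injection onto the integral closure transports finiteness. -/
theorem moduleFinite_of_integralClosure {A B Q : Type*} [CommRing A] [CommRing B] [CommRing Q]
    [Algebra A B] [Algebra A Q] (γ : B →ₐ[A] Q) (hγ : Function.Injective γ)
    (hr : ∀ z, IsIntegral A z ↔ ∃ b, γ b = z) :
    Module.Finite A B ↔ Module.Finite A (integralClosure A Q) := by
  let φ : B →ₐ[A] integralClosure A Q := γ.codRestrict _ fun b ↦ (hr _).2 ⟨b, rfl⟩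
  have hφ : Function.Bijective φ := by
    refine ⟨fun a b hab ↦ hγ congr(($hab).1), fun z ↦ ?_⟩
    obtain ⟨b, hb⟩ := (hr z.1).1 z.2
    exact ⟨b, Subtype.ext hb⟩
  exact Module.Finite.equiv_iff (LinearEquiv.ofBijective φ.toLinearMap hφ)

variable {A R B Q : Type*} [CommRing A] [CommRing R] [CommRing B] [CommRing Q]

theorem finite_comp_of_isGenericAlgebra [Algebra A Q] (α : A →+* R) (β : R →+* B)
    (γ : B →+* Q) (hA : ∀ a, algebraMap A Q a = γ (β (α a)))
    (hfin : Module.Finite A (integralClosure A Q)) (hγ : Function.Injective γ)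
    (hr : ∀ z, IsIntegral A z ↔ ∃ b, γ b = z) : (β.comp α).Finite := by
  let _ := (β.comp α).toAlgebra
  let γ' : B →ₐ[A] Q := { γ with commutes' := fun a ↦ (hA a).symm }
  exact (moduleFinite_of_integralClosure γ' hγ hr).2 hfin

/-- The integral closure is a finite module of fractions, so it has a common denominator that is a
unit of `Q`. -/
theorem exists_conductor_of_isGenericAlgebra [Algebra A Q] (hG : IsGenericAlgebra A Q)
    (α : A →+* R) (β : R →+* B) (γ : B →+* Q) (hA : ∀ a, algebraMap A Q a = γ (β (α a)))
    (hfin : Module.Finite A (integralClosure A Q)) (hγ : Function.Injective γ)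
    (hr : ∀ z, IsIntegral A z ↔ ∃ b, γ b = z) :
    ∃ f : A, IsUnit (algebraMap A Q f) ∧ ∀ b, ∃ a, β (α a) = β (α f) * b := by
  obtain ⟨f, hf, hfN⟩ := hG.exists_isUnit_smul_mem_range
    (Subalgebra.toSubmodule (integralClosure A Q)) (Module.Finite.iff_fg.1 hfin)
  refine ⟨f, hf, fun b ↦ ?_⟩
  obtain ⟨a, ha⟩ := hfN (γ b) ((hr _).2 ⟨b, rfl⟩)
  exact ⟨a, hγ (by rw [map_mul, ← hA, ← hA, ha])⟩

/-- The ring `R` lies between `A` and its integral closure `B`, so it is finite over the Noetherian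
ring `A`. Moreover, `B` is also the integral closure of `R` in `Q`, and the conductor element of `A`
serves for `R`. -/
theorem isRegularLocalRing_iff_of_isGenericAlgebra {A R L : Type u} {B Q : Type*} [CommRing A]
    [CommRing R] [CommRing B] [CommRing Q] [CommRing L] [IsNoetherianRing A] [Ring.KrullDimLE 1 R]
    [Algebra A Q] (hG : IsGenericAlgebra A Q) (α : A →+* R) (β : R →+* B) (γ : B →+* Q)
    (hA : ∀ a, algebraMap A Q a = γ (β (α a)))
    (hfin : Module.Finite A (integralClosure A Q)) (hβ : Function.Injective β)
    (hγ : Function.Injective γ) (hr : ∀ z, IsIntegral A z ↔ ∃ b, γ b = z)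
    (P : Ideal R) [P.IsPrime] [Algebra R L] [IsLocalization.AtPrime L P] :
    IsRegularLocalRing L ↔ ∃ s ∉ P, ∀ b, ∃ r, β r = β s * b := by
  obtain ⟨f, hf, hfb⟩ := exists_conductor_of_isGenericAlgebra hG α β γ hA hfin hγ hr
  have hB := finite_comp_of_isGenericAlgebra α β γ hA hfin hγ hr
  let _ := α.toAlgebra
  let _ := β.toAlgebra
  let _ := (β.comp α).toAlgebra
  let _ := (γ.comp β).toAlgebra
  have : IsScalarTower A R B := .of_algebraMap_eq fun _ ↦ rfl
  have : IsScalarTower A R Q := .of_algebraMap_eq fun a ↦ hA a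
  have : Module.Finite A B := hB
  have : Module.Finite R B := .of_restrictScalars_finite A R B
  have : Module.Finite A R := .of_injective (IsScalarTower.toAlgHom A R B).toLinearMap hβ
  have : IsNoetherianRing R := isNoetherian_of_isNoetherianRing_of_finite A R |> isNoetherian_of_tower A
  have := hG.isReduced
  have := hG.isArtinianRing
  have hr' : ∀ z : Q, IsIntegral R z ↔ ∃ b, γ b = z := fun z ↦
    ⟨fun h ↦ (hr z).1 (isIntegral_trans z h), fun h ↦ ((hr z).2 h).tower_top⟩
  let γ' : B →ₐ[R] Q := { γ with commutes' := fun a ↦ rfl }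
  have hfin' := (moduleFinite_of_integralClosure γ' hγ hr').1 inferInstance
  have key (s : R) : (∀ b : Q, IsIntegral R b → algebraMap R Q s * b ∈ (algebraMap R Q).range) ↔
      ∀ b, ∃ r, β r = β s * b := by
    constructor
    · intro h b
      obtain ⟨r, hr⟩ := h (γ b) ((hr' _).2 ⟨b, rfl⟩)
      exact ⟨r, hγ (hr.trans (map_mul γ _ _).symm)⟩
    · rintro h z hz
      obtain ⟨b, rfl⟩ := (hr' z).1 hz
      obtain ⟨r, hr⟩ := h b
      exact ⟨r, (congrArg γ hr).trans (map_mul γ _ _)⟩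
  rw [isRegularLocalRing_iff_exists_mul_mem_range (R := R) (Q := Q) (f := α f) (hγ.comp hβ)
    exists_sq_mul_eq_of_isArtinianRing hfin' (hA f ▸ hf) ?_ P]
  · simp only [key]
  · rw [key]
    intro b
    obtain ⟨a, ha⟩ := hfb b
    exact ⟨α a, ha⟩

/-- The integral closure in a von Neumann regular ring is seminormal. -/
theorem exists_sq_cube_of_isGenericAlgebra {A B Q : Type*} [CommRing A] [CommRing B] [CommRing Q]
    [Algebra A Q] (hG : IsGenericAlgebra A Q) (γ : B →+* Q) (hγ : Function.Injective γ)
    (hr : ∀ z, IsIntegral A z ↔ ∃ b, γ b = z) {x y : B} (hxy : x ^ 3 = y ^ 2) :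
    ∃ a, x = a ^ 2 ∧ y = a ^ 3 := by
  have := hG.isReduced
  have := hG.isArtinianRing
  -- Here `z` is a weak inverse of `x`, and `y * z` stands for `y / x`, with value `0` where `x`
  -- vanishes. Its square is `x`, so it is integral.
  obtain ⟨z, hz⟩ := exists_sq_mul_eq_of_isArtinianRing (γ x)
  have h1 : γ x ^ 3 = γ y ^ 2 := by rw [← map_pow, hxy, map_pow]
  have h2 : (γ y * z) ^ 2 = γ x := by
    calc (γ y * z) ^ 2 = γ x ^ 3 * z ^ 2 := by rw [h1]; ring
      _ = (γ x ^ 2 * z) * (γ x * z) := by ring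
      _ = γ x := by rw [hz, ← mul_assoc, ← sq, hz]
  have h3 : γ y * (γ x * z) = γ y := by
    have : (γ y * (γ x * z) - γ y) ^ 2 = 0 := by
      calc _ = γ y ^ 2 * (1 - γ x * z) ^ 2 := by ring
        _ = (γ x * (γ x - γ x ^ 2 * z) ^ 2) := by rw [← h1]; ring
        _ = 0 := by rw [hz]; ring
    exact sub_eq_zero.1 (pow_eq_zero_iff two_ne_zero |>.1 this)
  have hint : IsIntegral A (γ y * z) := by
    refine IsIntegral.of_pow two_pos ?_
    rw [h2]
    exact (hr _).2 ⟨x, rfl⟩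
  obtain ⟨a, ha⟩ := (hr _).1 hint
  refine ⟨a, hγ ?_, hγ ?_⟩
  · rw [map_pow, ha, h2]
  · rw [map_pow, ha, pow_succ, h2, ← mul_assoc, mul_comm (γ x), mul_assoc, h3]

end Conductor

/-! ### The normalisation and its sections. -/

section Normalisation

theorem toNormalization_fromNormalization_eq {X Y : Scheme.{u}} (f : X ⟶ Y) [QuasiCompact f]
    [QuasiSeparated f] : f.toNormalization ≫ f.fromNormalization = f :=
  f.toNormalization_fromNormalization

theorem injective_app_toNormalization {X Y : Scheme.{u}} (f : X ⟶ Y) [QuasiCompact f]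
    [QuasiSeparated f] {U : Y.Opens} (hU : IsAffineOpen U) :
    Function.Injective (f.toNormalization.app (f.fromNormalization ⁻¹ᵁ U)) ∧
      ∀ z, (((f.toNormalization ≫ f.fromNormalization).app U).hom.IsIntegralElem z ↔
        ∃ b, f.toNormalization.app (f.fromNormalization ⁻¹ᵁ U) b = z) := by
  let _ := (f.app U).hom.toAlgebra
  have hle : f ⁻¹ᵁ U ≤ f.toNormalization ⁻¹ᵁ f.fromNormalization ⁻¹ᵁ U := by
    rw [← Scheme.Hom.comp_preimage, toNormalization_fromNormalization_eq]
  have key : ∀ (q : X ⟶ Y) (hq : q = f), Function.Injective (f.toNormalization.appLE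
      (f.fromNormalization ⁻¹ᵁ U) (q ⁻¹ᵁ U) (hq ▸ hle)) ∧
      ∀ z, ((q.app U).hom.IsIntegralElem z ↔
        ∃ b, f.toNormalization.appLE (f.fromNormalization ⁻¹ᵁ U) (q ⁻¹ᵁ U) (hq ▸ hle) b = z) := by
    rintro q rfl
    have h1 := q.normalizationObjIso_hom_val hU
    have h2 : ∀ b, q.toNormalization.appLE (q.fromNormalization ⁻¹ᵁ U) (q ⁻¹ᵁ U) hle b =
        ((q.normalizationObjIso hU).hom b).1 := fun b ↦ congr($h1.symm b)
    have h3 := ConcreteCategory.bijective_of_isIso (q.normalizationObjIso hU).hom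
    refine ⟨fun a b hab ↦ h3.1 (Subtype.ext ?_), fun z ↦ ⟨fun hz ↦ ?_, ?_⟩⟩
    · rw [← h2, ← h2, hab]
    · obtain ⟨b, hb⟩ := h3.2 ⟨z, hz⟩
      exact ⟨b, by rw [h2, hb]⟩
    · rintro ⟨b, rfl⟩
      rw [h2]
      exact ((q.normalizationObjIso hU).hom b).2
  have h := key _ (toNormalization_fromNormalization_eq f)
  rw [Scheme.Hom.app_eq_appLE]
  exact h

variable (S : Scheme.{u}) [IsNoetherian S]

/-- The inclusion of the generic points in the normalisation. -/
noncomputable def genericSchemeToNormalisation : genericScheme S ⟶ normalisation S :=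
  (genericSchemeMap S).toNormalization

theorem genericSchemeToNormalisation_normalisationMap :
    genericSchemeToNormalisation S ≫ normalisationMap S = genericSchemeMap S :=
  toNormalization_fromNormalization_eq _

theorem injective_app_genericSchemeToNormalisation {U : S.Opens} (hU : IsAffineOpen U) :
    Function.Injective ((genericSchemeToNormalisation S).app (normalisationMap S ⁻¹ᵁ U)) ∧
      ∀ z, (((genericSchemeToNormalisation S ≫ normalisationMap S).app U).hom.IsIntegralElem z ↔
        ∃ b, (genericSchemeToNormalisation S).app (normalisationMap S ⁻¹ᵁ U) b = z) :=
  injective_app_toNormalization (genericSchemeMap S) hU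

instance isIntegralHom_normalisationMap : IsIntegralHom (normalisationMap S) :=
  inferInstanceAs (IsIntegralHom (genericSchemeMap S).fromNormalization)

instance isReduced_normalisation : AlgebraicGeometry.IsReduced (normalisation S) :=
  inferInstanceAs (AlgebraicGeometry.IsReduced (genericSchemeMap S).normalization)

instance surjective_normalisationMap : Surjective (normalisationMap S) := by
  have : IsDominant (normalisationMap S) := by
    refine ⟨dense_iff_closure_eq.2 (Set.eq_univ_of_univ_subset ?_)⟩
    rw [← genericPoints.closure]
    refine closure_mono fun x hx ↦ ?_
    obtain ⟨z, rfl⟩ := exists_genericSchemeMap_eq S hx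
    rw [← genericSchemeToNormalisation_normalisationMap]
    exact ⟨genericSchemeToNormalisation S z, rfl⟩
  exact surjective_of_isDominant_of_isClosed_range _
    (normalisationMap S).isClosedMap.isClosed_range

theorem isGenericAlgebra_normalisation {U : S.Opens} (hU : IsAffineOpen U) :
    letI := ((genericSchemeToNormalisation S ≫ normalisationMap S).app U).hom.toAlgebra
    IsGenericAlgebra Γ(S, U)
      Γ(genericScheme S, (genericSchemeToNormalisation S ≫ normalisationMap S) ⁻¹ᵁ U) := by
  rw [genericSchemeToNormalisation_normalisationMap]
  exact isGenericAlgebra_genericSchemeMap S hU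

theorem finite_integralClosure_normalisation {κ : Type u} [Field κ]
    (p : S ⟶ Spec (CommRingCat.of κ)) [LocallyOfFiniteType p] {U : S.Opens} (hU : IsAffineOpen U) :
    letI := ((genericSchemeToNormalisation S ≫ normalisationMap S).app U).hom.toAlgebra
    Module.Finite Γ(S, U) (integralClosure Γ(S, U)
      Γ(genericScheme S, (genericSchemeToNormalisation S ≫ normalisationMap S) ⁻¹ᵁ U)) := by
  let _ := ((genericSchemeToNormalisation S ≫ normalisationMap S).app U).hom.toAlgebra
  let _ : Algebra κ Γ(S, U) := ((p.appLE ⊤ U le_top).hom.comp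
    (Scheme.ΓSpecIso (CommRingCat.of κ)).inv.hom).toAlgebra
  have : Algebra.FiniteType κ Γ(S, U) := by
    refine RingHom.FiniteType.comp (p.finiteType_appLE (isAffineOpen_top _) hU le_top)
      (RingHom.FiniteType.of_surjective _ ?_)
    exact (ConcreteCategory.bijective_of_isIso (Scheme.ΓSpecIso (CommRingCat.of κ)).inv).2
  exact (isGenericAlgebra_normalisation S hU).finite_integralClosure κ

end Normalisation

/-! ### Schemes between the normalisation and the curve. -/

section Intermediate

theorem mem_primeIdealOf_iff {X : Scheme.{u}} {U : X.Opens} (hU : IsAffineOpen U) (x : X) (hx : x ∈ U)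
    (b : Γ(X, U)) : b ∈ (hU.primeIdealOf ⟨x, hx⟩).asIdeal ↔ X.evaluation U x hx b = 0 := by
  rw [← not_iff_not, ← Ne, X.evaluation_ne_zero_iff_mem_basicOpen _ hx b]
  let p : Spec Γ(X, U) := hU.primeIdealOf ⟨x, hx⟩
  have h1 : p ∈ hU.fromSpec ⁻¹ᵁ X.basicOpen b ↔ b ∉ (hU.primeIdealOf ⟨x, hx⟩).asIdeal := by
    rw [hU.fromSpec_preimage_basicOpen]
    rfl
  rw [← h1]
  have h2 : hU.fromSpec p = x := hU.fromSpec_primeIdealOf ⟨x, hx⟩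
  change hU.fromSpec p ∈ X.basicOpen b ↔ _
  rw [h2]

/-- Over the open `V`, the morphism `ν` looks like the normalisation of a reduced curve. -/
structure HasConductor {N S : Scheme.{u}} (ν : N ⟶ S) (V : S.Opens) : Prop where
  finite : (ν.app V).hom.Finite
  isNoetherianRing : IsNoetherianRing Γ(S, V)
  exists_conductor : ∃ f : Γ(S, V), (∀ p : Ideal Γ(S, V), p.IsPrime → f ∈ p → p.IsMaximal) ∧
    ∀ b, ∃ r, ν.app V r = ν.app V f * b
  isRegularLocalRing_iff : ∀ x (hx : x ∈ V), IsRegularLocalRing (S.presheaf.stalk x) ↔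
    ∃ s, S.evaluation V x hx s ≠ 0 ∧ ∀ b, ∃ r, ν.app V r = ν.app V s * b

variable (C : Scheme.{u}) [IsNoetherian C]

theorem surjective_of_comp_eq_normalisationMap {S : Scheme.{u}} (σ : normalisation C ⟶ S)
    (h : S ⟶ C) (e : σ ≫ h = normalisationMap C) (hh : IsUniversalHomeomorphism h) :
    Surjective σ := by
  refine ⟨fun y ↦ ?_⟩
  obtain ⟨x, hx⟩ := (normalisationMap C).surjective (h y)
  rw [← e] at hx
  exact ⟨x, hh.isHomeomorph.injective hx⟩

/-- Over `U`, the sections of `S` lie between those of `C` and their integral closure, and the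
homeomorphism `h` transfers the dimension bound. The case of the identity gives finiteness of the
normalisation itself. -/
theorem hasConductor_of_comp_eq_normalisationMap {κ : Type u} [Field κ]
    (p : C ⟶ Spec (CommRingCat.of κ)) [LocallyOfFiniteType p] (hdim : topologicalKrullDim C ≤ 1)
    {S : Scheme.{u}} (σ : normalisation C ⟶ S) (h : S ⟶ C) (e : σ ≫ h = normalisationMap C)
    (hh : IsUniversalHomeomorphism h) [AlgebraicGeometry.IsReduced S] {U : C.Opens}
    (hU : IsAffineOpen U) : HasConductor σ (h ⁻¹ᵁ U) := by
  have hdim' : topologicalKrullDim S ≤ (1 : ℕ) := by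
    rw [hh.isHomeomorph.topologicalKrullDim_eq]
    exact_mod_cast hdim
  have := hh.isIntegralHom
  have hV : IsAffineOpen (h ⁻¹ᵁ U) := hU.preimage h
  have hR := krullDimLE_of_topologicalKrullDim_le hdim' hV
  have hnoeth : IsNoetherianRing Γ(C, U) := IsLocallyNoetherian.component_noetherian ⟨U, hU⟩
  have hsurj : Surjective σ := surjective_of_comp_eq_normalisationMap C σ h e hh
  have h1 := isGenericAlgebra_normalisation C hU
  have h2 := finite_integralClosure_normalisation C p hU
  have h3 := injective_app_genericSchemeToNormalisation C hU
  rw [← e] at h1 h2 h3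
  let _ := ((genericSchemeToNormalisation C ≫ σ ≫ h).app U).hom.toAlgebra
  obtain ⟨f, hf, hfb⟩ := exists_conductor_of_isGenericAlgebra h1 (h.app U).hom
    (σ.app (h ⁻¹ᵁ U)).hom ((genericSchemeToNormalisation C).app ((σ ≫ h) ⁻¹ᵁ U)).hom
    (fun _ ↦ rfl) h2 h3.1 h3.2
  have hβ := injective_app_of_surjective σ (h ⁻¹ᵁ U)
  have hf' : IsUnit ((genericSchemeToNormalisation C).app ((σ ≫ h) ⁻¹ᵁ U)
    (σ.app (h ⁻¹ᵁ U) (h.app U f))) := hf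
  have hfin : ((σ.app (h ⁻¹ᵁ U)).hom.comp (h.app U).hom).Finite :=
    finite_comp_of_isGenericAlgebra (Q := Γ(genericScheme C,
      (genericSchemeToNormalisation C ≫ σ ≫ h) ⁻¹ᵁ U)) (h.app U).hom (σ.app (h ⁻¹ᵁ U)).hom
      ((genericSchemeToNormalisation C).app ((σ ≫ h) ⁻¹ᵁ U)).hom (fun _ ↦ rfl) h2 h3.1 h3.2
  refine ⟨hfin.of_comp_finite, ?_, ⟨h.app U f, fun P hP hfP ↦ ?_, fun b ↦ ?_⟩, fun x hx ↦ ?_⟩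
  · let _ := (h.app U).hom.toAlgebra
    let _ := ((σ.app (h ⁻¹ᵁ U)).hom.comp (h.app U).hom).toAlgebra
    have : Module.Finite Γ(C, U) Γ(normalisation C, σ ⁻¹ᵁ h ⁻¹ᵁ U) := hfin
    let φ : Γ(S, h ⁻¹ᵁ U) →ₐ[Γ(C, U)] Γ(normalisation C, σ ⁻¹ᵁ h ⁻¹ᵁ U) :=
      { (σ.app (h ⁻¹ᵁ U)).hom with commutes' := fun _ ↦ rfl }
    have : Module.Finite Γ(C, U) Γ(S, h ⁻¹ᵁ U) := .of_injective φ.toLinearMap hβ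
    exact isNoetherian_of_isNoetherianRing_of_finite Γ(C, U) Γ(S, h ⁻¹ᵁ U) |> isNoetherian_of_tower _
  · let _ : Algebra Γ(S, h ⁻¹ᵁ U) Γ(genericScheme C,
        (genericSchemeToNormalisation C ≫ σ ≫ h) ⁻¹ᵁ U) :=
      (((genericSchemeToNormalisation C).app ((σ ≫ h) ⁻¹ᵁ U)).hom.comp
      (σ.app (h ⁻¹ᵁ U)).hom).toAlgebra
    exact isMaximal_of_mem_of_isUnit_algebraMap (f := h.app U f) (Q := Γ(genericScheme C,
      (genericSchemeToNormalisation C ≫ σ ≫ h) ⁻¹ᵁ U)) (h3.1.comp hβ) hf' P hP hfP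
  · obtain ⟨a, ha⟩ := hfb b
    exact ⟨h.app U a, ha⟩
  · let _ : Algebra Γ(S, h ⁻¹ᵁ U) (S.presheaf.stalk x) :=
      TopCat.Presheaf.algebra_section_stalk S.presheaf (⟨x, hx⟩ : (h ⁻¹ᵁ U : S.Opens))
    have := hV.isLocalization_stalk ⟨x, hx⟩
    have h4 := isRegularLocalRing_iff_of_isGenericAlgebra (L := S.presheaf.stalk x) h1 (h.app U).hom
      (σ.app (h ⁻¹ᵁ U)).hom ((genericSchemeToNormalisation C).app ((σ ≫ h) ⁻¹ᵁ U)).hom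
      (fun _ ↦ rfl) h2 hβ h3.1 h3.2 (hV.primeIdealOf ⟨x, hx⟩).asIdeal
    simp only [mem_primeIdealOf_iff] at h4
    exact h4

end Intermediate

/-! ### Existence of the seminormalisation, and the criterion for seminormality. -/

section Seminormalisation

theorem IsGluedFactorization.comp_iso {X X' Y T : Scheme.{u}} {g : X ⟶ X'} {h : X' ⟶ Y}
    (hgh : IsGluedFactorization g h) (e : X' ⟶ T) [IsIso e] (k : T ⟶ Y)
    (hk : IsResidualUniversalHomeomorphism k) (hek : e ≫ k = h) :
    IsGluedFactorization (g ≫ e) k := by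
  subst hek
  have := hgh.surjective
  have := hgh.isReduced
  refine ⟨hk, inferInstance, isReduced_of_isOpenImmersion (inv e), fun {U} hU b hb ↦ ?_⟩
  obtain ⟨r, hr⟩ := hgh.exists_app_eq hU _
    (map_mem_gluedSections_of_eq (Category.assoc g e k) hb)
  obtain ⟨r', rfl⟩ := (ConcreteCategory.bijective_of_isIso (e.app (k ⁻¹ᵁ U))).2 r
  exact ⟨r', hr.trans congr($(X.presheaf.map_id _) b)⟩

theorem FactorisationTheorem.IsSeminormalisation.exists_iso {X X' S : Scheme.{u}} {f : X ⟶ S}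
    {f' : X' ⟶ S} (hf : IsSeminormalisation f) (hf' : IsSeminormalisation f') :
    ∃ e : X ⟶ X', IsIso e ∧ e ≫ f' = f := by
  obtain ⟨a, ha, -⟩ := hf.existsUnique_lift _ f' hf'.isResidualUniversalHomeomorphism
  obtain ⟨b, hb, -⟩ := hf'.existsUnique_lift _ f hf.isResidualUniversalHomeomorphism
  refine ⟨a, ⟨b, ?_, ?_⟩, ha⟩
  · refine (hf.existsUnique_lift _ f hf.isResidualUniversalHomeomorphism).unique ?_ ?_ <;>
      simp [ha, hb]
  · refine (hf'.existsUnique_lift _ f' hf'.isResidualUniversalHomeomorphism).unique ?_ ?_ <;>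
      simp [ha, hb]

theorem FactorisationTheorem.IsResidualUniversalHomeomorphism.exists_fromSpecResidueField_lift
    {X Y : Scheme.{u}} {k : X ⟶ Y} (hk : IsResidualUniversalHomeomorphism k) (y : Y) :
    ∃ l : Spec (Y.residueField y) ⟶ X, l ≫ k = Y.fromSpecResidueField y := by
  obtain ⟨x, rfl⟩ := hk.isUniversalHomeomorphism.isHomeomorph.surjective y
  have := hk.isIso_residueFieldMap x
  refine ⟨Spec.map (inv (k.residueFieldMap x)) ≫ X.fromSpecResidueField x, ?_⟩
  rw [Category.assoc, ← Scheme.Hom.SpecMap_residueFieldMap_fromSpecResidueField, ← Category.assoc,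
    ← Spec.map_comp, IsIso.hom_inv_id, Spec.map_id, Category.id_comp]

variable (C : Scheme.{u}) [IsNoetherian C]

/-- Generic points lift to `T` because the residue extensions are trivial. Since `k` is integral,
the universal property of relative normalisation extends the lift. -/
theorem exists_normalisation_lift {T : Scheme.{u}} (k : T ⟶ C)
    (hk : IsResidualUniversalHomeomorphism k) :
    ∃ l : normalisation C ⟶ T, l ≫ k = normalisationMap C := by
  choose l hl using fun i : genericPoints C ↦ hk.exists_fromSpecResidueField_lift i.1
  have := hk.isUniversalHomeomorphism.isIntegralHom
  have H : genericSchemeMap C = Sigma.desc l ≫ k := by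
    refine Sigma.hom_ext _ _ fun i ↦ ?_
    refine (genericSchemeι_genericSchemeMap C i).trans ?_
    rw [Sigma.ι_desc_assoc, hl]
  exact ⟨(genericSchemeMap C).normalizationDesc _ _ H, Scheme.Hom.normalizationDesc_comp _ _ _ H⟩

/-- Existence of the map to `T` comes from gluing. Uniqueness holds because `X'` is reduced and `k`
is universally injective. -/
theorem isSeminormalisation_of_isGluedFactorization {X' : Scheme.{u}} (g : normalisation C ⟶ X')
    (h : X' ⟶ C) (e : g ≫ h = normalisationMap C) (hgh : IsGluedFactorization g h) :
    IsSeminormalisation h := by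
  refine ⟨hgh.isResidualUniversalHomeomorphism, fun T k hk ↦ ?_⟩
  obtain ⟨l, hl⟩ := exists_normalisation_lift C k hk
  obtain ⟨m, -, hm⟩ := hgh.exists_lift l k hk (hl.trans e.symm)
  have := hk.isUniversalHomeomorphism.isIntegralHom
  have := hk.isUniversalHomeomorphism.universallyInjective
  have := hgh.isReduced
  exact ⟨m, hm, fun m' hm' ↦ eq_of_comp_eq_of_universallyInjective (hm'.trans hm.symm)⟩

theorem exists_isSeminormalisation :
    ∃ (X' : Scheme.{u}) (g : normalisation C ⟶ X') (h : X' ⟶ C), g ≫ h = normalisationMap C ∧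
      IsGluedFactorization g h ∧ IsSeminormalisation h := by
  obtain ⟨X', g, h, e, hgh⟩ := exists_isGluedFactorization (normalisationMap C)
  exact ⟨X', g, h, e, hgh, isSeminormalisation_of_isGluedFactorization C g h e hgh⟩

variable {C}

/-- Seminormalisations are unique up to isomorphism over `C`, so the explicit description by glued
sections applies to any of them. -/
theorem FactorisationTheorem.IsSeminormalisation.exists_isGluedFactorization {Csn : Scheme.{u}}
    {ς : Csn ⟶ C} (hς : IsSeminormalisation ς) :
    ∃ σ : normalisation C ⟶ Csn, σ ≫ ς = normalisationMap C ∧ IsGluedFactorization σ ς := by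
  obtain ⟨X', g, h, e, hgh, hh⟩ := exists_isSeminormalisation C
  obtain ⟨φ, _, hφ⟩ := hh.exists_iso hς
  exact ⟨g ≫ φ, by rw [Category.assoc, hφ, e],
    hgh.comp_iso φ ς hς.isResidualUniversalHomeomorphism hφ⟩

theorem eq_of_sq_eq_of_cube_eq {R : Type*} [CommRing R] [_root_.IsReduced R] {a b : R}
    (h2 : a ^ 2 = b ^ 2) (h3 : a ^ 3 = b ^ 3) : a = b := by
  refine sub_eq_zero.1 (eq_zero_of_pow_eq_zero (n := 3) ?_)
  linear_combination 4 * h3 - 3 * (a + b) * h2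

theorem exists_sq_cube_normalisation {ν : normalisation C ⟶ C} (e : ν = normalisationMap C)
    {U : C.Opens} (hU : IsAffineOpen U) {x y : Γ(normalisation C, ν ⁻¹ᵁ U)} (hxy : x ^ 3 = y ^ 2) :
    ∃ a, x = a ^ 2 ∧ y = a ^ 3 := by
  subst e
  let _ := ((genericSchemeToNormalisation C ≫ normalisationMap C).app U).hom.toAlgebra
  have h3 := injective_app_genericSchemeToNormalisation C hU
  exact exists_sq_cube_of_isGenericAlgebra (Q := Γ(genericScheme C,
      (genericSchemeToNormalisation C ≫ normalisationMap C) ⁻¹ᵁ U))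
    (isGenericAlgebra_normalisation C hU)
    ((genericSchemeToNormalisation C).app (normalisationMap C ⁻¹ᵁ U)).hom h3.1 h3.2 hxy

/-- At each point the value of `a` is the quotient of the values of `y` and `x` in the residue field
of the base. Where `x` vanishes so does `a`, and the convention `0 / 0 = 0` gives the right value.
-/
theorem mem_gluedSections_of_sq_of_cube {X Y : Scheme.{u}} {f : X ⟶ Y} {U : Y.Opens}
    {a : Γ(X, f ⁻¹ᵁ U)} {x y : Γ(Y, U)} (hx : f.app U x = a ^ 2) (hy : f.app U y = a ^ 3) :
    a ∈ gluedSections f U := by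
  classical
  refine ⟨fun z ↦ if hz : z ∈ U then Y.evaluation U z hz y / Y.evaluation U z hz x else 0,
    fun z hz ↦ ?_⟩
  refine Eq.trans ?_ (congrArg (f.residueFieldMap z) (dif_pos (show f z ∈ U from hz)).symm)
  have h1 := evaluation_app f z hz x
  have h2 := evaluation_app f z hz y
  rw [hx, map_pow] at h1
  rw [hy, map_pow] at h2
  rw [map_div₀]
  refine Eq.trans ?_ (congr_arg₂ (· / ·) h2 h1)
  by_cases h0 : X.evaluation (f ⁻¹ᵁ U) z hz a = 0
  · simp [h0]
  · field_simp

/-- The root exists on the normalisation, which is integrally closed in its ring of fractions. It is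
glued, so it descends to the seminormalisation, here isomorphic to `C`. -/
theorem isSeminormal_of_isGluedFactorization [AlgebraicGeometry.IsReduced C] {Csn : Scheme.{u}}
    {ς : Csn ⟶ C} {σ : normalisation C ⟶ Csn} (e : σ ≫ ς = normalisationMap C)
    (h : IsGluedFactorization σ ς) [IsIso ς] : IsSeminormal C := by
  intro U hU x y hxy
  have hs := h.surjective
  have hinj : Function.Injective ((σ ≫ ς).app U) := injective_app_of_surjective _ U
  have hxy' : ((σ ≫ ς).app U x) ^ 3 = ((σ ≫ ς).app U y) ^ 2 := by
    rw [← map_pow, hxy, map_pow]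
  obtain ⟨b, hb2, hb3⟩ := exists_sq_cube_normalisation e hU hxy'
  obtain ⟨r, hr⟩ := h.exists_app_eq hU b (mem_gluedSections_of_sq_of_cube hb2 hb3)
  obtain ⟨a, rfl⟩ := (ConcreteCategory.bijective_of_isIso (ς.app U)).2 r
  have hr' : (σ ≫ ς).app U a = b := hr
  have h2 : x = a ^ 2 := hinj (by rw [map_pow, hr', hb2])
  have h3 : y = a ^ 3 := hinj (by rw [map_pow, hr', hb3])
  exact ⟨a, ⟨h2, h3⟩, fun a' ha' ↦
    eq_of_sq_eq_of_cube_eq (ha'.1.symm.trans h2) (ha'.2.symm.trans h3)⟩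

end Seminormalisation

/-! ### A criterion for co-Cartesian squares. -/

section Pushout

variable {W X Y Z : Scheme.{u}}

/-- A criterion for a square to be co-Cartesian in terms of points and sections. -/
theorem isPushout_of_sections (a : W ⟶ X) (b : W ⟶ Z) (f : X ⟶ Y) (i : Z ⟶ Y)
    (comm : a ≫ f = b ≫ i) [IsIntegralHom f] [Surjective f] [AlgebraicGeometry.IsReduced Y]
    [Surjective b] [AlgebraicGeometry.IsReduced Z]
    (H₁ : ∀ x x', f x = f x' → x = x' ∨ ∃ w w', a w = x ∧ a w' = x' ∧ b w = b w')
    {B : Set Y.Opens} (hB : TopologicalSpace.Opens.IsBasis B)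
    (H₂ : ∀ V ∈ B, ∀ (e : b ⁻¹ᵁ i ⁻¹ᵁ V ≤ a ⁻¹ᵁ f ⁻¹ᵁ V)
      (s : Γ(X, f ⁻¹ᵁ V)) (t : Γ(Z, i ⁻¹ᵁ V)),
      a.appLE (f ⁻¹ᵁ V) (b ⁻¹ᵁ i ⁻¹ᵁ V) e s = b.app (i ⁻¹ᵁ V) t → ∃ r, f.app V r = s) :
    IsPushout a b f i := by
  have hf := epi_of_surjective f
  have hb := epi_of_surjective b
  have lift : ∀ {T : Scheme.{u}} (α : X ⟶ T) (β : Z ⟶ T), a ≫ α = b ≫ β →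
      ∃ l : Y ⟶ T, f ≫ l = α ∧ i ≫ l = β := by
    intro T α β hαβ
    suffices h : ∃ l, f ≫ l = α by
      obtain ⟨l, hl⟩ := h
      refine ⟨l, hl, ?_⟩
      rw [← cancel_epi b, ← reassoc_of% comm, hl, hαβ]
    refine exists_lift_of_sections f α fun y ↦ ?_
    obtain ⟨x₀, rfl⟩ := f.surjective y
    have hpt (w : W) : α (a w) = β (b w) := by
      rw [← Scheme.Hom.comp_apply, hαβ, Scheme.Hom.comp_apply]
    have hfib (x : X) (hx : f x = f x₀) : α x = α x₀ := by
      obtain rfl | ⟨w, w', rfl, rfl, hww⟩ := H₁ x x₀ hx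
      · rfl
      · rw [hpt, hpt, hww]
    obtain ⟨A, hA⟩ := SectionSubrings.exists_affine_mem (α x₀)
    -- The map `α` is constant on the fibres of `f`, so the closed set `K` avoids the point in
    -- question. Off `K` the whole preimage under `f` is sent into the affine open `A`, where only
    -- sections matter.
    let K : Set Y := f '' ((α ⁻¹ᵁ A.toOpens : X.Opens) : Set X)ᶜ
    have hK : IsClosed K := f.isClosedMap _ (α ⁻¹ᵁ A.toOpens).isOpen.isClosed_compl
    have hyK : f x₀ ∉ K := by
      rintro ⟨x, hx, hxx⟩
      exact hx (show α x ∈ A.toOpens from hfib x hxx ▸ hA)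
    obtain ⟨V, hV, hyV, hVK⟩ := hB.exists_subset_of_mem_open
      (show f x₀ ∈ Kᶜ from hyK) hK.isOpen_compl
    obtain ⟨V, hVB, rfl⟩ := hV
    have e₁ : f ⁻¹ᵁ V ≤ α ⁻¹ᵁ A.toOpens := fun x hx ↦ by
      by_contra hxA
      exact hVK (show f x ∈ V from hx) ⟨x, hxA, rfl⟩
    have e₀ : b ⁻¹ᵁ i ⁻¹ᵁ V ≤ a ⁻¹ᵁ f ⁻¹ᵁ V := by
      rw [← Scheme.Hom.comp_preimage, ← Scheme.Hom.comp_preimage, comm]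
    have e₂ : i ⁻¹ᵁ V ≤ β ⁻¹ᵁ A.toOpens := fun z hz ↦ by
      obtain ⟨w, rfl⟩ := b.surjective z
      have : a w ∈ f ⁻¹ᵁ V := e₀ hz
      exact (hpt w ▸ e₁ this : β (b w) ∈ A.toOpens)
    refine ⟨V, A.toOpens, A.2, e₁, hyV, fun t ↦ ?_⟩
    refine H₂ V hVB e₀ _ (β.appLE A.toOpens _ e₂ t) ?_
    rw [Scheme.Hom.app_eq_appLE, ← CommRingCat.comp_apply, ← CommRingCat.comp_apply,
      Scheme.Hom.appLE_comp_appLE, Scheme.Hom.appLE_comp_appLE]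
    simp only [hαβ]
  refine ⟨⟨comm⟩, ⟨PushoutCocone.IsColimit.mk comm (fun s ↦ (lift s.inl s.inr s.condition).choose)
    (fun s ↦ (lift s.inl s.inr s.condition).choose_spec.1)
    (fun s ↦ (lift s.inl s.inr s.condition).choose_spec.2) fun s m hm _ ↦ ?_⟩⟩
  rw [← cancel_epi f, hm, (lift s.inl s.inr s.condition).choose_spec.1]

end Pushout

/-! ### Local lifting of sections, and reduced closed subschemes. -/

section Gluing

/-- Lifting sections is a local problem. -/
theorem exists_app_eq_of_locally {X Y : Scheme.{u}} (f : X ⟶ Y) [Surjective f]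
    [AlgebraicGeometry.IsReduced Y] {V : Y.Opens} (s : Γ(X, f ⁻¹ᵁ V))
    (H : ∀ y ∈ V, ∃ (U : Y.Opens) (h : U ≤ V), y ∈ U ∧
      ∃ r, f.app U r = X.presheaf.map (homOfLE (f.preimage_mono h)).op s) :
    ∃ r, f.app V r = s := by
  choose U hU hyU r hr using H
  have hnat {U U' : Y.Opens} (h : U' ≤ U) (r : Γ(Y, U)) : f.app U' (Y.presheaf.map (homOfLE h).op r) =
      X.presheaf.map (homOfLE (f.preimage_mono h)).op (f.app U r) :=
    congr($(f.naturality (homOfLE h).op) r)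
  have hres {U U' U'' : X.Opens} (h : U'' ≤ U') (h' : U' ≤ U) (s : Γ(X, U)) :
      X.presheaf.map (homOfLE h).op (X.presheaf.map (homOfLE h').op s) =
        X.presheaf.map (homOfLE (h.trans h')).op s :=
    congr($(X.presheaf.map_comp (homOfLE h').op (homOfLE h).op) s).symm
  obtain ⟨t, ht, -⟩ := Y.sheaf.existsUnique_gluing' (fun y : V ↦ U y.1 y.2) V
    (fun y ↦ homOfLE (hU y.1 y.2))
    (fun y hy ↦ TopologicalSpace.Opens.mem_iSup.2 ⟨⟨y, hy⟩, hyU y hy⟩) (fun y ↦ r y.1 y.2)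
    (fun y y' ↦ by
      refine injective_app_of_surjective f _ ?_
      refine (hnat inf_le_left _).trans (Eq.trans ?_ (hnat inf_le_right _).symm)
      rw [hr, hr, hres, hres])
  refine ⟨t, X.sheaf.eq_of_locally_eq' (fun y : V ↦ f ⁻¹ᵁ U y.1 y.2) (f ⁻¹ᵁ V)
    (fun y ↦ homOfLE (f.preimage_mono (hU y.1 y.2)))
    (fun x hx ↦ TopologicalSpace.Opens.mem_iSup.2 ⟨⟨f x, hx⟩, hyU (f x) hx⟩) _ _ fun y ↦ ?_⟩
  refine (hnat (hU y.1 y.2) t).symm.trans ((congrArg (f.app _) (ht y)).trans ?_)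
  exact hr y.1 y.2

end Gluing

section ReducedSubscheme

variable (X : Scheme.{u}) (Z : TopologicalSpace.Closeds X)

instance : IsClosedImmersion (reducedSubschemeMap X Z) :=
  inferInstanceAs (IsClosedImmersion (Scheme.IdealSheafData.vanishingIdeal Z).subschemeι)

theorem range_reducedSubschemeMap : Set.range (reducedSubschemeMap X Z) = Z := by
  refine (Scheme.IdealSheafData.range_subschemeι _).trans ?_
  simp

instance isReduced_reducedSubscheme : AlgebraicGeometry.IsReduced (reducedSubscheme X Z) := by
  refine isReduced_of_isReduced_app (reducedSubschemeMap X Z) fun {U} hU ↦ ?_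
  have hsurj : Function.Surjective ((reducedSubschemeMap X Z).app U).hom :=
    Scheme.Hom.app_surjective _ _ hU
  have hker : RingHom.ker ((reducedSubschemeMap X Z).app U).hom =
      PrimeSpectrum.vanishingIdeal (hU.fromSpec ⁻¹' Z) :=
    Scheme.IdealSheafData.ker_subschemeι_app (Scheme.IdealSheafData.vanishingIdeal Z) ⟨U, hU⟩
  have hrad : (RingHom.ker ((reducedSubschemeMap X Z).app U).hom).IsRadical := by
    rw [hker]
    exact PrimeSpectrum.isRadical_vanishingIdeal _
  have := (Ideal.isRadical_iff_quotient_reduced _).1 hrad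
  exact isReduced_of_injective _ (RingHom.quotientKerEquivOfSurjective hsurj).symm.injective

end ReducedSubscheme

/-! ### The regular locus and the push-out square over the singular locus. -/

section Glued

variable {X Y : Scheme.{u}}

theorem evaluation_appLE (f : X ⟶ Y) {U : Y.Opens} {V : X.Opens} (e : V ≤ f ⁻¹ᵁ U) (x : X)
    (hx : x ∈ V) (a : Γ(Y, U)) :
    X.evaluation V x hx (f.appLE U V e a) = f.residueFieldMap x (Y.evaluation U (f x) (e hx) a) :=
  (evaluation_map X e (f.app U a) x hx).trans (evaluation_app f x (e hx) a)

/-- Gluedness over the base can be tested on the scheme of glued sections, over all opens. -/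
theorem IsGluedFactorization.exists_app_eq_of_mem {N S C : Scheme.{u}} {σ : N ⟶ S} {ς : S ⟶ C}
    (h : IsGluedFactorization σ ς) {V : S.Opens} {d : Γ(N, σ ⁻¹ᵁ V)} (hd : d ∈ gluedSections σ V) :
    ∃ r, σ.app V r = d := by
  classical
  have := h.surjective
  have := h.isReduced
  have hς := h.isResidualUniversalHomeomorphism.isUniversalHomeomorphism.isHomeomorph
  refine exists_app_eq_of_locally σ d fun y hy ↦ ?_
  -- Glued sections are known to lift only over affine opens of `C`. Their preimages form a basis of
  -- `S` because `ς` is a homeomorphism.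
  obtain ⟨_, ⟨U, hU, rfl⟩, hyU, hUV⟩ := (C.isBasis_affineOpens).exists_subset_of_mem_open
    (Set.mem_image_of_mem ς hy) (hς.isOpenMap _ V.isOpen)
  have hle : ς ⁻¹ᵁ U ≤ V := fun z hz ↦ by
    obtain ⟨z', hz', hzz⟩ := hUV (show ς z ∈ U from hz)
    exact hς.injective hzz ▸ hz'
  refine ⟨ς ⁻¹ᵁ U, hle, hyU, h.exists_app_eq hU _ ?_⟩
  refine mem_gluedSections_of_forall fun w _ ↦ ?_
  obtain ⟨z, rfl⟩ := hς.surjective w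
  obtain ⟨c, hc⟩ := map_mem_gluedSections σ hle d hd
  have := h.isResidualUniversalHomeomorphism.isIso_residueFieldMap z
  obtain ⟨c₀, hc₀⟩ := (ConcreteCategory.bijective_of_isIso (ς.residueFieldMap z)).2 (c z)
  refine ⟨Function.update (fun _ ↦ 0) (ς z) c₀, fun x hx hxz ↦ ?_⟩
  obtain rfl : σ x = z := hς.injective hxz
  refine (hc x hx).trans ?_
  rw [← hc₀, Scheme.residueFieldMap_comp]
  have : (Function.update (fun _ ↦ 0) (ς (σ x)) c₀ : ∀ y, C.residueField y) ((σ ≫ ς) x) = c₀ :=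
    Function.update_self _ _ _
  exact congrArg (fun t ↦ σ.residueFieldMap x (ς.residueFieldMap (σ x) t)) this.symm

end Glued

section Regular

variable {N S C : Scheme.{u}} {σ : N ⟶ S}

/-- With a conductor element `s` that does not vanish at `y`, each section upstairs has the form `r
/ s` near the fibre. Its value on the fibre thus comes from the residue field at `y`. -/
theorem HasConductor.isIso_residueFieldMap {V : S.Opens} (h : HasConductor σ V)
    (hV : IsAffineOpen V) [IsAffineHom σ] {y : S} (hy : y ∈ V)
    (hreg : IsRegularLocalRing (S.presheaf.stalk y)) :
    (∀ x x', σ x = y → σ x' = y → x = x') ∧ ∀ x, σ x = y → IsIso (σ.residueFieldMap x) := by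
  classical
  obtain ⟨s, hs, hsb⟩ := (h.isRegularLocalRing_iff y hy).1 hreg
  have key : ∀ r : Γ(N, σ ⁻¹ᵁ V), ∃ c : ∀ y, S.residueField y, ∀ x (hx : x ∈ σ ⁻¹ᵁ V), σ x = y →
      N.evaluation _ x hx r = σ.residueFieldMap x (c (σ x)) := by
    intro b
    obtain ⟨r, hr⟩ := hsb b
    refine ⟨Function.update (fun _ ↦ 0) y (S.evaluation V y hy r / S.evaluation V y hy s),
      fun x hx hxy ↦ ?_⟩
    subst hxy
    rw [Function.update_self, map_div₀, eq_div_iff ((map_ne_zero _).2 hs)]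
    have h1 := evaluation_app σ x hx r
    rw [hr, map_mul] at h1
    rw [mul_comm]
    exact (congr_arg₂ (· * ·) (evaluation_app σ x hx s).symm rfl).trans h1
  refine ⟨fun x x' hx hx' ↦ eq_of_forall_evaluation_eq σ hV hy key hx hx', ?_⟩
  rintro x rfl
  refine isIso_residueFieldMap_of_forall_evaluation_eq σ hV x hy fun r ↦ ?_
  obtain ⟨c, hc⟩ := key r
  exact ⟨_, hc x hy rfl⟩

/-- A conductor element that witnesses regularity at a point does so on its whole basic open. -/
theorem isClosed_nonRegularLocus (H : ∀ y : S, ∃ V, IsAffineOpen V ∧ y ∈ V ∧ HasConductor σ V) :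
    IsClosed (nonRegularLocus S) := by
  rw [← isOpen_compl_iff, isOpen_iff_forall_mem_open]
  intro y hy
  obtain ⟨V, hV, hyV, h⟩ := H y
  obtain ⟨s, hs, hsb⟩ := (h.isRegularLocalRing_iff y hyV).1 (not_not.1 hy)
  refine ⟨S.basicOpen s, fun y' hy' ↦ not_not.2 ?_, (S.basicOpen s).isOpen,
    (S.evaluation_ne_zero_iff_mem_basicOpen y hyV s).1 hs⟩
  have hy'V : y' ∈ V := S.basicOpen_le s hy'
  exact (h.isRegularLocalRing_iff y' hy'V).2
    ⟨s, (S.evaluation_ne_zero_iff_mem_basicOpen y' hy'V s).2 hy', hsb⟩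

variable {ς : S ⟶ C}

/-- Off `Z` being glued is no condition. Over `Z`, the section `t` extends to some `r₀`, and `s -
r₀` pulls back to zero on the fibre product. It therefore has value `0` at all points above `Z` and
is glued. -/
theorem isPushout_nonRegularLocus [IsIntegralHom σ] (h : IsGluedFactorization σ ς)
    (H : ∀ y : S, ∃ V, IsAffineOpen V ∧ y ∈ V ∧ HasConductor σ V)
    (Z : TopologicalSpace.Closeds S) (hZ : (Z : Set S) = nonRegularLocus S) :
    IsPushout (pullback.fst σ (reducedSubschemeMap S Z)) (pullback.snd σ (reducedSubschemeMap S Z))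
      σ (reducedSubschemeMap S Z) := by
  have := h.surjective
  have := h.isReduced
  have hreg : ∀ y ∉ Z, (∀ x x', σ x = y → σ x' = y → x = x') ∧
      ∀ x, σ x = y → IsIso (σ.residueFieldMap x) := by
    intro y hy
    obtain ⟨V, hV, hyV, hcond⟩ := H y
    refine hcond.isIso_residueFieldMap hV hyV (not_not.1 fun hn ↦ hy ?_)
    rw [← SetLike.mem_coe, hZ]
    exact hn
  have hmem : ∀ y ∈ Z, ∃ z, reducedSubschemeMap S Z z = y := by
    intro y hy
    rwa [← SetLike.mem_coe, ← range_reducedSubschemeMap] at hy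
  refine isPushout_of_sections _ _ _ _ pullback.condition (fun x x' hxx ↦ ?_)
    S.isBasis_affineOpens fun V hV e s t hst ↦ ?_
  · by_cases hy : σ x ∈ Z
    · obtain ⟨z, hz⟩ := hmem _ hy
      obtain ⟨w, hw, hwz⟩ := Scheme.Pullback.exists_preimage_pullback x z hz.symm
      obtain ⟨w', hw', hwz'⟩ := Scheme.Pullback.exists_preimage_pullback x' z (hxx.symm.trans hz.symm)
      exact .inr ⟨w, w', hw, hw', hwz.trans hwz'.symm⟩
    · exact .inl ((hreg _ hy).1 x x' rfl hxx.symm)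
  · obtain ⟨r₀, rfl⟩ := Scheme.Hom.app_surjective (reducedSubschemeMap S Z) V hV t
    suffices hd : s - σ.app V r₀ ∈ gluedSections σ V by
      obtain ⟨r₁, hr₁⟩ := h.exists_app_eq_of_mem hd
      exact ⟨r₁ + r₀, by rw [map_add, hr₁, sub_add_cancel]⟩
    have hd0 : (pullback.fst σ (reducedSubschemeMap S Z)).appLE (σ ⁻¹ᵁ V)
        (pullback.snd σ (reducedSubschemeMap S Z) ⁻¹ᵁ reducedSubschemeMap S Z ⁻¹ᵁ V) e
        (s - σ.app V r₀) = 0 := by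
      rw [map_sub, hst, sub_eq_zero]
      simp only [Scheme.Hom.app_eq_appLE]
      rw [← CommRingCat.comp_apply, ← CommRingCat.comp_apply, Scheme.Hom.appLE_comp_appLE,
        Scheme.Hom.appLE_comp_appLE]
      simp only [pullback.condition]
    refine mem_gluedSections_of_forall fun y hy ↦ ?_
    by_cases hyZ : y ∈ Z
    · refine ⟨fun _ ↦ 0, fun x hx hxy ↦ ?_⟩
      subst hxy
      obtain ⟨z, hz⟩ := hmem _ hyZ
      obtain ⟨w, rfl, rfl⟩ := Scheme.Pullback.exists_preimage_pullback x z hz.symm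
      have hw : w ∈ pullback.snd σ (reducedSubschemeMap S Z) ⁻¹ᵁ reducedSubschemeMap S Z ⁻¹ᵁ V :=
        (hz ▸ hy : _ ∈ V)
      have h1 := evaluation_appLE _ e w hw (s - σ.app V r₀)
      rw [hd0, map_zero] at h1
      rw [map_zero]
      exact (map_eq_zero _).1 h1.symm
    · obtain ⟨x, rfl⟩ := σ.surjective y
      have := (hreg _ hyZ).2 x rfl
      exact exists_evaluation_eq_of_isIso x (fun x' hx' ↦ (hreg _ hyZ).1 x' x hx' rfl) _

end Regular

/-! ### Reducedness of the fibres. -/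

section Fiber

theorem isUnit_germ_of_evaluation_ne_zero {X : Scheme.{u}} {U : X.Opens} {x : X} (hx : x ∈ U)
    {a : Γ(X, U)} (ha : X.evaluation U x hx a ≠ 0) : IsUnit (X.presheaf.germ U x hx a) :=
  (X.mem_basicOpen a x hx).1 ((X.evaluation_ne_zero_iff_mem_basicOpen x hx a).1 ha)

theorem eq_zero_of_evaluation_eq_zero {X : Scheme.{u}} [AlgebraicGeometry.IsReduced X]
    {U : X.Opens} {a : Γ(X, U)} (ha : ∀ x (hx : x ∈ U), X.evaluation U x hx a = 0) : a = 0 := by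
  refine eq_zero_of_basicOpen_eq_bot a ?_
  rw [Scheme.basicOpen_eq_bot_iff_forall_evaluation_eq_zero]
  exact fun x ↦ ha x.1 x.2

variable {N S C : Scheme.{u}} {σ : N ⟶ S}

/-- Singular points are zeros of the conductor element, which lies in only finitely many primes, all
maximal. A product of elements from those not contained in the prime of `y` does what is needed. -/
theorem HasConductor.exists_evaluation_eq_zero {V : S.Opens} (h : HasConductor σ V)
    (hV : IsAffineOpen V) {y : S} (hy : y ∈ V) : ∃ s : Γ(S, V), S.evaluation V y hy s ≠ 0 ∧
      ∀ y' (hy' : y' ∈ V), y' ≠ y → y' ∈ nonRegularLocus S → S.evaluation V y' hy' s = 0 := by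
  classical
  obtain ⟨f, hf, hfb⟩ := h.exists_conductor
  have := h.isNoetherianRing
  let P := (hV.primeIdealOf ⟨y, hy⟩).asIdeal
  let T := (finite_setOf_mem_of_isMaximal hf).toFinset.filter fun p ↦ ¬ p ≤ P
  have hT : ∀ p : Ideal Γ(S, V), ¬ p ≤ P → ∃ e ∈ p, e ∉ P := fun p hp ↦ SetLike.not_le_iff_exists.1 hp
  choose! e he heP using hT
  refine ⟨∏ p ∈ T, e p, ?_, fun y' hy' hne hsing ↦ ?_⟩
  · rw [Ne, ← mem_primeIdealOf_iff hV, Ideal.IsPrime.prod_mem_iff]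
    rintro ⟨p, hp, hpP⟩
    exact heP p (Finset.mem_filter.1 hp).2 hpP
  · have hf0 : S.evaluation V y' hy' f = 0 := by
      by_contra hne
      exact hsing ((h.isRegularLocalRing_iff y' hy').2 ⟨f, hne, hfb⟩)
    let p := (hV.primeIdealOf ⟨y', hy'⟩).asIdeal
    have hfp : f ∈ p := (mem_primeIdealOf_iff hV y' hy' f).2 hf0
    rw [← mem_primeIdealOf_iff hV, Ideal.IsPrime.prod_mem_iff]
    have hpP : ¬ p ≤ P := fun hle ↦ by
      have heq : p = P := (hf p inferInstance hfp).eq_of_le (Ideal.IsPrime.ne_top inferInstance) hle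
      refine hne (Specializes.antisymm ?_ ?_).eq
      · refine specializes_of_evaluation_eq_zero hV hy' hy fun b ↦ ?_
        rw [← mem_primeIdealOf_iff hV, ← mem_primeIdealOf_iff hV]
        exact fun hb ↦ hle hb
      · refine specializes_of_evaluation_eq_zero hV hy hy' fun b ↦ ?_
        rw [← mem_primeIdealOf_iff hV, ← mem_primeIdealOf_iff hV]
        exact fun hb ↦ heq.ge hb
    exact ⟨p, Finset.mem_filter.2 ⟨(Set.Finite.mem_toFinset _).2 ⟨inferInstance, hfp⟩, hpP⟩,
      he p hpP⟩

/-- Sections separate the points of the fibres of a finite morphism. -/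
theorem exists_evaluation_eq_zero_of_isFinite [IsFinite σ] {V : S.Opens} (hV : IsAffineOpen V)
    (x : N) (hx : x ∈ σ ⁻¹ᵁ V) : ∃ e : Γ(N, σ ⁻¹ᵁ V), N.evaluation _ x hx e ≠ 0 ∧
      ∀ x' (hx' : x' ∈ σ ⁻¹ᵁ V), σ x' = σ x → x' ≠ x → N.evaluation _ x' hx' e = 0 := by
  classical
  have hfin := σ.finite_preimage_singleton (σ x)
  have hdisc := σ.isDiscrete_preimage_singleton (σ x)
  have hB : IsAffineOpen (σ ⁻¹ᵁ V) := hV.preimage σ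
  have key : ∀ x' : N, σ x' = σ x → x' ≠ x → ∃ e : Γ(N, σ ⁻¹ᵁ V), N.evaluation _ x hx e ≠ 0 ∧
      ∀ hx', N.evaluation _ x' hx' e = 0 := by
    intro x' hx'x hne
    by_contra! hcon
    have hx' : x' ∈ σ ⁻¹ᵁ V := (hx'x ▸ hx : σ x' ∈ V)
    have hsp : x' ⤳ x := by
      refine specializes_of_evaluation_eq_zero hB hx' hx fun b hb ↦ ?_
      by_contra hb'
      obtain ⟨h1, h2⟩ := hcon b hb'
      exact h2 hb
    have : DiscreteTopology (σ ⁻¹' {σ x}) := hdisc.to_subtype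
    have h1 : (⟨x', hx'x⟩ : σ ⁻¹' {σ x}) ⤳ ⟨x, rfl⟩ :=
      Topology.IsInducing.subtypeVal.specializes_iff.1 hsp
    exact hne congr(($(h1.eq)).1)
  choose! e he he' using key
  refine ⟨∏ x' ∈ hfin.toFinset.filter (· ≠ x), e x', ?_, fun x' hx' hx'x hne ↦ ?_⟩
  · rw [map_prod, Finset.prod_ne_zero_iff]
    intro x' hx'
    obtain ⟨h1, h2⟩ := Finset.mem_filter.1 hx'
    exact he x' (show x' ∈ σ ⁻¹' {σ x} from hfin.mem_toFinset.1 h1) h2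
  · rw [map_prod]
    exact Finset.prod_eq_zero (Finset.mem_filter.2 ⟨(Set.Finite.mem_toFinset _).2 hx'x, hne⟩)
      (he' x' hx'x hne hx')

theorem app_fiberι_eq_zero {V : S.Opens} {y : S} (hy : y ∈ V) {r : Γ(S, V)}
    (hr : S.evaluation V y hy r = 0) : (σ.fiberι y).app (σ ⁻¹ᵁ V) (σ.app V r) = 0 := by
  have h0 : (S.fromSpecResidueField y).app V r = 0 := by
    refine eq_zero_of_evaluation_eq_zero fun z hz ↦ ?_
    refine (evaluation_app _ z hz r).trans ?_
    have : ∀ y' (hy' : y' ∈ V), y' = y → S.evaluation V y' hy' r = 0 := by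
      rintro _ _ rfl
      exact hr
    rw [this _ hz (S.fromSpecResidueField_apply y z), map_zero]
  have key : ∀ q : σ.fiber y ⟶ S, q = σ.fiberToSpecResidueField y ≫ S.fromSpecResidueField y →
      q.app V r = 0 := by
    rintro _ rfl
    exact (congrArg ((σ.fiberToSpecResidueField y).app _) h0).trans (map_zero _)
  exact key (σ.fiberι y ≫ σ) pullback.condition

variable {ς : S ⟶ C}

theorem isReduced_fiber [IsFinite σ] (h : IsGluedFactorization σ ς)
    (H : ∀ y : S, ∃ V, IsAffineOpen V ∧ y ∈ V ∧ HasConductor σ V) (y : S) :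
    AlgebraicGeometry.IsReduced (σ.fiber y) := by
  have := h.surjective
  obtain ⟨V, hV, hyV, hcond⟩ := H y
  have hB : IsAffineOpen (σ ⁻¹ᵁ V) := hV.preimage σ
  obtain ⟨s, hs, hs0⟩ := hcond.exists_evaluation_eq_zero hV hyV
  have key (w : σ.fiber y) : _root_.IsReduced ((σ.fiber y).presheaf.stalk w) := by
    refine ⟨fun g hg ↦ ?_⟩
    let φ := (σ.fiberι y).stalkMap w
    have hσx : σ (σ.fiberι y w) = y := by
      have : σ.fiberι y w ∈ σ ⁻¹' {y} := by
        rw [← σ.range_fiberι y]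
        exact ⟨w, rfl⟩
      exact this
    have hx : σ.fiberι y w ∈ σ ⁻¹ᵁ V := by
      change σ (σ.fiberι y w) ∈ V
      rwa [hσx]
    obtain ⟨n, rfl⟩ := (σ.fiberι y).stalkMap_surjective w g
    let _ : Algebra Γ(N, σ ⁻¹ᵁ V) (N.presheaf.stalk (σ.fiberι y w)) :=
      TopCat.Presheaf.algebra_section_stalk N.presheaf (⟨_, hx⟩ : (σ ⁻¹ᵁ V : N.Opens))
    have := hB.isLocalization_stalk ⟨_, hx⟩
    obtain ⟨⟨b, u⟩, hbu⟩ :=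
      IsLocalization.surj (hB.primeIdealOf ⟨_, hx⟩).asIdeal.primeCompl n
    have hu : IsUnit (N.presheaf.germ _ _ hx u.1) := IsLocalization.map_units _ u
    have hbu' : n * N.presheaf.germ _ _ hx u.1 = N.presheaf.germ _ _ hx b := hbu
    suffices hb : φ (N.presheaf.germ _ _ hx b) = 0 by
      rw [← hbu', map_mul] at hb
      exact ((hu.map φ.hom).mul_left_eq_zero).1 hb
    have hbx : N.evaluation _ _ hx b = 0 := by
      have h1 : IsNilpotent (φ (N.presheaf.germ _ _ hx b)) := by
        rw [← hbu', map_mul]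
        exact (Commute.all _ _).isNilpotent_mul_right hg
      have h2 := h1.map ((σ.fiber y).residue w).hom
      have h3 : IsNilpotent ((σ.fiberι y).residueFieldMap w (N.evaluation _ _ hx b)) :=
        cast congr(IsNilpotent ($(Scheme.residue_residueFieldMap (σ.fiberι y) w)
          (N.presheaf.germ _ _ hx b))).symm h2
      exact (map_eq_zero _).1 h3.eq_zero
    obtain ⟨e, he, he0⟩ := exists_evaluation_eq_zero_of_isFinite (σ := σ) hV _ hx
    -- All values over `y` are zero: `b` vanishes at the chosen point and `e` at the rest of the
    -- fibre. Over the other singular points `s` vanishes, and over regular points nothing is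
    -- required.
    have hm : σ.app V s * e * b ∈ gluedSections σ V := by
      refine mem_gluedSections_of_forall fun y' hy' ↦ ?_
      by_cases hyy : y' = y
      · refine ⟨fun _ ↦ 0, fun x' hx' hxy' ↦ ?_⟩
        rw [map_mul, map_mul, map_zero]
        by_cases hxx : x' = σ.fiberι y w
        · subst hxx
          exact mul_eq_zero_of_right _ hbx
        · rw [he0 x' hx' (hxy'.trans (hyy.trans hσx.symm)) hxx, mul_zero, zero_mul]
      · by_cases hreg : y' ∈ nonRegularLocus S
        · refine ⟨fun _ ↦ 0, fun x' hx' hxy' ↦ ?_⟩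
          subst hxy'
          have h1 := evaluation_app σ x' hx' s
          rw [hs0 _ hx' hyy hreg, map_zero] at h1
          rw [map_mul, map_mul, map_zero]
          exact mul_eq_zero_of_left (mul_eq_zero_of_left h1 _) _
        · obtain ⟨x', rfl⟩ := σ.surjective y'
          obtain ⟨V', hV', hyV', hcond'⟩ := H (σ x')
          obtain ⟨h1, h2⟩ := hcond'.isIso_residueFieldMap hV' hyV' (not_not.1 hreg)
          have := h2 x' rfl
          exact exists_evaluation_eq_of_isIso x' (fun x'' hx'' ↦ h1 _ _ hx'' rfl) _
    obtain ⟨r, hr⟩ := h.exists_app_eq_of_mem hm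
    have hr0 : ∀ hy, S.evaluation V (σ (σ.fiberι y w)) hy r = 0 := by
      intro hy
      have h1 := evaluation_app σ _ hx r
      rw [hr, map_mul, hbx, mul_zero] at h1
      exact (map_eq_zero _).1 h1.symm
    have hr1 : S.evaluation V y hyV r = 0 := by
      clear_value φ
      have : ∀ y' (hy' : y' ∈ V), y' = y → S.evaluation V y' hy' r = 0 → S.evaluation V y hyV r = 0 := by
        rintro _ _ rfl h
        exact h
      exact this _ hx hσx (hr0 _)
    -- The glued section comes from a section vanishing at `y`, so it is zero on the fibre. The
    -- factors `s` and `e` are units at the chosen point, which forces the germ of `b` to be zero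
    -- there.
    have h4 : φ (N.presheaf.germ _ _ hx (σ.app V s * e * b)) = 0 := by
      rw [← hr]
      refine (Scheme.Hom.germ_stalkMap_apply _ _ _ _ _).trans ?_
      rw [app_fiberι_eq_zero hyV hr1, map_zero]
    have hsu : IsUnit (N.presheaf.germ _ _ hx (σ.app V s)) := by
      refine isUnit_germ_of_evaluation_ne_zero hx fun h0 ↦ ?_
      have h1 := (map_eq_zero _).1 ((evaluation_app σ _ hx s).symm.trans h0)
      have : ∀ y' (hy' : y' ∈ V), y' = y → S.evaluation V y' hy' s = 0 → S.evaluation V y hyV s = 0 := by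
        rintro _ _ rfl h
        exact h
      exact hs (this _ hx hσx h1)
    have heu := isUnit_germ_of_evaluation_ne_zero hx he
    rw [map_mul, map_mul, map_mul, map_mul] at h4
    exact (((hsu.map φ.hom).mul (heu.map φ.hom)).mul_right_eq_zero).1 h4
  exact isReduced_of_isReduced_stalk _

end Fiber

/-! ### Ramification produces tangent vectors. -/

section Derivation

theorem exists_derivation_of_not_formallyUnramified {A B : Type*} [CommRing A] [CommRing B]
    [Algebra A B] [Algebra.FiniteType A B] (h : ¬ Algebra.FormallyUnramified A B) :
    ∃ (n : Ideal B) (_ : n.IsMaximal) (D : Derivation A B (B ⧸ n)), D ≠ 0 := by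
  rw [Algebra.formallyUnramified_iff, not_subsingleton_iff_nontrivial] at h
  -- Nakayama's lemma at a maximal ideal containing the annihilator of the nonzero finite module of
  -- differentials.
  obtain ⟨n, hn, hne⟩ : ∃ n : Ideal B, n.IsMaximal ∧
      n • (⊤ : Submodule B (Ω[B⁄A])) ≠ ⊤ := by
    by_contra! hcon
    obtain ⟨x, hx⟩ := exists_ne (0 : Ω[B⁄A])
    let I := Submodule.annihilator (⊤ : Submodule B (Ω[B⁄A]))
    have hI : I ≠ ⊤ := fun hI ↦ by
      have h1 : (1 : B) ∈ I := hI ▸ Submodule.mem_top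
      exact hx (by simpa using Submodule.mem_annihilator.1 h1 x trivial)
    obtain ⟨n, hn, hIn⟩ := Ideal.exists_le_maximal I hI
    obtain ⟨r, hr, hr0⟩ := Submodule.exists_sub_one_mem_and_smul_eq_zero_of_fg_of_le_smul n
      (⊤ : Submodule B (Ω[B⁄A])) Module.Finite.fg_top (hcon n hn).ge
    have h2 : r ∈ n := hIn (Submodule.mem_annihilator.2 hr0)
    refine hn.ne_top ((Ideal.eq_top_iff_one n).2 ?_)
    have := n.sub_mem h2 hr
    rwa [sub_sub_cancel] at this
  let _ : Field (B ⧸ n) := Ideal.Quotient.field n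
  let V := Ω[B⁄A] ⧸ (n • (⊤ : Submodule B (Ω[B⁄A])))
  have : Nontrivial V := Submodule.Quotient.nontrivial_iff.2 hne
  obtain ⟨v, hv⟩ := exists_ne (0 : V)
  obtain ⟨l, hl⟩ := Module.Projective.exists_dual_ne_zero (B ⧸ n) hv
  let l' : Ω[B⁄A] →ₗ[B] B ⧸ n := (l.restrictScalars B).comp (Submodule.mkQ _)
  refine ⟨n, hn, l'.compDer (KaehlerDifferential.D A B), fun h0 ↦ hl ?_⟩
  have h1 : l' = 0 := (KaehlerDifferential.linearMapEquivDerivation A B).injective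
    (h0.trans (map_zero (KaehlerDifferential.linearMapEquivDerivation A B)).symm)
  obtain ⟨w, rfl⟩ := Submodule.mkQ_surjective _ v
  exact LinearMap.congr_fun h1 w

/-- The ring homomorphism to the dual numbers attached to a derivation. -/
def dualNumberHom {B K : Type*} [CommRing B] [CommRing K] (ψ : B →+* K) (D : B →+ K)
    (hD : ∀ x y, D (x * y) = ψ x * D y + ψ y * D x) : B →+* DualNumber K where
  toFun b := (ψ b, D b)
  map_one' := by
    have h := hD 1 1
    rw [map_one, mul_one, one_mul, left_eq_add] at h
    exact TrivSqZeroExt.ext (map_one ψ) h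
  map_zero' := TrivSqZeroExt.ext (map_zero ψ) (map_zero D)
  map_add' x y := TrivSqZeroExt.ext (map_add ψ x y) (map_add D x y)
  map_mul' x y := TrivSqZeroExt.ext (map_mul ψ x y)
    ((hD x y).trans (congrArg (ψ x * D y + ·) (mul_comm _ _)))

/-- Elements killed by `D` already fill the constants. Subtracting one of them from `b₀` gives a
nonzero multiple of `ε`. -/
theorem surjective_dualNumberHom {B K : Type*} [CommRing B] [Field K] (ψ : B →+* K) (D : B →+ K)
    (hD : ∀ x y, D (x * y) = ψ x * D y + ψ y * D x) (hψ : ∀ k, ∃ b, ψ b = k ∧ D b = 0)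
    {b₀ : B} (hb₀ : D b₀ ≠ 0) : Function.Surjective (dualNumberHom ψ D hD) := by
  obtain ⟨a₀, ha₀, ha₀'⟩ := hψ (ψ b₀)
  rintro ⟨k, d⟩
  obtain ⟨a, ha, ha'⟩ := hψ k
  obtain ⟨a₁, ha₁, ha₁'⟩ := hψ (d / D b₀)
  refine ⟨a + a₁ * (b₀ - a₀), TrivSqZeroExt.ext ?_ ?_⟩
  · change ψ _ = k
    rw [map_add, map_mul, map_sub, ha₀, sub_self, mul_zero, add_zero, ha]
  · change D _ = d
    rw [map_add, hD, map_sub, map_sub, ha', ha₀', ha₁', ha₁, mul_zero, add_zero, sub_zero, zero_add,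
      div_mul_cancel₀ _ hb₀]

end Derivation

/-! ### Pinching a scheme along a contracted subscheme. -/

section PushoutSections

variable {W X Y Z : Scheme.{u}}

theorem exists_app_pow_mul_eq_zero (f : X ⟶ Y) [QuasiCompact f] {U : Y.Opens} (hU : IsAffineOpen U)
    (r : Γ(Y, U)) (x : Γ(X, f ⁻¹ᵁ U))
    (hx : X.presheaf.map (homOfLE (f.preimage_mono (Y.basicOpen_le r))).op x = 0) :
    ∃ n : ℕ, f.app U r ^ n * x = 0 := by
  refine exists_pow_mul_eq_zero_of_res_basicOpen_eq_zero_of_isCompact X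
    (f.isCompact_preimage hU.isCompact) x (f.app U r) ?_
  have h1 := congrArg (X.presheaf.map (eqToHom (f.preimage_basicOpen r).symm).op) hx
  rw [map_zero, ← CommRingCat.comp_apply, ← X.presheaf.map_comp] at h1
  exact h1

variable (a : W ⟶ X) (b : W ⟶ Z) (f : X ⟶ Y) (i : Z ⟶ Y)

theorem preimage_le_of_comm (comm : a ≫ f = b ≫ i) (U : Y.Opens) :
    b ⁻¹ᵁ i ⁻¹ᵁ U ≤ a ⁻¹ᵁ f ⁻¹ᵁ U := by
  rw [← Scheme.Hom.comp_preimage, ← Scheme.Hom.comp_preimage, comm]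

theorem appLE_app_eq (comm : a ≫ f = b ≫ i) (U : Y.Opens) (r : Γ(Y, U)) :
    a.appLE _ _ (preimage_le_of_comm a b f i comm U) (f.app U r) = b.app _ (i.app U r) := by
  simp only [Scheme.Hom.app_eq_appLE]
  rw [← CommRingCat.comp_apply, ← CommRingCat.comp_apply, Scheme.Hom.appLE_comp_appLE,
    Scheme.Hom.appLE_comp_appLE]
  simp only [comm]

/-- The sections of `X` over the preimage of an open of `Y` whose pullback to `W` comes from `Z`. -/
noncomputable def pushoutSections (comm : a ≫ f = b ≫ i) (U : Y.Opens) : Subring Γ(X, f ⁻¹ᵁ U) :=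
  (b.app (i ⁻¹ᵁ U)).hom.range.comap (a.appLE _ _ (preimage_le_of_comm a b f i comm U)).hom

variable {a b f i} {comm : a ≫ f = b ≫ i}

theorem mem_pushoutSections {U : Y.Opens} {s : Γ(X, f ⁻¹ᵁ U)} :
    s ∈ pushoutSections a b f i comm U ↔ ∃ t, b.app (i ⁻¹ᵁ U) t =
      a.appLE _ _ (preimage_le_of_comm a b f i comm U) s := Iff.rfl

variable (a b f i comm)

theorem appLE_map_preimage {U V : Y.Opens} (h : V ≤ U) (s : Γ(X, f ⁻¹ᵁ U)) :
    a.appLE _ _ (preimage_le_of_comm a b f i comm V)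
      (X.presheaf.map (homOfLE (f.preimage_mono h)).op s) =
    W.presheaf.map (homOfLE (b.preimage_mono (i.preimage_mono h))).op
      (a.appLE _ _ (preimage_le_of_comm a b f i comm U) s) := by
  rw [← CommRingCat.comp_apply, ← CommRingCat.comp_apply, Scheme.Hom.map_appLE,
    Scheme.Hom.appLE_map]

theorem app_map_preimage {U V : Y.Opens} (h : V ≤ U) (t : Γ(Z, i ⁻¹ᵁ U)) :
    b.app _ (Z.presheaf.map (homOfLE (i.preimage_mono h)).op t) =
      W.presheaf.map (homOfLE (b.preimage_mono (i.preimage_mono h))).op (b.app _ t) :=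
  congr($(b.naturality (homOfLE (i.preimage_mono h)).op) t)

theorem map_app_eq_app_map {U V : Y.Opens} (h : V ≤ U) (r : Γ(Y, U)) :
    X.presheaf.map (homOfLE (f.preimage_mono h)).op (f.app U r) =
      f.app V (Y.presheaf.map (homOfLE h).op r) :=
  congr($(f.naturality (homOfLE h).op) r).symm

/-- The family of subrings of those sections whose pullback to `W` comes from `Z`. -/
noncomputable def pushoutSectionSubrings [QuasiCompact f] [QuasiSeparated f] [QuasiCompact i]
    [QuasiSeparated i] [QuasiCompact b] : SectionSubrings f where
  ring := pushoutSections a b f i comm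
  app_mem U r := ⟨i.app U r, (appLE_app_eq a b f i comm U r).symm⟩
  map_mem {U V} h s := by
    rintro ⟨t, ht⟩
    refine ⟨Z.presheaf.map (homOfLE (i.preimage_mono h)).op t, ?_⟩
    exact (app_map_preimage b i h t).trans
      ((congrArg _ ht).trans (appLE_map_preimage a b f i comm h s).symm)
  exists_map_eq {U} hU r s := by
    rintro ⟨t, ht⟩
    have hle := Y.basicOpen_le r
    obtain ⟨n₁, s₁, hs₁⟩ := exists_map_eq_app_pow_mul f hU r s
    obtain ⟨n₂, t₁, ht₁⟩ := exists_map_eq_app_pow_mul i hU r t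
    have ht' : b.app (i ⁻¹ᵁ Y.basicOpen r) t =
      a.appLE _ _ (preimage_le_of_comm a b f i comm _) s := ht
    let r' := Y.presheaf.map (homOfLE hle).op r
    have hs₂ : X.presheaf.map (homOfLE (f.preimage_mono hle)).op (f.app U r ^ n₂ * s₁) =
        f.app _ r' ^ (n₁ + n₂) * s := by
      rw [map_mul, map_pow, map_app_eq_app_map f hle, hs₁]
      ring
    have ht₂ : Z.presheaf.map (homOfLE (i.preimage_mono hle)).op (i.app U r ^ n₁ * t₁) =
        i.app _ r' ^ (n₁ + n₂) * t := by
      rw [map_mul, map_pow, map_app_eq_app_map i hle, ht₁]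
      ring
    -- The two extensions to `U` agree on `W` only over the basic open, so a further power of `r` is
    -- needed.
    obtain ⟨m, hm⟩ := exists_app_pow_mul_eq_zero (b ≫ i) hU r
      (a.appLE _ _ (preimage_le_of_comm a b f i comm U) (f.app U r ^ n₂ * s₁) -
        b.app (i ⁻¹ᵁ U) (i.app U r ^ n₁ * t₁)) (by
        refine (map_sub _ _ _).trans (sub_eq_zero.2 ?_)
        refine (appLE_map_preimage a b f i comm hle _).symm.trans
          (Eq.trans ?_ (app_map_preimage b i hle _))
        rw [hs₂, ht₂, map_mul, map_mul, map_pow, map_pow, appLE_app_eq a b f i comm, ht'])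
    have hm' : b.app _ (i.app U r) ^ m * a.appLE _ _ (preimage_le_of_comm a b f i comm U)
        (f.app U r ^ n₂ * s₁) =
        b.app _ (i.app U r) ^ m * b.app (i ⁻¹ᵁ U) (i.app U r ^ n₁ * t₁) := by
      refine sub_eq_zero.1 (Eq.trans ?_ hm)
      exact (mul_sub _ _ _).symm
    refine ⟨m + (n₁ + n₂), f.app U r ^ m * (f.app U r ^ n₂ * s₁),
      ⟨i.app U r ^ m * (i.app U r ^ n₁ * t₁), ?_⟩, ?_⟩
    · have h1 : b.app (i ⁻¹ᵁ U) (i.app U r ^ m * (i.app U r ^ n₁ * t₁)) =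
          a.appLE _ _ (preimage_le_of_comm a b f i comm U)
            (f.app U r ^ m * (f.app U r ^ n₂ * s₁)) := by
        simp only [map_mul, map_pow, appLE_app_eq a b f i comm U r] at hm' ⊢
        exact hm'.symm
      exact h1
    · rw [map_mul, map_pow, hs₂, map_app_eq_app_map f hle]
      ring

end PushoutSections

section Chain

variable {W X X' Y Z : Scheme.{u}}

/-- Two morphisms over an affine morphism agree if they agree on sections. -/
theorem hom_ext_of_appLE (h : X' ⟶ Y) [IsAffineHom h] {m₁ m₂ : W ⟶ X'} (hm : m₁ ≫ h = m₂ ≫ h)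
    (H : ∀ {U : Y.Opens}, IsAffineOpen U → ∀ (V : W.Opens) (e₁ : V ≤ m₁ ⁻¹ᵁ h ⁻¹ᵁ U)
      (e₂ : V ≤ m₂ ⁻¹ᵁ h ⁻¹ᵁ U) (r : Γ(X', h ⁻¹ᵁ U)), m₁.appLE _ V e₁ r = m₂.appLE _ V e₂ r) :
    m₁ = m₂ := by
  refine Scheme.hom_ext_of_forall _ _ fun w ↦ ?_
  obtain ⟨U, hU⟩ := SectionSubrings.exists_affine_mem (h (m₁ w))
  have hA : IsAffineOpen (h ⁻¹ᵁ U.toOpens) := U.2.preimage h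
  have e₂ : m₁ ⁻¹ᵁ h ⁻¹ᵁ U.toOpens ≤ m₂ ⁻¹ᵁ h ⁻¹ᵁ U.toOpens := by
    rw [← Scheme.Hom.comp_preimage, ← Scheme.Hom.comp_preimage, hm]
  refine ⟨m₁ ⁻¹ᵁ h ⁻¹ᵁ U.toOpens, hU, ?_⟩
  rw [← toSpecΓ_SpecMap_appLE_fromSpec m₁ hA _ le_rfl, ← toSpecΓ_SpecMap_appLE_fromSpec m₂ hA _ e₂]
  congr 3
  ext r
  exact H U.2 _ le_rfl e₂ r

theorem isFinite_of_comp (g : X ⟶ X') (h : X' ⟶ Y) [IsFinite (g ≫ h)] [Surjective g]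
    [AlgebraicGeometry.IsReduced X'] [IsLocallyNoetherian Y] [IsAffineHom h] : IsFinite h where
  finite_app U hU := by
    have hn : IsNoetherianRing Γ(Y, U) := IsLocallyNoetherian.component_noetherian ⟨U, hU⟩
    have hfin : ((g ≫ h).app U).hom.Finite := (g ≫ h).finite_app U hU
    let _ := (h.app U).hom.toAlgebra
    let _ := ((g ≫ h).app U).hom.toAlgebra
    have : Module.Finite Γ(Y, U) Γ(X, (g ≫ h) ⁻¹ᵁ U) := hfin
    let φ : Γ(X', h ⁻¹ᵁ U) →ₐ[Γ(Y, U)] Γ(X, (g ≫ h) ⁻¹ᵁ U) :=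
      { (g.app (h ⁻¹ᵁ U)).hom with commutes' := fun r ↦ rfl }
    exact Module.Finite.of_injective φ.toLinearMap (injective_app_of_surjective g (h ⁻¹ᵁ U))

/-- A finite surjective universally injective morphism to a reduced scheme is an isomorphism if it
is unramified. -/
theorem isIso_of_formallyUnramified (π : X ⟶ Y) [IsFinite π] [AlgebraicGeometry.IsReduced Y]
    [Surjective π] [UniversallyInjective π] [FormallyUnramified π] : IsIso π := by
  -- Universal injectivity makes the diagonal surjective and unramifiedness makes it an open
  -- immersion.
  have hs : Surjective (pullback.diagonal π) := (UniversallyInjective.iff_diagonal π).1 ‹_›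
  have : IsIso (pullback.diagonal π) :=
    isIso_of_isOpenImmersion_of_opensRange_eq_top _
      (TopologicalSpace.Opens.ext hs.surj.range_eq)
  have : Mono π := (pullback.isIso_diagonal_iff π).1 this
  have := (IsClosedImmersion.iff_isFinite_and_mono π).2 ⟨‹_›, ‹_›⟩
  exact isIso_of_isClosedImmersion_of_surjective π

theorem formallyUnramified_of_forall_app (π : X ⟶ Y) [IsAffineHom π]
    (H : ∀ U : Y.Opens, IsAffineOpen U → (π.app U).hom.FormallyUnramified) :
    FormallyUnramified π where
  formallyUnramified_appLE {U} hU {V} hV e := by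
    have h1 := Scheme.Hom.formallyUnramified_appLE (𝟙 X) (hU.preimage π) hV e
    have h2 : π.appLE U V e = π.app U ≫ (𝟙 X : X ⟶ X).appLE (π ⁻¹ᵁ U) V e := by
      unfold Scheme.Hom.appLE
      rw [Scheme.Hom.id_app]
      exact congrArg _ (Category.id_comp _).symm
    rw [h2, CommRingCat.hom_comp]
    exact RingHom.FormallyUnramified.comp (H U hU) h1

theorem isIso_residueFieldMap_of_comp (g : X ⟶ X') (h : X' ⟶ Y) (x : X)
    [IsIso ((g ≫ h).residueFieldMap x)] : IsIso (h.residueFieldMap (g x)) := by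
  refine (ConcreteCategory.isIso_iff_bijective _).2 ⟨(h.residueFieldMap (g x)).hom.injective,
    fun r ↦ ?_⟩
  obtain ⟨c, hc⟩ := ((ConcreteCategory.isIso_iff_bijective _).1
    ‹IsIso ((g ≫ h).residueFieldMap x)›).2 (g.residueFieldMap x r)
  refine ⟨c, (g.residueFieldMap x).hom.injective (Eq.trans ?_ hc)⟩
  rw [Scheme.residueFieldMap_comp]
  rfl

theorem appLE_appLE (f : X ⟶ Y) (g : Y ⟶ Z) {U : Z.Opens} {V : Y.Opens} {O : X.Opens}
    (e₁ : V ≤ g ⁻¹ᵁ U) (e₂ : O ≤ f ⁻¹ᵁ V) (e : O ≤ (f ≫ g) ⁻¹ᵁ U) (r : Γ(Z, U)) :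
    f.appLE V O e₂ (g.appLE U V e₁ r) = (f ≫ g).appLE U O e r := by
  rw [← CommRingCat.comp_apply, Scheme.Hom.appLE_comp_appLE]

theorem appLE_id_apply {U : X.Opens} (e : U ≤ (𝟙 X) ⁻¹ᵁ U) (r : Γ(X, U)) :
    (𝟙 X : X ⟶ X).appLE U U e r = r := by
  rw [Scheme.Hom.appLE, Scheme.Hom.id_app]
  exact congr($(X.presheaf.map_id _) r)

/-- A section on `W` that comes from `Z` is recovered by restricting it along `z` and pulling back
along `b`. This makes the pinching square commute with the bottom map given by `z`. -/
theorem appLE_eq_of_appLE_eq {a : W ⟶ X} {b : W ⟶ Z} {z : Z ⟶ W} (hz : z ≫ b = 𝟙 Z)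
    {g : X ⟶ X'} {A : X'.Opens} {B : X.Opens} {D : Z.Opens} {E : W.Opens} (hB : B ≤ g ⁻¹ᵁ A)
    (hE : E ≤ a ⁻¹ᵁ B) (hE' : E ≤ b ⁻¹ᵁ D) (hD : D ≤ z ⁻¹ᵁ E) {r : Γ(X', A)} {t : Γ(Z, D)}
    (ht : b.appLE D E hE' t = a.appLE B E hE (g.appLE A B hB r)) {V : W.Opens} (hV : V ≤ E)
    (e₁ : V ≤ (b ≫ z ≫ a ≫ g) ⁻¹ᵁ A) (e₂ : V ≤ (a ≫ g) ⁻¹ᵁ A) :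
    (b ≫ z ≫ a ≫ g).appLE A V e₁ r = (a ≫ g).appLE A V e₂ r := by
  have h0 : z.appLE E D hD (b.appLE D E hE' t) = t := by
    rw [appLE_appLE z b _ _ (by rw [hz]; rfl)]
    simp only [hz]
    exact appLE_id_apply _ t
  have hE₀ : E ≤ (a ≫ g) ⁻¹ᵁ A := fun _ h ↦ hB (hE h)
  have hD₀ : D ≤ (z ≫ a ≫ g) ⁻¹ᵁ A := fun _ h ↦ hE₀ (hD h)
  rw [appLE_appLE a g hB hE hE₀] at ht
  have h1 : (z ≫ a ≫ g).appLE A D hD₀ r = t := by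
    rw [← h0, ht, appLE_appLE z (a ≫ g) hE₀ hD hD₀]
  rw [← appLE_appLE b (z ≫ a ≫ g) hD₀ (hV.trans hE'), h1,
    ← Scheme.Hom.appLE_map _ hE' (homOfLE hV).op, CommRingCat.comp_apply, ht,
    ← CommRingCat.comp_apply, Scheme.Hom.appLE_map]

/-- The push-out of a homeomorphism `f` with trivial residue field extensions along a morphism `b`
with a section: it factors `f`, and its sections are described by `pushoutSections`. -/
theorem exists_isPushout (a : W ⟶ X) (b : W ⟶ Z) (z : Z ⟶ W) (hz : z ≫ b = 𝟙 Z) (f : X ⟶ Y)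
    (hf : IsResidualUniversalHomeomorphism f) (comm : a ≫ f = b ≫ z ≫ a ≫ f)
    [AlgebraicGeometry.IsReduced X] [AlgebraicGeometry.IsReduced Z] [Surjective b] [QuasiCompact b]
    [QuasiCompact (z ≫ a ≫ f)] [QuasiSeparated (z ≫ a ≫ f)] :
    ∃ (X' : Scheme.{u}) (g : X ⟶ X') (h : X' ⟶ Y), g ≫ h = f ∧
      IsResidualUniversalHomeomorphism h ∧ AlgebraicGeometry.IsReduced X' ∧ Surjective g ∧
      IsPushout a b g (z ≫ a ≫ g) ∧ ∀ {U : Y.Opens}, IsAffineOpen U → ∀ r : Γ(X', h ⁻¹ᵁ U),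
        ∃ t : Γ(Z, (z ≫ a ≫ g) ⁻¹ᵁ h ⁻¹ᵁ U), ∀ e,
          a.appLE _ _ e (g.app (h ⁻¹ᵁ U) r) = b.app _ t := by
  have := hf.isUniversalHomeomorphism.isIntegralHom
  have hfinj := hf.isUniversalHomeomorphism.isHomeomorph.injective
  have hfsurj := hf.isUniversalHomeomorphism.isHomeomorph.surjective
  have hfres := hf.isIso_residueFieldMap
  have : Surjective f := ⟨hfsurj⟩
  obtain ⟨X', g, h, rfl, haff, H⟩ := (pushoutSectionSubrings a b f _ comm).exists_factorization
  have hinj : ∀ {U : Y.Opens}, IsAffineOpen U → Function.Injective (g.app (h ⁻¹ᵁ U)) := by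
    intro U hU
    have := (H hU).1
    rwa [Scheme.Hom.app_eq_appLE]
  have hmem : ∀ {U : Y.Opens}, IsAffineOpen U → ∀ s, s ∈ pushoutSections a b (g ≫ h) _ comm U ↔
      ∃ r, g.app (h ⁻¹ᵁ U) r = s := by
    intro U hU
    have := (H hU).2
    rwa [Scheme.Hom.app_eq_appLE]
  have hred := isReduced_of_injective_app g h hinj
  have hdom := isDominant_of_injective_app g h hinj
  have hint := isIntegralHom_of_injective_app g h hinj
  have hint' : IsIntegralHom g := IsIntegralHom.of_comp g h
  have hsurj : Surjective g :=
    surjective_of_isDominant_of_isClosed_range _ g.isClosedMap.isClosed_range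
  have hsurj' : Surjective h := Surjective.of_comp g h
  have hginj : Function.Injective g := fun x x' hxx ↦ hfinj (by
    rw [Scheme.Hom.comp_apply, hxx, Scheme.Hom.comp_apply])
  have hhinj : Function.Injective h := fun y y' hyy ↦ by
    obtain ⟨x, rfl⟩ := g.surjective y
    obtain ⟨x', rfl⟩ := g.surjective y'
    exact congrArg _ (hfinj hyy)
  have hh : IsResidualUniversalHomeomorphism h := by
    refine isResidualUniversalHomeomorphism_of_isIntegralHom hhinj fun y ↦ ?_
    obtain ⟨x, rfl⟩ := g.surjective y
    exact isIso_residueFieldMap_of_comp g h x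
  have hcomm : a ≫ g = b ≫ z ≫ a ≫ g := by
    refine (hom_ext_of_appLE h (by simpa using comm.symm) fun hU V e₁ e₂ r ↦ ?_).symm
    obtain ⟨t, ht⟩ := mem_pushoutSections.1 ((hmem hU _).2 ⟨r, rfl⟩)
    rw [Scheme.Hom.app_eq_appLE, Scheme.Hom.app_eq_appLE] at ht
    exact appLE_eq_of_appLE_eq hz _ _ _ (by rw [← Scheme.Hom.comp_preimage z b, hz]; rfl) ht e₁ _ _
  have hbasis : TopologicalSpace.Opens.IsBasis
      (Set.range fun U : Y.AffineZariskiSite ↦ h ⁻¹ᵁ U.toOpens) := by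
    rw [TopologicalSpace.Opens.isBasis_iff_nbhd]
    intro V y hy
    have hhom := hh.isUniversalHomeomorphism.isHomeomorph
    obtain ⟨V', hV', hVV⟩ := hhom.isInducing.isOpen_iff.1 V.2
    have hle (x : X') : x ∈ V ↔ h x ∈ V' := (Set.ext_iff.1 hVV x).symm
    obtain ⟨_, ⟨U, hU, rfl⟩, hyU, hUV⟩ :=
      Y.isBasis_affineOpens.exists_subset_of_mem_open ((hle y).1 hy) hV'
    exact ⟨_, ⟨⟨U, hU⟩, rfl⟩, hyU, fun x hx ↦ (hle x).2 (hUV hx)⟩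
  refine ⟨X', g, h, rfl, hh, hred, hsurj, ?_, fun {U} hU r ↦ ?_⟩
  · refine isPushout_of_sections a b g _ hcomm (fun x x' hx ↦ .inl (hginj hx)) hbasis ?_
    rintro _ ⟨U, rfl⟩ e s t hst
    exact (hmem U.2 s).1 ⟨t, hst.symm⟩
  · obtain ⟨t, ht⟩ := (hmem hU _).2 ⟨r, rfl⟩
    exact ⟨t, fun e ↦ ht.symm⟩

end Chain

/-! ### Dual numbers. -/

section DualNumber

theorem exists_surjective_dualNumber {A B K : Type*} [CommRing A] [CommRing B] [Field K]
    [Algebra A B] {n : Ideal B} {D : Derivation A B (B ⧸ n)} (hD : D ≠ 0) (ψ : B →+* K)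
    (hn : ∀ b, b ∈ n ↔ ψ b = 0) (hψ : ∀ k, ∃ a, ψ (algebraMap A B a) = k) :
    ∃ φ : B →+* DualNumber K, Function.Surjective φ ∧ (∀ b, (φ b).fst = ψ b) ∧
      ∀ a, φ (algebraMap A B a) = algebraMap K _ (ψ (algebraMap A B a)) := by
  let ψ' : B ⧸ n →+* K := Ideal.Quotient.lift n ψ fun b hb ↦ (hn b).1 hb
  have hψ' : Function.Injective ψ' := (injective_iff_map_eq_zero _).2 fun b hb ↦ by
    obtain ⟨b, rfl⟩ := Ideal.Quotient.mk_surjective b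
    exact Ideal.Quotient.eq_zero_iff_mem.2 ((hn b).2 hb)
  have hsmul (b : B) (v : B ⧸ n) : ψ' (b • v) = ψ b * ψ' v := by
    rw [Algebra.smul_def, map_mul]
    rfl
  let D' : B →+ K := ψ'.toAddMonoidHom.comp D.toLinearMap.toAddMonoidHom
  have hD' (x y : B) : D' (x * y) = ψ x * D' y + ψ y * D' x := by
    change ψ' (D (x * y)) = _
    rw [D.leibniz, map_add, hsmul, hsmul]
    rfl
  have hA (a : A) : D' (algebraMap A B a) = 0 := by
    change ψ' (D _) = 0
    rw [D.map_algebraMap, map_zero]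
  obtain ⟨b₀, hb₀⟩ : ∃ b₀, D b₀ ≠ 0 := by
    by_contra! h
    exact hD (Derivation.ext h)
  refine ⟨dualNumberHom ψ D' hD', surjective_dualNumberHom ψ D' hD' (fun k ↦ ?_) (b₀ := b₀) ?_,
    fun b ↦ rfl, fun a ↦ TrivSqZeroExt.ext rfl (hA a)⟩
  · obtain ⟨a, ha⟩ := hψ k
    exact ⟨_, ha, hA a⟩
  · exact fun h ↦ hb₀ (hψ' (h.trans (map_zero ψ').symm))

/-- The dual numbers are functorial. -/
def dualNumberMap {K L : Type*} [CommRing K] [CommRing L] (φ : K →+* L) :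
    DualNumber K →+* DualNumber L where
  toFun x := (φ x.fst, φ x.snd)
  map_one' := TrivSqZeroExt.ext (map_one φ) (map_zero φ)
  map_zero' := TrivSqZeroExt.ext (map_zero φ) (map_zero φ)
  map_add' x y := TrivSqZeroExt.ext (map_add φ _ _) (map_add φ _ _)
  map_mul' x y := TrivSqZeroExt.ext (map_mul φ _ _) (by
    change φ (x.fst * y.snd + x.snd * y.fst) = φ x.fst * φ y.snd + φ x.snd * φ y.fst
    rw [map_add, map_mul, map_mul])

/-- The canonical morphism `Spec K[ε] ⟶ Spec K`. -/
noncomputable abbrev dualNumberProj (K : Type u) [CommRing K] :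
    Spec (CommRingCat.of (DualNumber K)) ⟶ Spec (CommRingCat.of K) :=
  Spec.map (CommRingCat.ofHom (algebraMap K (DualNumber K)))

/-- The canonical morphism `Spec K ⟶ Spec K[ε]`. -/
noncomputable abbrev dualNumberSection (K : Type u) [CommRing K] :
    Spec (CommRingCat.of K) ⟶ Spec (CommRingCat.of (DualNumber K)) :=
  Spec.map (CommRingCat.ofHom (TrivSqZeroExt.fstHom K K K).toRingHom)

theorem dualNumberSection_proj (K : Type u) [CommRing K] :
    dualNumberSection K ≫ dualNumberProj K = 𝟙 _ := by
  rw [← Spec.map_comp, ← Spec.map_id]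
  rfl

instance subsingleton_primeSpectrum_dualNumber (K : Type*) [Field K] :
    Subsingleton (PrimeSpectrum (DualNumber K)) := by
  have key (p : PrimeSpectrum (DualNumber K)) (r : DualNumber K) :
      r ∈ p.asIdeal ↔ r.fst = 0 := by
    refine ⟨fun hr ↦ ?_, fun hr ↦ p.2.mem_of_pow_mem 2 ?_⟩
    · by_contra h
      exact p.2.ne_top (Ideal.eq_top_of_isUnit_mem _ hr
        (TrivSqZeroExt.isUnit_iff_isUnit_fst.2 (isUnit_iff_ne_zero.2 h)))
    · have : r ^ 2 = 0 := by
        rw [sq]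
        exact TrivSqZeroExt.ext (by simp [hr]) (by simp [hr])
      exact this ▸ p.asIdeal.zero_mem
  exact ⟨fun p q ↦ PrimeSpectrum.ext (Ideal.ext fun r ↦ (key p r).trans (key q r).symm)⟩

instance isClosedImmersion_dualNumberSection (K : Type u) [CommRing K] :
    IsClosedImmersion (dualNumberSection K) :=
  IsClosedImmersion.spec_of_surjective _ fun k ↦ ⟨algebraMap K _ k, rfl⟩

instance surjective_dualNumberProj (K : Type u) [CommRing K] : Surjective (dualNumberProj K) where
  surj x := ⟨dualNumberSection K x, by
    rw [← Scheme.Hom.comp_apply, dualNumberSection_proj]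
    rfl⟩

/-- The function `ε` is not constant. This makes every pinching a strict step. -/
theorem not_surjective_app_dualNumberProj (K : Type u) [Field K]
    {D : (Spec (CommRingCat.of K)).Opens} (hD : D = ⊤) :
    ¬ Function.Surjective ((dualNumberProj K).app D) := by
  subst hD
  intro h
  have h1 : (dualNumberProj K).appTop = (Scheme.ΓSpecIso _).hom ≫
      CommRingCat.ofHom (algebraMap K (DualNumber K)) ≫ (Scheme.ΓSpecIso _).inv := by
    rw [Scheme.ΓSpecIso_inv_naturality, Iso.hom_inv_id_assoc]
  obtain ⟨s, hs⟩ := h ((Scheme.ΓSpecIso _).inv DualNumber.eps)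
  have h2 := congrArg (Scheme.ΓSpecIso _).hom hs
  change (Scheme.ΓSpecIso _).hom ((dualNumberProj K).appTop s) = _ at h2
  rw [h1, ← CommRingCat.comp_apply, ← CommRingCat.comp_apply] at h2
  simp only [Category.assoc, Iso.inv_hom_id, Category.comp_id] at h2
  have h3 := congrArg TrivSqZeroExt.snd h2
  change 0 = (1 : K) at h3
  exact zero_ne_one h3

variable {X Y Z : Scheme.{u}}

/-- A `K`-point that is a closed immersion identifies `K` with the residue field of its image. This
allows the pinching to be built with the residue field of the final base instead of that of the
pinched scheme. -/
theorem isDualNumberPushout_of_isPushout {f : X ⟶ Y} (K : Type u) [Field K]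
    (i : Spec (CommRingCat.of (DualNumber K)) ⟶ X) [IsClosedImmersion i]
    (j : Spec (CommRingCat.of K) ⟶ Y) [hj : IsClosedImmersion j]
    (H : IsPushout i (dualNumberProj K) f j) : IsDualNumberPushout f := by
  obtain ⟨⟨y, φ⟩, rfl⟩ := (Scheme.SpecToEquivOfField K Y).symm.surjective j
  change IsPushout i _ f (Spec.map φ ≫ Y.fromSpecResidueField y) at H
  replace hj : IsClosedImmersion (Spec.map φ ≫ Y.fromSpecResidueField y) := hj
  have hφ : IsClosedImmersion (Spec.map φ) :=
    IsClosedImmersion.of_comp _ (Y.fromSpecResidueField y)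
  have hsurj : Surjective (Spec.map φ) :=
    ⟨fun x ↦ ⟨IsLocalRing.closedPoint K, Subsingleton.elim (α := PrimeSpectrum _) _ _⟩⟩
  have : IsIso (Spec.map φ) := isIso_of_isClosedImmersion_of_surjective _
  have : IsIso φ := (ConcreteCategory.isIso_iff_bijective φ).2 (isIso_SpecMap_iff.1 this)
  have hy : IsClosed ({y} : Set Y) := by
    rw [← Y.range_fromSpecResidueField y, ← hsurj.surj.range_comp (Y.fromSpecResidueField y)]
    exact (Spec.map φ ≫ Y.fromSpecResidueField y).isClosedEmbedding.isClosed_range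
  let w : Spec (CommRingCat.of (DualNumber (Y.residueField y))) ⟶
      Spec (CommRingCat.of (DualNumber K)) :=
    Spec.map (CommRingCat.ofHom (dualNumberMap (inv φ).hom))
  have hw : IsIso w := by
    have h1 : w ≫ Spec.map (CommRingCat.ofHom (dualNumberMap φ.hom)) = 𝟙 _ := by
      rw [← Spec.map_comp, ← Spec.map_id]
      refine congrArg _ (CommRingCat.hom_ext (RingHom.ext fun (x : DualNumber _) ↦ ?_))
      exact TrivSqZeroExt.ext congr($(IsIso.hom_inv_id φ) x.fst) congr($(IsIso.hom_inv_id φ) x.snd)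
    have h2 : Spec.map (CommRingCat.ofHom (dualNumberMap φ.hom)) ≫ w = 𝟙 _ := by
      rw [← Spec.map_comp, ← Spec.map_id]
      refine congrArg _ (CommRingCat.hom_ext (RingHom.ext fun (x : DualNumber _) ↦ ?_))
      exact TrivSqZeroExt.ext congr($(IsIso.inv_hom_id φ) x.fst) congr($(IsIso.inv_hom_id φ) x.snd)
    exact ⟨_, h1, h2⟩
  have hsq : IsPushout w (dualNumberProj (Y.residueField y)) (dualNumberProj K)
      (Spec.map (inv φ)) := by
    refine IsPushout.of_horiz_isIso ⟨?_⟩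
    rw [← Spec.map_comp, ← Spec.map_comp]
    refine congrArg _ (CommRingCat.hom_ext (RingHom.ext fun x ↦ ?_))
    exact TrivSqZeroExt.ext rfl (map_zero (inv φ).hom)
  have H' := hsq.paste_horiz H
  rw [← Category.assoc, ← Spec.map_comp, IsIso.hom_inv_id, Spec.map_id] at H'
  refine ⟨y, hy, w ≫ i, inferInstance, ?_⟩
  convert H' using 1
  exact (Category.id_comp _).symm

theorem FactorisationTheorem.IsDualNumberPushout.comp_isIso {f : X ⟶ Y}
    (hf : IsDualNumberPushout f) (e : Y ⟶ Z) [IsIso e] : IsDualNumberPushout (f ≫ e) := by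
  obtain ⟨y, hy, i, hi, H⟩ := hf
  have := isClosed_singleton_iff_isClosedImmersion.1 hy
  refine isDualNumberPushout_of_isPushout (Y.residueField y) i (Y.fromSpecResidueField y ≫ e) ?_
  have hsq : IsPushout (Y.fromSpecResidueField y)
      (𝟙 (Spec (CommRingCat.of (Y.residueField y)))) e (Y.fromSpecResidueField y ≫ e) :=
    IsPushout.of_vert_isIso ⟨(Category.id_comp _).symm⟩
  have H' : IsPushout i (dualNumberProj _ ≫ 𝟙 _) (f ≫ e) (Y.fromSpecResidueField y ≫ e) :=
    H.paste_vert hsq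
  rwa [Category.comp_id] at H'

end DualNumber

/-! ### One pinching step. -/

section Step

variable {X Y : Scheme.{u}}

theorem SpecMap_evaluation_fromSpec {U : X.Opens} (hU : IsAffineOpen U) (x : X) (hx : x ∈ U) :
    Spec.map (X.evaluation U x hx) ≫ hU.fromSpec = X.fromSpecResidueField x := by
  rw [← X.germ_residue, Spec.map_comp, Category.assoc]
  congr 1
  exact (hU.fromSpecStalk_eq_fromSpecStalk hx)

/-- A finite universal homeomorphism of reduced schemes with trivial residue field extensions that
is not an isomorphism is ramified, and hence contracts a tangent vector. -/
theorem exists_isClosedImmersion_dualNumber [JacobsonSpace X] [AlgebraicGeometry.IsReduced Y]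
    (π : X ⟶ Y) [IsFinite π] (hπ : IsResidualUniversalHomeomorphism π) (hiso : ¬ IsIso π) :
    ∃ y : Y, IsClosed ({y} : Set Y) ∧
      ∃ i : Spec (CommRingCat.of (DualNumber (Y.residueField y))) ⟶ X, IsClosedImmersion i ∧
        dualNumberSection _ ≫ i ≫ π = Y.fromSpecResidueField y ∧
        i ≫ π = dualNumberProj _ ≫ dualNumberSection _ ≫ i ≫ π := by
  have := hπ.isUniversalHomeomorphism.universallyInjective
  have : Surjective π := ⟨hπ.isUniversalHomeomorphism.isHomeomorph.surjective⟩
  obtain ⟨U, hU, hFU⟩ : ∃ U : Y.Opens, IsAffineOpen U ∧ ¬ (π.app U).hom.FormallyUnramified := by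
    by_contra! H
    have := formallyUnramified_of_forall_app π H
    exact hiso (isIso_of_formallyUnramified π)
  have hB : IsAffineOpen (π ⁻¹ᵁ U) := hU.preimage π
  have hfin : (π.app U).hom.Finite := π.finite_app U hU
  let _ := (π.app U).hom.toAlgebra
  have : Module.Finite Γ(Y, U) Γ(X, π ⁻¹ᵁ U) := hfin
  obtain ⟨n, hn, D, hD⟩ := exists_derivation_of_not_formallyUnramified
    (A := Γ(Y, U)) (B := Γ(X, π ⁻¹ᵁ U)) hFU
  obtain ⟨x, hx, hnx⟩ := exists_evaluation_eq_zero_iff_mem hB n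
  have hx' : π x ∈ U := hx
  have := hπ.isIso_residueFieldMap x
  let ψ : Γ(X, π ⁻¹ᵁ U) ⟶ Y.residueField (π x) := X.evaluation _ x hx ≫ inv (π.residueFieldMap x)
  have hψA : π.app U ≫ ψ = Y.evaluation U (π x) hx' := by
    have h1 : π.app U ≫ X.evaluation _ x hx = Y.evaluation U (π x) hx' ≫ π.residueFieldMap x :=
      (Scheme.evaluation_naturality π x hx').symm
    rw [← Category.assoc, h1, Category.assoc, IsIso.hom_inv_id, Category.comp_id]
  have hψn (b : Γ(X, π ⁻¹ᵁ U)) : b ∈ n ↔ ψ.hom b = 0 := by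
    rw [hnx]
    exact (map_eq_zero (inv (π.residueFieldMap x)).hom).symm
  have hmax : (n.comap (algebraMap Γ(Y, U) Γ(X, π ⁻¹ᵁ U))).IsMaximal :=
    Ideal.isMaximal_comap_of_isIntegral_of_isMaximal n
  -- The contracted ideal is maximal, so denominators are inverted modulo it, and the values of
  -- sections exhaust the residue field.
  have hψs (k : Y.residueField (π x)) : ∃ a, ψ.hom (π.app U a) = k := by
    have hψA' (a) : ψ.hom (π.app U a) = Y.evaluation U (π x) hx' a := congr($hψA a)
    obtain ⟨s, a, hs, hk⟩ := exists_evaluation_mul_eq hU (π x) hx' k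
    have hsn : s ∉ n.comap (algebraMap Γ(Y, U) Γ(X, π ⁻¹ᵁ U)) := fun h ↦
      hs ((hψA' s).symm.trans ((hψn _).1 h))
    obtain ⟨t, ht⟩ := hmax.exists_inv hsn
    obtain ⟨m, hm, htm⟩ := ht
    have h1 : Y.evaluation U (π x) hx' t * Y.evaluation U (π x) hx' s = 1 := by
      have h2 := congrArg (Y.evaluation U (π x) hx') htm
      rw [map_add, map_mul, map_one, (hψA' m).symm.trans ((hψn _).1 hm), add_zero] at h2
      exact h2
    refine ⟨a * t, ?_⟩
    rw [hψA', map_mul, ← hk, mul_assoc, mul_comm (Y.evaluation U (π x) hx' s), h1, mul_one]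
  obtain ⟨φ, hφs, hφ, hφA⟩ := exists_surjective_dualNumber hD ψ.hom hψn hψs
  let i : Spec (CommRingCat.of (DualNumber (Y.residueField (π x)))) ⟶ X :=
    Spec.map (CommRingCat.ofHom φ) ≫ hB.fromSpec
  have hsec : dualNumberSection (Y.residueField (π x)) ≫ i = Spec.map ψ ≫ hB.fromSpec := by
    rw [← Category.assoc, ← Spec.map_comp]
    congr 2
    exact CommRingCat.hom_ext (RingHom.ext fun b ↦ hφ b)
  have hBU : hB.fromSpec ≫ π = Spec.map (π.app U) ≫ hU.fromSpec := by
    rw [Scheme.Hom.app_eq_appLE]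
    exact (hU.SpecMap_appLE_fromSpec π hB le_rfl).symm
  have h1 : dualNumberSection (Y.residueField (π x)) ≫ i ≫ π = Y.fromSpecResidueField (π x) := by
    rw [← Category.assoc, hsec, Category.assoc, hBU, ← Category.assoc, ← Spec.map_comp, hψA,
      SpecMap_evaluation_fromSpec]
  have h2 : i ≫ π = dualNumberProj _ ≫ dualNumberSection _ ≫ i ≫ π := by
    rw [h1, ← SpecMap_evaluation_fromSpec hU (π x) hx', ← hψA, Category.assoc, hBU, ← Category.assoc,
      ← Category.assoc, ← Spec.map_comp, ← Spec.map_comp]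
    congr 2
    exact CommRingCat.hom_ext (RingHom.ext fun a ↦ hφA a)
  have hcl : IsClosedImmersion (Spec.map (CommRingCat.ofHom φ)) :=
    IsClosedImmersion.spec_of_surjective _ hφs
  -- The image is a single locally closed point, and such points are closed in a Jacobson space.
  have hrange : IsClosed (Set.range i) := by
    have : Nonempty (Spec (CommRingCat.of (DualNumber (Y.residueField (π x))))) :=
      ⟨dualNumberSection _ (IsLocalRing.closedPoint (Y.residueField (π x)))⟩
    have : Subsingleton (Spec (CommRingCat.of (DualNumber (Y.residueField (π x))))) :=
      subsingleton_primeSpectrum_dualNumber _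
    obtain ⟨w⟩ := ‹Nonempty _›
    have hw : Set.range i = {i w} := Set.eq_singleton_iff_unique_mem.2
      ⟨⟨w, rfl⟩, by rintro _ ⟨w', rfl⟩; rw [Subsingleton.elim w w']⟩
    have hloc : IsLocallyClosed (Set.range i) := i.isLocallyClosed_range
    rw [hw] at hloc ⊢
    exact isClosed_singleton_of_isLocallyClosed_singleton hloc
  have hi : IsClosedImmersion i := .of_isPreimmersion _ hrange
  refine ⟨π x, ?_, i, hi, h1, h2⟩
  have : IsIntegralHom (dualNumberSection (Y.residueField (π x)) ≫ i ≫ π) := inferInstance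
  rw [← Y.range_fromSpecResidueField, ← h1]
  exact (Scheme.Hom.isClosedMap _).isClosed_range

end Step

section Step

variable {X Y : Scheme.{u}}

/-- A finite universal homeomorphism of reduced schemes with trivial residue field extensions that
is not an isomorphism factors through the push-out along a tangent vector. -/
theorem exists_isDualNumberPushout [JacobsonSpace X] [AlgebraicGeometry.IsReduced X]
    [AlgebraicGeometry.IsReduced Y] (π : X ⟶ Y) [IsFinite π]
    (hπ : IsResidualUniversalHomeomorphism π) (hiso : ¬ IsIso π) :
    ∃ (X' : Scheme.{u}) (g : X ⟶ X') (h : X' ⟶ Y), g ≫ h = π ∧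
      IsResidualUniversalHomeomorphism h ∧ AlgebraicGeometry.IsReduced X' ∧ Surjective g ∧
      IsDualNumberPushout g ∧ ∃ y : Y, ∀ U : Y.Opens, IsAffineOpen U → y ∈ U →
        ¬ Function.Surjective (g.app (h ⁻¹ᵁ U)) := by
  obtain ⟨y, hy, i, hi, hsec, hcomm⟩ := exists_isClosedImmersion_dualNumber π hπ hiso
  let K := Y.residueField y
  have hcl : IsClosedImmersion (dualNumberSection K ≫ i ≫ π) := by
    rw [hsec]
    exact isClosed_singleton_iff_isClosedImmersion.1 hy
  obtain ⟨X', g, h, rfl, hh, hred, hsurj, H, hsec'⟩ := exists_isPushout i (dualNumberProj K)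
    (dualNumberSection K) (dualNumberSection_proj K) π hπ hcomm
  have := hh.isUniversalHomeomorphism.isIntegralHom
  have hcl' : IsClosedImmersion ((dualNumberSection K ≫ i ≫ g) ≫ h) := by
    simpa only [Category.assoc] using hcl
  have hj : IsClosedImmersion (dualNumberSection K ≫ i ≫ g) := IsClosedImmersion.of_comp _ h
  refine ⟨X', g, h, rfl, hh, hred, hsurj,
    isDualNumberPushout_of_isPushout K i (dualNumberSection K ≫ i ≫ g) H, y, fun U hU hyU hs ↦ ?_⟩
  let D := (dualNumberSection K ≫ i ≫ g) ⁻¹ᵁ h ⁻¹ᵁ U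
  have hD : D = ⊤ := by
    refine eq_top_iff.2 fun s _ ↦ ?_
    have h1 : (dualNumberSection K ≫ i ≫ g ≫ h) s = y := by
      rw [hsec]
      exact Y.fromSpecResidueField_apply y s
    have h2 : (dualNumberSection K ≫ i ≫ g ≫ h) s ∈ U := h1 ▸ hyU
    exact h2
  have e : dualNumberProj K ⁻¹ᵁ D = i ⁻¹ᵁ g ⁻¹ᵁ h ⁻¹ᵁ U := by
    change _ = (i ≫ g ≫ h) ⁻¹ᵁ U
    rw [hcomm]
    rfl
  -- If all sections of `X` came from `X'`, every function on `Spec K[ε]` would be constant, since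
  -- sections of `X'` restrict to constants there.
  refine not_surjective_app_dualNumberProj K hD fun w ↦ ?_
  have hA : IsAffineOpen (g ⁻¹ᵁ h ⁻¹ᵁ U) := hU.preimage (g ≫ h)
  obtain ⟨s, hs'⟩ : ∃ s, i.appLE (g ⁻¹ᵁ h ⁻¹ᵁ U) (dualNumberProj K ⁻¹ᵁ D) e.le s = w := by
    have h1 := i.app_surjective _ hA
    have h2 : i.appLE (g ⁻¹ᵁ h ⁻¹ᵁ U) (dualNumberProj K ⁻¹ᵁ D) e.le =
      i.app _ ≫ (Spec (CommRingCat.of (DualNumber K))).presheaf.map (eqToHom e).op := rfl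
    obtain ⟨s, hs⟩ := h1 ((Spec (CommRingCat.of (DualNumber K))).presheaf.map (eqToHom e.symm).op w)
    refine ⟨s, ?_⟩
    rw [h2, CommRingCat.comp_apply, hs, ← CommRingCat.comp_apply, ← Functor.map_comp, ← op_comp,
      eqToHom_trans, eqToHom_refl, op_id, CategoryTheory.Functor.map_id, CommRingCat.id_apply]
  obtain ⟨r, rfl⟩ := hs s
  obtain ⟨t, ht⟩ := hsec' hU r
  exact ⟨t, (ht e.le).symm.trans hs'⟩

end Step

/-! ### Termination of the pinching process. -/

section Termination

/-- Subrings containing the image of `A` are `A`-submodules, and they embed in the ordered set of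
submodules of the Artinian quotient. -/
theorem wellFoundedLT_subring_of_isArtinian {A B : Type*} [CommRing A] [CommRing B] [Algebra A B]
    [IsArtinian A (B ⧸ LinearMap.range (Algebra.linearMap A B))] :
    WellFoundedLT (Set.Ici (algebraMap A B).range) := by
  let N₀ := LinearMap.range (Algebra.linearMap A B)
  let F : Set.Ici (algebraMap A B).range → Submodule A B := fun S ↦
    { S.1.toAddSubgroup.toAddSubmonoid with
      smul_mem' := fun a b hb ↦ by
        rw [Algebra.smul_def]
        exact S.1.mul_mem (S.2 ⟨a, rfl⟩) hb }
  have hF (S) : N₀ ≤ F S := by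
    rintro _ ⟨a, rfl⟩
    exact S.2 ⟨a, rfl⟩
  have hmono : StrictMono fun S ↦ (F S).map N₀.mkQ := by
    refine Monotone.strictMono_of_injective (fun S T h ↦ Submodule.map_mono h) fun S T h ↦ ?_
    have h1 := congrArg (Submodule.comap N₀.mkQ) h
    simp only [Submodule.comap_map_mkQ, sup_eq_right.2 (hF _)] at h1
    exact Subtype.ext (SetLike.ext fun b ↦ SetLike.ext_iff.1 h1 b)
  exact hmono.wellFoundedLT

theorem HasConductor.wellFoundedLT_subring {N S : Scheme.{u}} {ν : N ⟶ S} {V : S.Opens}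
    (h : HasConductor ν V) : WellFoundedLT (Set.Ici (ν.app V).hom.range) := by
  have := h.isNoetherianRing
  have hfin := h.finite
  let _ := (ν.app V).hom.toAlgebra
  have : Module.Finite Γ(S, V) Γ(N, ν ⁻¹ᵁ V) := hfin
  obtain ⟨f, hf, hfN⟩ := h.exists_conductor
  have : IsArtinian Γ(S, V)
      (Γ(N, ν ⁻¹ᵁ V) ⧸ LinearMap.range (Algebra.linearMap Γ(S, V) Γ(N, ν ⁻¹ᵁ V))) := by
    refine isArtinian_of_smul_eq_zero hf fun x ↦ ?_
    obtain ⟨b, rfl⟩ := Submodule.mkQ_surjective _ x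
    rw [← map_smul]
    refine (Submodule.Quotient.mk_eq_zero _).2 ?_
    obtain ⟨r, hr⟩ := hfN b
    exact ⟨r, hr⟩
  exact wellFoundedLT_subring_of_isArtinian (A := Γ(S, V)) (B := Γ(N, ν ⁻¹ᵁ V))

variable {N X X' C : Scheme.{u}} {ν : N ⟶ C}

theorem le_preimage_of_comp_eq {g : N ⟶ X} {π : X ⟶ C} (e : g ≫ π = ν) (U : C.Opens) :
    ν ⁻¹ᵁ U ≤ g ⁻¹ᵁ π ⁻¹ᵁ U := by
  rw [← e]
  rfl

/-- The sections of `N` that come from `X`, for a factorization `N ⟶ X ⟶ C`. -/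
noncomputable def sectionsOfFactorization {g : N ⟶ X} {π : X ⟶ C} (e : g ≫ π = ν) (U : C.Opens) :
    Set.Ici (ν.app U).hom.range :=
  ⟨(g.appLE (π ⁻¹ᵁ U) (ν ⁻¹ᵁ U) (le_preimage_of_comp_eq e U)).hom.range, by
    subst e
    rintro _ ⟨r, rfl⟩
    exact ⟨π.app U r, congr($((g.app_eq_appLE (U := π ⁻¹ᵁ U)).symm) (π.app U r))⟩⟩

theorem sectionsOfFactorization_comp_le {g : N ⟶ X} {g₀ : X ⟶ X'} {h : X' ⟶ C}
    (e : (g ≫ g₀) ≫ h = ν) (e' : g ≫ g₀ ≫ h = ν) (U : C.Opens) :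
    sectionsOfFactorization e U ≤ sectionsOfFactorization e' U := by
  subst e'
  rintro _ ⟨r, rfl⟩
  refine ⟨g₀.app (h ⁻¹ᵁ U) r, ?_⟩
  exact (congrArg _ (by rw [Scheme.Hom.app_eq_appLE])).trans (appLE_appLE g g₀ le_rfl _ _ r)

theorem surjective_app_of_sectionsOfFactorization_le {g : N ⟶ X} {g₀ : X ⟶ X'} {h : X' ⟶ C}
    [Surjective g] [AlgebraicGeometry.IsReduced X] (e : (g ≫ g₀) ≫ h = ν) (e' : g ≫ g₀ ≫ h = ν)
    {U : C.Opens} (hle : sectionsOfFactorization e' U ≤ sectionsOfFactorization e U) :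
    Function.Surjective (g₀.app (h ⁻¹ᵁ U)) := by
  subst e'
  intro s
  obtain ⟨r, hr⟩ := hle ⟨s, rfl⟩
  refine ⟨r, injective_app_of_surjective g ((g₀ ≫ h) ⁻¹ᵁ U) ?_⟩
  rw [Scheme.Hom.app_eq_appLE]
  refine Eq.trans ?_ hr
  exact (congrArg _ (by rw [Scheme.Hom.app_eq_appLE])).trans (appLE_appLE g g₀ le_rfl _ _ r)

/-- Well-founded induction on the subrings of sections of `N` coming from `X`, taken over a finite
affine cover of `C`. Each pinching shrinks the subring strictly over a member of the cover that
contains the pinched point. -/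
theorem isDualNumberPushoutChain_of_not_isIso [CompactSpace C] [IsLocallyNoetherian C]
    [AlgebraicGeometry.IsReduced C] [JacobsonSpace C] [IsFinite ν]
    (H : ∀ U : C.Opens, IsAffineOpen U → HasConductor ν U) (g : N ⟶ X) (π : X ⟶ C)
    (e : g ≫ π = ν) [Surjective g] [AlgebraicGeometry.IsReduced X]
    (hπ : IsResidualUniversalHomeomorphism π) (hiso : ¬ IsIso π) : IsDualNumberPushoutChain π := by
  let 𝒰 := C.affineCover.finiteSubcover
  let U (j : 𝒰.I₀) : C.Opens := (𝒰.f j).opensRange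
  have hU (j) : IsAffineOpen (U j) := isAffineOpen_opensRange _
  have hwf (j : 𝒰.I₀) : WellFoundedLT (Set.Ici (ν.app (U j)).hom.range) :=
    (H _ (hU j)).wellFoundedLT_subring
  obtain ⟨m, hm⟩ : ∃ m : ∀ j, Set.Ici (ν.app (U j)).hom.range,
      m = fun j ↦ sectionsOfFactorization e (U j) := ⟨_, rfl⟩
  induction m using WellFoundedLT.induction generalizing X with | ind m ih
  have := hπ.isUniversalHomeomorphism.isIntegralHom
  have : IsFinite (g ≫ π) := e ▸ ‹_›
  have : IsFinite π := isFinite_of_comp g π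
  have : JacobsonSpace X := LocallyOfFiniteType.jacobsonSpace π
  obtain ⟨X', g₀, h, rfl, hh, hred, hsurj, hdual, y, hy⟩ := exists_isDualNumberPushout π hπ hiso
  -- When nothing is left to pinch, the remaining isomorphism is absorbed into the last push-out.
  by_cases hisoh : IsIso h
  · exact .single _ (hdual.comp_isIso h)
  · have e' : (g ≫ g₀) ≫ h = ν := (Category.assoc _ _ _).trans e
    refine .cons g₀ h hdual (ih _ ?_ (g ≫ g₀) h e' hh hisoh rfl)
    subst hm
    refine lt_of_le_not_ge (fun j ↦ sectionsOfFactorization_comp_le e' e (U j)) fun hle ↦ ?_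
    obtain ⟨j, x, rfl⟩ := 𝒰.exists_eq y
    exact hy (U j) (hU j) ⟨x, rfl⟩ (surjective_app_of_sectionsOfFactorization_le e' e (hle j))

end Termination

/-! ### The factorisation theorem. -/

section Main

theorem isFinite_normalisationMap {κ : Type u} [Field κ] {C : Scheme.{u}}
    [AlgebraicGeometry.IsReduced C] [AlgebraicGeometry.IsNoetherian C]
    (p : C ⟶ Spec (CommRingCat.of κ)) [LocallyOfFiniteType p] (hdim : topologicalKrullDim C ≤ 1) :
    IsFinite (normalisationMap C) where
  finite_app _ hU :=
    (hasConductor_of_comp_eq_normalisationMap C p hdim (normalisationMap C) (𝟙 C)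
      (Category.comp_id _) (@isUniversalHomeomorphism_of_isIntegralHom _ _ (𝟙 C) _ _ _) hU).finite

end Main

theorem mainTheorem4 (κ : Type u) [Field κ] (C : Scheme.{u}) [AlgebraicGeometry.IsReduced C]
    (p : C ⟶ Spec (CommRingCat.of κ)) [LocallyOfFiniteType p] [QuasiCompact p]
    (hC : IsPurelyOneDimensional C) :
    haveI : AlgebraicGeometry.IsNoetherian C := isNoetherian_of_finiteType p
    (∃ (Csn : Scheme.{u}) (ς : Csn ⟶ C), IsSeminormalisation ς) ∧
    ∀ (Csn : Scheme.{u}) (ς : Csn ⟶ C), IsSeminormalisation ς →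
      (¬ IsSeminormal C → IsDualNumberPushoutChain ς) ∧
      ∃ σ : normalisation C ⟶ Csn,
        (σ ≫ ς = normalisationMap C ∧
          ∀ τ : normalisation C ⟶ Csn, τ ≫ ς = normalisationMap C → τ = σ) ∧
        (∃ Z : TopologicalSpace.Closeds Csn, (Z : Set Csn) = nonRegularLocus Csn ∧
          IsPushout
            (pullback.fst σ (reducedSubschemeMap Csn Z))
            (pullback.snd σ (reducedSubschemeMap Csn Z))
            σ (reducedSubschemeMap Csn Z)) ∧
        ∀ y : Csn, AlgebraicGeometry.IsReduced (σ.fiber y) := by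
  have : AlgebraicGeometry.IsNoetherian C := isNoetherian_of_finiteType p
  have hdim : topologicalKrullDim C ≤ 1 :=
    topologicalKrullDim_le_of_irreducibleComponents fun Z hZ ↦ (hC Z hZ).le
  have hν : IsFinite (normalisationMap C) := isFinite_normalisationMap p hdim
  have hC' : JacobsonSpace C := LocallyOfFiniteType.jacobsonSpace p
  refine ⟨?_, fun Csn ς hς ↦ ?_⟩
  · obtain ⟨Csn, -, ς, -, -, hς⟩ := exists_isSeminormalisation C
    exact ⟨Csn, ς, hς⟩
  obtain ⟨σ, e, hσ⟩ := hς.exists_isGluedFactorization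
  have hς' := hς.isResidualUniversalHomeomorphism
  have := hς'.isUniversalHomeomorphism.isIntegralHom
  have := hς'.isUniversalHomeomorphism.universallyInjective
  have := hσ.surjective
  have := hσ.isReduced
  have hfin : IsFinite (σ ≫ ς) := e ▸ hν
  have : IsFinite σ :=
    MorphismProperty.of_postcomp (W := @IsFinite) (W' := @IsSeparated) σ ς inferInstance hfin
  have H (y : Csn) : ∃ V, IsAffineOpen V ∧ y ∈ V ∧ HasConductor σ V := by
    obtain ⟨U, hU⟩ := SectionSubrings.exists_affine_mem (ς y)
    exact ⟨ς ⁻¹ᵁ U.toOpens, U.2.preimage ς, hU, hasConductor_of_comp_eq_normalisationMap C p hdim σ ς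
      e hς'.isUniversalHomeomorphism U.2⟩
  refine ⟨fun hsn ↦ ?_, σ, ⟨e, fun τ hτ ↦ ?_⟩, ?_, isReduced_fiber hσ H⟩
  · refine isDualNumberPushoutChain_of_not_isIso (ν := normalisationMap C) (fun _ hU ↦ ?_) σ ς e hς'
      fun hiso ↦ hsn (isSeminormal_of_isGluedFactorization e hσ)
    exact hasConductor_of_comp_eq_normalisationMap C p hdim (normalisationMap C) (𝟙 C)
      (Category.comp_id _) (@isUniversalHomeomorphism_of_isIntegralHom _ _ (𝟙 C) _ _ _) hU
  · exact eq_of_comp_eq_of_universallyInjective (hτ.trans e.symm)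
  · exact ⟨⟨nonRegularLocus Csn, isClosed_nonRegularLocus H⟩, rfl,
      isPushout_nonRegularLocus hσ H _ rfl⟩
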